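/- Let $(M,g)$ be a smooth Hausdorff pseudo-Riemannian manifold of dimension $n$ and arbitrary signature, $U\subseteq M$ open, and $X_1,\dots,X_n$ a smooth orthonormal frame on $U$, $g(X_a,X_b)=\eta_a\delta_{ab}$, $\eta_a=\pm1$ (every point has such a neighbourhood, and all statements are local). Let $e^a$ be the dual coframe; indices are raised and lowered with $g$ and repeated indices are summed. Let $\nabla$ be the Levi-Civita connection, $d=e^a\wedge\nabla_a$, $\delta=-X^a\lrcorner\nabla_a$, let $\pi$ be the degree operator on inhomogeneous forms ($\pi\omega=p\,\omega$ on $p$-forms), and let juxtaposition denote the Clifford product of forms, $e^ae^b+e^be^a=2g^{ab}$, with commutator $[\cdot,\cdot]$. Put $s=\prod_a\eta_a$ and $\varepsilon=e^1\wedge\dots\wedge e^n$; $\varepsilon\omega$ (Clifford product) is the Hodge dual of $\omega$ up to sign. A conformal Killing–Yano form is a smooth solution of $\nabla_a\omega-\frac1{\pi+1}X_a\lrcorner d\omega+\frac1{n-\pi+1}e_a\wedge\delta\omega=0$; it is KY if $\delta\omega=0$ and CCKY if $d\omega=0$. Let the Clifford algebra act on a nonzero finite-dimensional space $S$ of spinors,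 $\gamma^a$ being the action of $e^a$; spinor fields over $U$ are smooth maps $\psi:U\to S$, with $\nabla_a\psi=X_a[\psi]+\frac14\omega_{abc}\gamma^b\gamma^c\psi$, $\omega_{abc}=g(X_b,\nabla_{X_a}X_c)$. Define $$K_\omega=(X^a\lrcorner\omega)\nabla_a+\tfrac{\pi-1}{2\pi}d\omega,\qquad M_\omega=(e^a\wedge\omega)\nabla_a-\tfrac{n-\pi-1}{2(n-\pi)}\delta\omega .$$ *Killing–Yano brackets.* For odd KY forms $\kappa,\lambda,\mu$ and even CCKY forms $\alpha,\beta,\omega$, the KY brackets $[\kappa,\lambda]_{KY}$, $[\mu,\omega]_{KY}$, $[\alpha,\beta]_{KY}$ are, respectively, an odd KY form, an even CCKY form without part of degree $n$, and an odd KY form such that, as operators on spinor fields over $U$, $$[K_\kappa,K_\lambda]=K_{[\kappa,\lambda]_{KY}},\quad [K_\mu,M_\omega]=M_{[\mu,\omega]_{KY}},\quad [M_\alpha,M_\beta]=K_{[\alpha,\beta]_{KY}},$$ whenever such forms exist. The explicit KY brackets, defined without any such condition, are $$[\kappa,\lambda]_{KY}=\tfrac1\pi e_b\wedge B^b(\kappa,\lambda),\quad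 [\mu,\omega]_{KY}=\tfrac1{n-\pi}X_b\lrcorner B^b(\mu,\omega),\quad [\alpha,\beta]_{KY}=\tfrac1\pi e_b\wedge B^b(\alpha,\beta),$$ where $B^b(\sigma,\tau)=\sigma^a\nabla_a\tau^b-\tau^a\nabla_a\sigma^b+[\sigma^b,\tilde\tau]+[\tilde\sigma,\tau^b]$ with $\sigma^a=X^a\lrcorner\sigma$, $\tilde\sigma=\frac{\pi-1}{2\pi}d\sigma$ for KY forms $\sigma$ and $\sigma^a=e^a\wedge\sigma$, $\tilde\sigma=-\frac{n-\pi-1}{2(n-\pi)}\delta\sigma$ for CCKY forms $\sigma$ (here $\nabla e^a=0$ and $\nabla X_a=0$, $a$ being a tensor index). *Schouten–Nijenhuis bracket.* For a $p$-form $\sigma$ and a $q$-form $\tau$, $$\tfrac{(p+q-1)!}{p!\,q!}[\sigma,\tau]_{SN}=(X^a\lrcorner\sigma)\wedge\nabla_a\tau+(-1)^{pq}(X^a\lrcorner\tau)\wedge\nabla_a\sigma .$$ **Proposition.** Let $\kappa,\lambda,\mu$ be KY forms on $U$, homogeneous of odd degrees $p,q,r$, and let $\alpha,\beta,\omega$ be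 CCKY forms on $U$, homogeneous of even degrees $a,b,c$, with $a,b\le n$ and $c<n$. 1. If $[X^a\lrcorner\kappa,X_a\lrcorner\lambda]=0$ on $U$, then $$[\kappa,\lambda]_{KY}=\frac{(p+q-2)!}{(p-1)!\,(q-1)!}\,[\kappa,\lambda]_{SN}.$$ 2. If $[X^a\lrcorner\mu,e_a\wedge\omega]=0$ on $U$, then $$[\mu,\omega]_{KY}=s\,(-1)^{\lfloor n/2\rfloor}\,\frac{(r+n-c-2)!}{(r-1)!\,(n-c-1)!}\;\varepsilon\,[\mu,\varepsilon\omega]_{SN}.$$ 3. If $n$ is odd and $[e^a\wedge\alpha,e_a\wedge\beta]=0$ on $U$, then $$[\alpha,\beta]_{KY}=s\,(-1)^{\lfloor (n-1)/2\rfloor}\,\frac{(2n-a-b-2)!}{(n-a-1)!\,(n-b-1)!}\,[\varepsilon\alpha,\varepsilon\beta]_{SN}.$$ In each case the equality holds on $U$ both for the explicit KY bracket and for every form that is the KY bracket in the sense of the operator identities. -/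

import Mathlib

open scoped Manifold ContDiff

noncomputable section

namespace KillingYano

/-! ### Inhomogeneous forms in an orthonormal coframe

With respect to an orthonormal coframe `e^a` an inhomogeneous antisymmetric form at a point is an
element of the exterior algebra of `ℝⁿ` (the covectors `α_a e^a`); the wedge product is the
multiplication of that algebra. -/

/-- Inhomogeneous antisymmetric forms, in components with respect to a coframe. -/
abbrev Form (n : ℕ) : Type := ExteriorAlgebra ℝ (Fin n → ℝ)

instance Form.instFinite (n : ℕ) : Module.Finite ℝ (Form n) := by
  classical
  have h : Module.Finite ℝ
      (DirectSum ℕ fun i => ⋀[ℝ]^i (Fin n → ℝ)) := by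
    have hbot : ∀ i, n < i → ∀ w : ⋀[ℝ]^i (Fin n → ℝ), w = 0 := by
      intro i hi w
      have h0 : Module.finrank ℝ (⋀[ℝ]^i (Fin n → ℝ)) = 0 := by
        rw [exteriorPower.finrank_eq, Module.finrank_fin_fun]
        exact Nat.choose_eq_zero_of_lt hi
      have := Module.finrank_zero_iff.1 h0
      exact Subsingleton.elim _ _
    let f : (∀ i : Fin (n + 1), ⋀[ℝ]^(i : ℕ) (Fin n → ℝ)) →ₗ[ℝ]
        DirectSum ℕ fun i => ⋀[ℝ]^i (Fin n → ℝ) :=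
      ∑ i : Fin (n + 1), (DirectSum.lof ℝ ℕ (fun i => ⋀[ℝ]^i (Fin n → ℝ)) i).comp
        (LinearMap.proj i)
    refine Module.Finite.of_surjective f ?_
    intro w
    refine ⟨fun i => w i, ?_⟩
    ext j : 1
    simp only [f, LinearMap.sum_apply, LinearMap.comp_apply, LinearMap.proj_apply]
    rw [DFinsupp.finsetSum_apply]
    by_cases hj : j < n + 1
    · rw [Finset.sum_eq_single (⟨j, hj⟩ : Fin (n + 1))]
      · exact DirectSum.lof_apply ..
      · intro b _ hb
        exact DirectSum.of_eq_of_ne _ _ _ (fun h => hb (Fin.ext h.symm))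
      · simp
    · rw [hbot j (by omega) (w j)]
      exact hbot j (by omega) _
  exact Module.Finite.equiv
    (DirectSum.decomposeLinearEquiv (fun i : ℕ => ⋀[ℝ]^i (Fin n → ℝ))).symm

variable {n : ℕ}

/-- The coframe 1-form `e^a`. -/
def e (a : Fin n) : Form n := ExteriorAlgebra.ι ℝ (Pi.single a 1)

/-- The contraction `X_a ⌟ ω` with the frame vector dual to `e^a` (in the first index). -/
def hook (a : Fin n) (w : Form n) : Form n :=
  CliffordAlgebra.contractLeft (LinearMap.proj a : Module.Dual ℝ (Fin n → ℝ)) w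

/-- The degree-`p` part of an inhomogeneous form. -/
def degPart (p : ℕ) (w : Form n) : Form n :=
  GradedRing.proj (fun i : ℕ => ⋀[ℝ]^i (Fin n → ℝ)) p w

/-- The function `f(π)` of the degree operator `π`: multiplies the degree-`p` part by `f p`. -/
def degFun (f : ℕ → ℝ) (w : Form n) : Form n :=
  ∑ p ∈ Finset.range (n + 1), f p • degPart p w

/-- The Levi-Civita form `ε = e^1 ∧ ⋯ ∧ e^n` of the orthonormal coframe. -/
def eps : Form n := ExteriorAlgebra.ιMulti ℝ n fun a : Fin n => (Pi.single a 1 : Fin n → ℝ)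

/-- The quadratic form `α ↦ g^{ab} α_a α_b` on covectors, where `g^{ab} = diag(η_a)`. -/
def quadForm (η : Fin n → ℝ) : QuadraticForm ℝ (Fin n → ℝ) :=
  QuadraticMap.weightedSumSquares ℝ η

/-- The standard linear isomorphism of the exterior algebra with the Clifford algebra. -/
def toClifford (η : Fin n → ℝ) : Form n ≃ₗ[ℝ] CliffordAlgebra (quadForm η) :=
  (CliffordAlgebra.equivExterior (quadForm η)).symm

/-- The Clifford product `α β` of two forms, transported to the exterior algebra. -/
def cmul (η : Fin n → ℝ) (α β : Form n) : Form n :=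
  (toClifford η).symm (toClifford η α * toClifford η β)

/-- The Clifford commutator of two forms. -/
def ccomm (η : Fin n → ℝ) (α β : Form n) : Form n := cmul η α β - cmul η β α

/-- Contraction with a raised index, `X^a ⌟ ω`. -/
def hookUp (η : Fin n → ℝ) (a : Fin n) (w : Form n) : Form n := η a • hook a w

/-- The 1-form with a lowered index, `e_a`. -/
def eDown (η : Fin n → ℝ) (a : Fin n) : Form n := η a • e a

/-! ### Smoothness and directional derivatives of maps into a finite-dimensional space -/

section Calculus

variable {M : Type*} [TopologicalSpace M] [ChartedSpace (EuclideanSpace ℝ (Fin n)) M]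

/-- Linear coordinates on a finite-dimensional real vector space. -/
def coords (V : Type*) [AddCommGroup V] [Module ℝ V] [Module.Finite ℝ V] :
    V ≃ₗ[ℝ] (Fin (Module.finrank ℝ V) → ℝ) :=
  (Module.finBasis ℝ V).equivFun

/-- Smoothness on `U` of a map to a finite-dimensional vector space. -/
def SmoothOn (n : ℕ) {M : Type*} [TopologicalSpace M]
    [ChartedSpace (EuclideanSpace ℝ (Fin n)) M] {V : Type*} [AddCommGroup V] [Module ℝ V] [Module.Finite ℝ V]
    (U : Set M) (f : M → V) : Prop :=
  ContMDiffOn (𝓡 n) 𝓘(ℝ, Fin (Module.finrank ℝ V) → ℝ) ∞ (fun y => coords V (f y)) U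

/-- The derivative of a vector-valued map along a tangent vector. -/
def dirDeriv {V : Type*} [AddCommGroup V] [Module ℝ V] [Module.Finite ℝ V]
    (f : M → V) (x : M) (v : TangentSpace (𝓡 n) x) : V :=
  (coords V).symm
    (mfderiv (𝓡 n) 𝓘(ℝ, Fin (Module.finrank ℝ V) → ℝ) (fun y => coords V (f y)) x v)

end Calculus

/-! ### Pseudo-Riemannian metrics and orthonormal frames -/

/-- A smooth pseudo-Riemannian metric, of arbitrary signature. -/
structure PseudoRiemannianMetric (n : ℕ) (M : Type*) [TopologicalSpace M]
    [ChartedSpace (EuclideanSpace ℝ (Fin n)) M] [IsManifold (𝓡 n) ∞ M] where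
  val : ∀ x : M, TangentSpace (𝓡 n) x →L[ℝ] TangentSpace (𝓡 n) x →L[ℝ] ℝ
  symm : ∀ x v w, val x v w = val x w v
  nondegenerate : ∀ x v, (∀ w, val x v w = 0) → v = 0
  smooth : ContMDiff (𝓡 n)
    ((𝓡 n).prod 𝓘(ℝ, EuclideanSpace ℝ (Fin n) →L[ℝ] EuclideanSpace ℝ (Fin n) →L[ℝ] ℝ)) ∞
    (fun x => Bundle.TotalSpace.mk'
      (EuclideanSpace ℝ (Fin n) →L[ℝ] EuclideanSpace ℝ (Fin n) →L[ℝ] ℝ) x (val x))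

variable {M : Type*} [TopologicalSpace M] [ChartedSpace (EuclideanSpace ℝ (Fin n)) M]
  [IsManifold (𝓡 n) ∞ M]

/-- A smooth orthonormal frame `X_1, …, X_n` on the set `U`, with `g(X_a, X_b) = η_a δ_{ab}`,
`η_a = ±1`. -/
structure OrthonormalFrame (g : PseudoRiemannianMetric n M) (U : Set M) where
  X : Fin n → ∀ x : M, TangentSpace (𝓡 n) x
  η : Fin n → ℝ
  sign : ∀ a, η a = 1 ∨ η a = -1
  smooth : ∀ a, ContMDiffOn (𝓡 n) (𝓡 n).tangent ∞
    (fun x => (⟨x, X a x⟩ : TangentBundle (𝓡 n) M)) U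
  orthonormal : ∀ x ∈ U, ∀ a b, g.val x (X a x) (X b x) = if a = b then η a else 0

namespace OrthonormalFrame

variable {g : PseudoRiemannianMetric n M} {U : Set M} (F : OrthonormalFrame g U)

/-- The product `s` of the signs in the signature. -/
def signature : ℝ := ∏ a, F.η a

/-- The Ricci coefficients `ω_{abc} = g(X_b, ∇_{X_a} X_c)` of the Levi-Civita connection, given by
the Koszul formula in the orthonormal frame. -/
def conn (a b c : Fin n) (x : M) : ℝ :=
  (1 / 2) * (g.val x (VectorField.mlieBracket (𝓡 n) (F.X a) (F.X c) x) (F.X b x)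
    - g.val x (VectorField.mlieBracket (𝓡 n) (F.X c) (F.X b) x) (F.X a x)
    + g.val x (VectorField.mlieBracket (𝓡 n) (F.X b) (F.X a) x) (F.X c x))

/-- The Levi-Civita derivative of a form, `∇_a α = X_a[α] - ω_a{}^b{}_c e^c ∧ (X_b ⌟ α)`. -/
def nabla (a : Fin n) (α : M → Form n) (x : M) : Form n :=
  dirDeriv α x (F.X a x) - ∑ b, ∑ c, (F.η b * F.conn a b c x) • (e c * hook b (α x))

/-- The exterior derivative `d = e^a ∧ ∇_a`. -/
def extD (α : M → Form n) (x : M) : Form n := ∑ a, e a * F.nabla a α x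

/-- The co-differential `δ = - X^a ⌟ ∇_a`. -/
def coD (α : M → Form n) (x : M) : Form n := -∑ a, hookUp F.η a (F.nabla a α x)

/-- Conformal Killing-Yano forms on `U`: smooth solutions of
`∇_a ω - (π + 1)⁻¹ X_a ⌟ dω + (n - π + 1)⁻¹ e_a ∧ δω = 0`. -/
def IsCKY (w : M → Form n) : Prop :=
  SmoothOn n U w ∧ ∀ x ∈ U, ∀ a,
    F.nabla a w x - degFun (fun p => 1 / ((p : ℝ) + 1)) (hook a (F.extD w x))
      + degFun (fun p => 1 / ((n : ℝ) - p + 1)) (eDown F.η a * F.coD w x) = 0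

/-- Killing-Yano forms: co-closed conformal Killing-Yano forms. -/
def IsKY (w : M → Form n) : Prop := F.IsCKY w ∧ ∀ x ∈ U, F.coD w x = 0

/-- Closed conformal Killing-Yano forms. -/
def IsCCKY (w : M → Form n) : Prop := F.IsCKY w ∧ ∀ x ∈ U, F.extD w x = 0

end OrthonormalFrame

/-- `ω` is a homogeneous form of degree `p` on `U`. -/
def HasDegree (U : Set M) (p : ℕ) (w : M → Form n) : Prop :=
  ∀ x ∈ U, w x ∈ ⋀[ℝ]^p (Fin n → ℝ)

/-- `ω` is an odd inhomogeneous form on `U`. -/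
def IsOddForm (U : Set M) (w : M → Form n) : Prop :=
  ∀ x ∈ U, ∀ k, Even k → degPart k (w x) = 0

/-- `ω` is an even inhomogeneous form on `U`. -/
def IsEvenForm (U : Set M) (w : M → Form n) : Prop :=
  ∀ x ∈ U, ∀ k, Odd k → degPart k (w x) = 0

namespace OrthonormalFrame

variable {g : PseudoRiemannianMetric n M} {U : Set M} (F : OrthonormalFrame g U)

/-! ### First-order operators on spinors

`ρ` is a representation of the Clifford algebra on a space `S` of spinors (`γ^a = ρ(e^a)`); in the
spin frame over `U` determined by `X_a`, spinor fields are maps `ψ : M → S`. -/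

variable {S : Type*} [AddCommGroup S] [Module ℝ S] [Module.Finite ℝ S]

/-- The spin connection `∇_a ψ = X_a[ψ] + ¼ ω_{abc} γ^b γ^c ψ`. -/
def spinNabla (ρ : CliffordAlgebra (quadForm F.η) →ₐ[ℝ] Module.End ℝ S)
    (a : Fin n) (ψ : M → S) (x : M) : S :=
  dirDeriv ψ x (F.X a x) + (1 / 4 : ℝ) • ∑ b, ∑ c, F.conn a b c x •
    ρ (toClifford F.η (e b) * toClifford F.η (e c)) (ψ x)

/-- The first-order operator `s^a ∇_a + t` on spinors. -/
def firstOrderOp (ρ : CliffordAlgebra (quadForm F.η) →ₐ[ℝ] Module.End ℝ S)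
    (s : Fin n → M → Form n) (t : M → Form n) (ψ : M → S) (x : M) : S :=
  ∑ a, ρ (toClifford F.η (s a x)) (F.spinNabla ρ a ψ x) + ρ (toClifford F.η (t x)) (ψ x)

/-- The form `ω^a = X^a ⌟ ω` with one vector index. -/
def symbK (w : M → Form n) (a : Fin n) (x : M) : Form n := hookUp F.η a (w x)

/-- The form `(π - 1) / (2π) dω`. -/
def zeroK (w : M → Form n) (x : M) : Form n :=
  degFun (fun p => ((p : ℝ) - 1) / (2 * p)) (F.extD w x)

/-- The form `ω^a = e^a ∧ ω` with one vector index. -/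
def symbM (_F : OrthonormalFrame g U) (w : M → Form n) (a : Fin n) (x : M) : Form n := e a * w x

/-- The form `-(n - π - 1) / (2(n - π)) δω`. -/
def zeroM (w : M → Form n) (x : M) : Form n :=
  -degFun (fun p => ((n : ℝ) - p - 1) / (2 * ((n : ℝ) - p))) (F.coD w x)

/-- `K_ω = X^a ⌟ ω ∇_a + (π - 1) / (2π) dω`. -/
def opK (ρ : CliffordAlgebra (quadForm F.η) →ₐ[ℝ] Module.End ℝ S) (w : M → Form n) :
    (M → S) → M → S :=
  F.firstOrderOp ρ (F.symbK w) (F.zeroK w)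

/-- `M_ω = e^a ∧ ω ∇_a - (n - π - 1) / (2(n - π)) δω`. -/
def opM (ρ : CliffordAlgebra (quadForm F.η) →ₐ[ℝ] Module.End ℝ S) (w : M → Form n) :
    (M → S) → M → S :=
  F.firstOrderOp ρ (F.symbM w) (F.zeroM w)

/-- The operator identity `[A, B] = C` on smooth spinor fields on `U`. -/
def CommutatorEq (_F : OrthonormalFrame g U) (A B C : (M → S) → M → S) : Prop :=
  ∀ ψ : M → S, SmoothOn n U ψ → ∀ x ∈ U, A (B ψ) x - B (A ψ) x = C ψ x

/-- `φ` is the Killing-Yano bracket of two odd KY forms: `φ` is an odd KY form with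
`[K_κ, K_λ] = K_φ`. -/
def IsBracketKK (ρ : CliffordAlgebra (quadForm F.η) →ₐ[ℝ] Module.End ℝ S)
    (κ lam φ : M → Form n) : Prop :=
  F.IsKY φ ∧ IsOddForm U φ ∧ F.CommutatorEq (F.opK ρ κ) (F.opK ρ lam) (F.opK ρ φ)

/-- `φ` is the Killing-Yano bracket of an odd KY form and an even CCKY form: `φ` is an even CCKY
form with `[K_μ, M_ω] = M_φ`. Since `M` vanishes on `n`-forms, `φ` is normalized to have no part of
degree `n`. -/
def IsBracketKM (ρ : CliffordAlgebra (quadForm F.η) →ₐ[ℝ] Module.End ℝ S)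
    (μ w φ : M → Form n) : Prop :=
  F.IsCCKY φ ∧ IsEvenForm U φ ∧ (∀ x ∈ U, degPart n (φ x) = 0) ∧
    F.CommutatorEq (F.opK ρ μ) (F.opM ρ w) (F.opM ρ φ)

/-- `φ` is the Killing-Yano bracket of two even CCKY forms: `φ` is an odd KY form with
`[M_α, M_β] = K_φ`. -/
def IsBracketMM (ρ : CliffordAlgebra (quadForm F.η) →ₐ[ℝ] Module.End ℝ S)
    (α β φ : M → Form n) : Prop :=
  F.IsKY φ ∧ IsOddForm U φ ∧ F.CommutatorEq (F.opM ρ α) (F.opM ρ β) (F.opK ρ φ)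

/-! ### Explicit Killing-Yano brackets

The expression in braces is the coefficient of `∇_b` in the commutator of `s^a ∇_a + s̃` and
`t^a ∇_a + t̃`. The explicit brackets make sense without any condition on the forms. -/

/-- `s^a (∇_a t^b) - t^a (∇_a s^b) + [s^b, t̃] + [s̃, t^b]`, where `ds a b = ∇_a s^b`. -/
def firstOrderCoeff (η : Fin n → ℝ) (s : Fin n → Form n) (ds : Fin n → Fin n → Form n)
    (s0 : Form n) (t : Fin n → Form n) (dt : Fin n → Fin n → Form n) (t0 : Form n)
    (b : Fin n) : Form n :=
  ∑ a, (cmul η (s a) (dt a b) - cmul η (t a) (ds a b)) + ccomm η (s b) t0 + ccomm η s0 (t b)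

/-- `∇_a (X^b ⌟ ω) = X^b ⌟ ∇_a ω`. -/
def dsymbK (w : M → Form n) (x : M) (a b : Fin n) : Form n := hookUp F.η b (F.nabla a w x)

/-- `∇_a (e^b ∧ ω) = e^b ∧ ∇_a ω`. -/
def dsymbM (w : M → Form n) (x : M) (a b : Fin n) : Form n := e b * F.nabla a w x

/-- `[κ, λ]_KY = π⁻¹ e_b ∧ {κ^a ∇_a λ^b - λ^a ∇_a κ^b + [κ^b, λ̃] + [κ̃, λ^b]}`. -/
def bracketKK (κ lam : M → Form n) (x : M) : Form n :=
  degFun (fun p => 1 / (p : ℝ)) (∑ b, eDown F.η b *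
    firstOrderCoeff F.η (fun a => F.symbK κ a x) (F.dsymbK κ x) (F.zeroK κ x)
      (fun a => F.symbK lam a x) (F.dsymbK lam x) (F.zeroK lam x) b)

/-- `[μ, ω]_KY = (n - π)⁻¹ X_b ⌟ {μ^a ∇_a ω^b - ω^a ∇_a μ^b + [μ^b, ω̃] + [μ̃, ω^b]}`. -/
def bracketKM (μ w : M → Form n) (x : M) : Form n :=
  degFun (fun p => 1 / ((n : ℝ) - p)) (∑ b, hook b
    (firstOrderCoeff F.η (fun a => F.symbK μ a x) (F.dsymbK μ x) (F.zeroK μ x)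
      (fun a => F.symbM w a x) (F.dsymbM w x) (F.zeroM w x) b))

/-- `[α, β]_KY = π⁻¹ e_b ∧ {α^a ∇_a β^b - β^a ∇_a α^b + [α^b, β̃] + [α̃, β^b]}`. -/
def bracketMM (α β : M → Form n) (x : M) : Form n :=
  degFun (fun p => 1 / (p : ℝ)) (∑ b, eDown F.η b *
    firstOrderCoeff F.η (fun a => F.symbM α a x) (F.dsymbM α x) (F.zeroM α x)
      (fun a => F.symbM β a x) (F.dsymbM β x) (F.zeroM β x) b)

/-! ### Traced conditions -/

/-- `[X^a ⌟ κ, X_a ⌟ λ] = 0` on `U` (summed over `a`). -/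
def TraceKK (κ lam : M → Form n) : Prop :=
  ∀ x ∈ U, ∑ a, ccomm F.η (hookUp F.η a (κ x)) (hook a (lam x)) = 0

/-- `[X^a ⌟ μ, e_a ∧ ω] = 0` on `U` (summed over `a`). -/
def TraceKM (μ w : M → Form n) : Prop :=
  ∀ x ∈ U, ∑ a, ccomm F.η (hookUp F.η a (μ x)) (eDown F.η a * w x) = 0

/-- `[e^a ∧ α, e_a ∧ β] = 0` on `U` (summed over `a`). -/
def TraceMM (α β : M → Form n) : Prop :=
  ∀ x ∈ U, ∑ a, ccomm F.η (e a * α x) (eDown F.η a * β x) = 0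

/-! ### Schouten-Nijenhuis bracket and Hodge duality -/

/-- The Schouten-Nijenhuis bracket of a `p`-form and a `q`-form:
`(p+q-1)!/(p! q!) [α, β]_SN = (X^a ⌟ α) ∧ ∇_a β + (-1)^{pq} (X^a ⌟ β) ∧ ∇_a α`. -/
def snBracket (p q : ℕ) (α β : M → Form n) (x : M) : Form n :=
  ((p.factorial * q.factorial : ℝ) / (p + q - 1).factorial) •
    (∑ a, hookUp F.η a (α x) * F.nabla a β x
      + (-1 : ℝ) ^ (p * q) • ∑ a, hookUp F.η a (β x) * F.nabla a α x)

/-- The Hodge dual `ε ω`: Clifford multiplication from the left by the Levi-Civita form. -/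
def dual (w : M → Form n) (x : M) : Form n := cmul F.η eps (w x)

end OrthonormalFrame

end KillingYano

end

/-! Case 1 is a computation at a point. A KY form of degree p satisfies ∇_a κ = (p+1)⁻¹ X_a ⌟ dκ, so
the explicit bracket depends only on κ, λ, dκ and dλ. The Clifford product is a series Σ_k (1/k!) x
∧_k y in the number k of contractions (`cmul_eq_sum`), and e_b ∧ X^b ⌟ merely counts free indices.
Hence the bracket becomes a sum of terms κ ∧_k dλ and λ ∧_k dκ with explicit coefficients
(`sum_e_mul_firstOrderCoeff`). The coefficient at k = 0 vanishes, and k = 1 is the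
Schouten-Nijenhuis expression.

The trace condition removes k ≥ 2. By degree separation it says κ ∧_m λ = 0 for every even m ≥ 2
(`cw_eq_zero_of_trace`). Its covariant derivative (`cw_nabla`), wedged with e^c, relates the two
families at k = m (`cw_relation_even`). Contracted with X^c, it relates them at k = m + 1
(`cw_relation_odd`). Both relations are exactly what makes the terms cancel.

Cases 2 and 3 follow by duality. Clifford multiplication by ε sends CCKY forms to KY forms
(`IsCCKY.isKY_dual`) and turns the coefficients of M_ω into those of K_{εω}, up to one common sign.
It commutes with even forms, and with all forms when n is odd. Since ε² = s(-1)^⌊n/2⌋ = ±1, the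
duality can be undone, which produces the sign in the result.

A form φ defined by an operator identity equals the explicit bracket because the first-order symbol
of a commutator is determined. A spinor representation may have a kernel, but no nonzero form of
definite parity lies in it (`eq_zero_of_spinAct_eq_zero`), so the identity lifts to form-valued
functions f·1. Test functions vanishing at a point then isolate the coefficient of ∇_b
(`symbol_of_commutator`), and φ is recovered from X^b ⌟ φ or e^b ∧ φ by inverting π or n - π. -/

namespace KillingYano

noncomputable section

/-! ### Exterior algebra of the coframe -/

section FormAlgebra

variable {n : ℕ}

/-- Contraction with a frame vector as a linear map. -/
def hookL (a : Fin n) : Form n →ₗ[ℝ] Form n :=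
  CliffordAlgebra.contractLeft (LinearMap.proj a : Module.Dual ℝ (Fin n → ℝ))

theorem hookL_apply (a : Fin n) (w : Form n) : hookL a w = hook a w := rfl

/-- The grade involution, `(-1)^π`. -/
def inv : Form n →ₐ[ℝ] Form n := CliffordAlgebra.involute

@[simp] theorem hook_zero (a : Fin n) : hook a (0 : Form n) = 0 := map_zero (hookL a)

theorem hook_add (a : Fin n) (v w : Form n) : hook a (v + w) = hook a v + hook a w :=
  map_add (hookL a) v w

theorem hook_sub (a : Fin n) (v w : Form n) : hook a (v - w) = hook a v - hook a w :=
  map_sub (hookL a) v w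

theorem hook_neg (a : Fin n) (w : Form n) : hook a (-w) = -hook a w := map_neg (hookL a) w

theorem hook_smul (a : Fin n) (r : ℝ) (w : Form n) : hook a (r • w) = r • hook a w :=
  map_smul (hookL a) r w

theorem hook_sum {ι : Type*} (a : Fin n) (s : Finset ι) (f : ι → Form n) :
    hook a (∑ i ∈ s, f i) = ∑ i ∈ s, hook a (f i) := map_sum (hookL a) f s

@[simp] theorem hook_one (a : Fin n) : hook a (1 : Form n) = 0 :=
  CliffordAlgebra.contractLeft_one ..

theorem hook_e_mul (a b : Fin n) (w : Form n) :
    hook a (e b * w) = (if a = b then w else 0) - e b * hook a w := by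
  have h := CliffordAlgebra.contractLeft_ι_mul (Q := (0 : QuadraticForm ℝ (Fin n → ℝ)))
    (LinearMap.proj a : Module.Dual ℝ (Fin n → ℝ)) (Pi.single b 1) w
  refine h.trans ?_
  simp only [LinearMap.proj_apply, Pi.single_apply, ite_smul, one_smul, zero_smul]
  rfl

theorem hook_comm (a b : Fin n) (w : Form n) : hook a (hook b w) = -hook b (hook a w) :=
  CliffordAlgebra.contractLeft_comm ..

@[simp] theorem hook_hook_self (a : Fin n) (w : Form n) : hook a (hook a w) = 0 :=
  CliffordAlgebra.contractLeft_contractLeft ..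

@[simp] theorem e_mul_e_self (a : Fin n) : e a * e a = 0 := ExteriorAlgebra.ι_sq_zero _

theorem e_mul_comm (a b : Fin n) : e a * e b = -(e b * e a) := by
  have h := ExteriorAlgebra.ι_add_mul_swap (R := ℝ) (Pi.single a 1 : Fin n → ℝ) (Pi.single b 1)
  exact eq_neg_of_add_eq_zero_left h

theorem e_mul_e_mul (a b : Fin n) (w : Form n) : e a * (e b * w) = -(e b * (e a * w)) := by
  rw [← mul_assoc, e_mul_comm, neg_mul, mul_assoc]

@[simp] theorem e_mul_e_mul_self (a : Fin n) (w : Form n) : e a * (e a * w) = 0 := by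
  rw [← mul_assoc, e_mul_e_self, zero_mul]

theorem ι_eq_sum (v : Fin n → ℝ) : ExteriorAlgebra.ι ℝ v = ∑ a, v a • (e a : Form n) := by
  conv_lhs => rw [← Finset.univ_sum_single v]
  rw [map_sum]
  refine Finset.sum_congr rfl fun a _ => ?_
  rw [e, ← map_smul, ← Pi.single_smul, smul_eq_mul, mul_one]

/-- Forms are generated from `1` by exterior products with the coframe. -/
theorem Form.induction {P : Form n → Prop} (one : P 1) (add : ∀ v w, P v → P w → P (v + w))
    (smul : ∀ (r : ℝ) w, P w → P (r • w)) (mul : ∀ a w, P w → P (e a * w)) (w : Form n) :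
    P w := by
  induction w using CliffordAlgebra.left_induction with
  | algebraMap r => rw [Algebra.algebraMap_eq_smul_one]; exact smul r 1 one
  | add v w hv hw => exact add v w hv hw
  | ι_mul w m hw =>
    have h : CliffordAlgebra.ι 0 m * w = ∑ a, m a • (e a * w) := by
      rw [show CliffordAlgebra.ι 0 m = ExteriorAlgebra.ι ℝ m from rfl, ι_eq_sum, Finset.sum_mul]
      simp only [smul_mul_assoc]
    rw [h]
    have h0 : P 0 := by simpa using smul 0 1 one
    exact Finset.sum_induction _ P add h0 fun a _ => smul _ _ (mul a w hw)

theorem Form.linearMap_ext {V : Type*} [AddCommGroup V] [Module ℝ V] {f g : Form n →ₗ[ℝ] V}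
    (one : f 1 = g 1) (mul : ∀ a w, f w = g w → f (e a * w) = g (e a * w)) : f = g := by
  refine LinearMap.ext fun w => ?_
  induction w using Form.induction with
  | one => exact one
  | add v w hv hw => rw [map_add, map_add, hv, hw]
  | smul r w hw => rw [map_smul, map_smul, hw]
  | mul a w hw => exact mul a w hw

@[simp] theorem inv_e (a : Fin n) : inv (e a) = -e a := CliffordAlgebra.involute_ι _

theorem inv_e_mul (a : Fin n) (w : Form n) : inv (e a * w) = -(e a * inv w) := by
  rw [map_mul, inv_e, neg_mul]

@[simp] theorem inv_inv (w : Form n) : inv (inv w) = w := CliffordAlgebra.involute_involute w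

theorem inv_hook (a : Fin n) (w : Form n) : inv (hook a w) = -hook a (inv w) := by
  have : inv.toLinearMap ∘ₗ hookL a = -(hookL a ∘ₗ inv.toLinearMap) := by
    refine Form.linearMap_ext ?_ fun b w hw => ?_
    · simp [hookL_apply]
    · simp only [LinearMap.comp_apply, hookL_apply, LinearMap.neg_apply,
        AlgHom.toLinearMap_apply] at hw ⊢
      rw [hook_e_mul, map_sub, inv_e_mul, hw, inv_e_mul, hook_neg, hook_e_mul]
      split_ifs <;> simp
  exact LinearMap.congr_fun this w

theorem hook_mul (a : Fin n) (v w : Form n) :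
    hook a (v * w) = hook a v * w + inv v * hook a w := by
  induction v using Form.induction with
  | one => simp
  | add u v hu hv => rw [add_mul, hook_add, hu, hv, hook_add, map_add]; noncomm_ring
  | smul r v hv => rw [smul_mul_assoc, hook_smul, hv, hook_smul, map_smul]; simp
  | mul b v hv =>
    rw [mul_assoc, hook_e_mul, hv, hook_e_mul, inv_e_mul, sub_mul]
    split_ifs <;> noncomm_ring

/-! ### Degrees -/

/-- The degree operator `π = e^a ∧ X_a ⌟`. -/
def degOp : Form n →ₗ[ℝ] Form n := ∑ a, LinearMap.mulLeft ℝ (e a) ∘ₗ hookL a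

theorem degOp_apply (w : Form n) : degOp w = ∑ a, e a * hook a w := by
  simp [degOp, LinearMap.sum_apply, hookL_apply]

/-- Together with `degOp_hook`, this allows degrees to be tracked as eigenvalues of a linear
operator instead of through the grading. -/
theorem degOp_e_mul (b : Fin n) (w : Form n) : degOp (e b * w) = e b * degOp w + e b * w := by
  simp only [degOp_apply, hook_e_mul, mul_sub, Finset.sum_sub_distrib, mul_ite, mul_zero,
    Finset.sum_ite_eq', Finset.mem_univ, if_true]
  rw [sub_eq_add_neg, add_comm, Finset.mul_sum, ← Finset.sum_neg_distrib]
  congr 1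
  exact Finset.sum_congr rfl fun a _ => by rw [e_mul_e_mul, neg_neg]

theorem degOp_hook (b : Fin n) (w : Form n) : degOp (hook b w) = hook b (degOp w) - hook b w := by
  simp only [degOp_apply, hook_sum, hook_e_mul, Finset.sum_sub_distrib,
    Finset.sum_ite_eq, Finset.mem_univ, if_true]
  rw [sub_eq_add_neg, sub_eq_add_neg, add_assoc, add_comm, ← Finset.sum_neg_distrib,
    add_assoc, neg_add_cancel, add_zero]
  exact Finset.sum_congr rfl fun a _ => by rw [hook_comm, mul_neg]

theorem degPart_add (p : ℕ) (v w : Form n) : degPart p (v + w) = degPart p v + degPart p w :=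
  map_add (GradedRing.proj (fun i : ℕ => ⋀[ℝ]^i (Fin n → ℝ)) p) v w

theorem degPart_smul (p : ℕ) (r : ℝ) (w : Form n) : degPart p (r • w) = r • degPart p w := by
  simp only [degPart, GradedRing.proj_apply]
  rw [DirectSum.decompose_smul]
  rfl

/-- The projection to the degree-`p` part as a linear map. -/
def degPartL (p : ℕ) : Form n →ₗ[ℝ] Form n where
  toFun := degPart p
  map_add' := degPart_add p
  map_smul' := degPart_smul p

theorem degPartL_apply (p : ℕ) (w : Form n) : degPartL p w = degPart p w := rfl

theorem degPart_mem (p : ℕ) (w : Form n) : degPart p w ∈ ⋀[ℝ]^p (Fin n → ℝ) :=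
  SetLike.coe_mem _

theorem degPart_of_mem {p : ℕ} {w : Form n} (hw : w ∈ ⋀[ℝ]^p (Fin n → ℝ)) :
    degPart p w = w := by
  rw [degPart, GradedRing.proj_apply]
  exact DirectSum.decompose_of_mem_same (fun i : ℕ => ⋀[ℝ]^i (Fin n → ℝ)) hw

theorem degPart_of_mem_ne {p k : ℕ} {w : Form n} (hw : w ∈ ⋀[ℝ]^p (Fin n → ℝ)) (h : p ≠ k) :
    degPart k w = 0 := by
  rw [degPart, GradedRing.proj_apply]
  exact DirectSum.decompose_of_mem_ne (fun i : ℕ => ⋀[ℝ]^i (Fin n → ℝ)) hw h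

theorem eq_zero_of_mem_of_lt {p : ℕ} {w : Form n} (hw : w ∈ ⋀[ℝ]^p (Fin n → ℝ)) (h : n < p) :
    w = 0 := by
  have h0 : Module.finrank ℝ (⋀[ℝ]^p (Fin n → ℝ)) = 0 := by
    rw [exteriorPower.finrank_eq, Module.finrank_fin_fun]
    exact Nat.choose_eq_zero_of_lt h
  have := Module.finrank_zero_iff.1 h0
  exact congrArg Subtype.val (Subsingleton.elim (⟨w, hw⟩ : ⋀[ℝ]^p (Fin n → ℝ)) 0)

theorem sum_degPart (w : Form n) : ∑ p ∈ Finset.range (n + 1), degPart p w = w := by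
  classical
  conv_rhs => rw [← DirectSum.sum_support_decompose (fun i : ℕ => ⋀[ℝ]^i (Fin n → ℝ)) w]
  symm
  refine Finset.sum_subset_zero_on_sdiff (fun p hp => ?_) (fun p hp => ?_) fun _ _ => rfl
  · by_contra h
    have h2 : n < p := by simpa using h
    rw [DFinsupp.mem_support_toFun] at hp
    exact hp (Subtype.ext (eq_zero_of_mem_of_lt (SetLike.coe_mem _) h2))
  · have := (Finset.mem_sdiff.1 hp).2
    simpa [degPart, GradedRing.proj_apply] using this

theorem mem_one_mul {p : ℕ} (a : Fin n) {w : Form n} (hw : w ∈ ⋀[ℝ]^p (Fin n → ℝ)) :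
    e a * w ∈ ⋀[ℝ]^(p + 1) (Fin n → ℝ) := by
  have h1 : e a ∈ ⋀[ℝ]^1 (Fin n → ℝ) := by
    simp only [pow_one]; exact LinearMap.mem_range_self _ _
  have := SetLike.mul_mem_graded h1 hw
  rwa [add_comm] at this

theorem one_mem_zero : (1 : Form n) ∈ ⋀[ℝ]^0 (Fin n → ℝ) := by
  simp only [pow_zero]; exact Submodule.one_le.1 le_rfl

theorem degPart_e_mul (k : ℕ) (a : Fin n) (w : Form n) :
    degPart (k + 1) (e a * w) = e a * degPart k w := by
  conv_lhs => rw [← sum_degPart w, Finset.mul_sum, ← degPartL_apply, map_sum]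
  simp only [degPartL_apply]
  have : ∀ p, degPart (k + 1) (e a * degPart p w) = if p = k then e a * degPart p w else 0 := by
    intro p
    split_ifs with h
    · subst h; exact degPart_of_mem (mem_one_mul a (degPart_mem _ _))
    · exact degPart_of_mem_ne (mem_one_mul a (degPart_mem _ _)) (by omega)
  simp only [this, Finset.sum_ite_eq']
  split_ifs with h
  · rfl
  · rw [eq_zero_of_mem_of_lt (degPart_mem k w) (by simpa using h), mul_zero]

theorem degPart_zero_e_mul (a : Fin n) (w : Form n) : degPart 0 (e a * w) = 0 := by
  conv_lhs => rw [← sum_degPart w, Finset.mul_sum, ← degPartL_apply, map_sum]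
  exact Finset.sum_eq_zero fun p _ => degPart_of_mem_ne (mem_one_mul a (degPart_mem _ _))
    (by omega)

theorem degPart_degOp (k : ℕ) (w : Form n) : degPart k (degOp w) = (k : ℝ) • degPart k w := by
  induction w using Form.induction generalizing k with
  | one =>
    rw [degOp_apply]
    simp only [hook_one, mul_zero, Finset.sum_const_zero]
    rw [← degPartL_apply, map_zero]
    rcases eq_or_ne 0 k with h | h
    · subst h; simp
    · rw [degPart_of_mem_ne one_mem_zero h, smul_zero]
  | add v w hv hw => rw [map_add, degPart_add, hv, hw, degPart_add, smul_add]
  | smul r w hw => rw [map_smul, degPart_smul, hw, degPart_smul, smul_comm]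
  | mul a w hw =>
    rw [degOp_e_mul, degPart_add]
    cases k with
    | zero => simp [degPart_zero_e_mul]
    | succ k =>
      rw [degPart_e_mul, degPart_e_mul, hw]
      push_cast
      rw [mul_smul_comm, add_smul, one_smul]

theorem degOp_of_mem {p : ℕ} {w : Form n} (hw : w ∈ ⋀[ℝ]^p (Fin n → ℝ)) :
    degOp w = (p : ℝ) • w := by
  rw [← sum_degPart (degOp w)]
  conv_rhs => rw [← sum_degPart w, Finset.smul_sum]
  refine Finset.sum_congr rfl fun k _ => ?_
  rw [degPart_degOp]
  rcases eq_or_ne p k with h | h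
  · rw [h]
  · rw [degPart_of_mem_ne hw h, smul_zero, smul_zero]

/-- The eigenvalue is real so that the lemma also covers values that are not degrees, such as -1 or
p + q - 2k with many contractions. -/
theorem degPart_eq_zero_of_degOp {r : ℝ} {w : Form n} (hw : degOp w = r • w) {k : ℕ}
    (h : r ≠ k) : degPart k w = 0 := by
  have := degPart_degOp k w
  rw [hw, degPart_smul, ← sub_eq_zero, ← sub_smul, smul_eq_zero] at this
  exact this.resolve_left (sub_ne_zero.2 h)

theorem mem_of_degOp {p : ℕ} {w : Form n} (hw : degOp w = (p : ℝ) • w) :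
    w ∈ ⋀[ℝ]^p (Fin n → ℝ) := by
  rw [← sum_degPart w]
  refine Submodule.sum_mem _ fun k _ => ?_
  rcases eq_or_ne p k with h | h
  · rw [h]; exact degPart_mem _ _
  · rw [degPart_eq_zero_of_degOp hw (by exact_mod_cast h)]; exact Submodule.zero_mem _

theorem hook_mem {p : ℕ} (a : Fin n) {w : Form n} (hw : w ∈ ⋀[ℝ]^(p + 1) (Fin n → ℝ)) :
    hook a w ∈ ⋀[ℝ]^p (Fin n → ℝ) := by
  refine mem_of_degOp ?_
  rw [degOp_hook, degOp_of_mem hw, hook_smul]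
  push_cast
  rw [add_smul, one_smul, add_sub_cancel_right]

/-- Contraction lowers the eigenvalue of `degOp` by one, and no form has degree -1. -/
theorem hook_of_mem_zero (a : Fin n) {w : Form n} (hw : w ∈ ⋀[ℝ]^0 (Fin n → ℝ)) :
    hook a w = 0 := by
  have h : degOp (hook a w) = (-1 : ℝ) • hook a w := by
    rw [degOp_hook, degOp_of_mem hw, hook_smul]; simp
  rw [← sum_degPart (hook a w)]
  refine Finset.sum_eq_zero fun k _ => degPart_eq_zero_of_degOp h ?_
  have : (0 : ℝ) ≤ k := k.cast_nonneg
  linarith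

theorem degPart_hook (k : ℕ) (a : Fin n) (w : Form n) :
    degPart k (hook a w) = hook a (degPart (k + 1) w) := by
  conv_lhs => rw [← sum_degPart w, hook_sum, ← degPartL_apply, map_sum]
  simp only [degPartL_apply]
  have : ∀ p, degPart k (hook a (degPart p w)) =
      if p = k + 1 then hook a (degPart p w) else 0 := by
    intro p
    split_ifs with h
    · subst h; exact degPart_of_mem (hook_mem a (degPart_mem _ _))
    · rcases p with _ | p
      · rw [hook_of_mem_zero a (degPart_mem _ _)]; exact (degPartL k).map_zero
      · exact degPart_of_mem_ne (hook_mem a (degPart_mem _ _)) (by omega)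
  simp only [this, Finset.sum_ite_eq']
  split_ifs with h
  · rfl
  · rw [eq_zero_of_mem_of_lt (degPart_mem _ w) (by simpa using h), hook_zero]

theorem inv_of_mem {p : ℕ} {w : Form n} (hw : w ∈ ⋀[ℝ]^p (Fin n → ℝ)) :
    inv w = (-1 : ℝ) ^ p • w := by
  have key : ∀ (w : Form n) (p : ℕ), inv (degPart p w) = (-1 : ℝ) ^ p • degPart p w := by
    intro w
    induction w using Form.induction with
    | one =>
      intro p
      rcases eq_or_ne 0 p with h | h
      · subst h; rw [degPart_of_mem one_mem_zero]; simp
      · rw [degPart_of_mem_ne one_mem_zero h]; simp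
    | add v w hv hw => intro p; rw [degPart_add, map_add, hv, hw, smul_add]
    | smul r w hw => intro p; rw [degPart_smul, map_smul, hw, smul_comm]
    | mul a w hw =>
      intro p
      cases p with
      | zero => simp [degPart_zero_e_mul]
      | succ p => rw [degPart_e_mul, inv_e_mul, hw, pow_succ]; simp
  rw [← degPart_of_mem hw, key]

theorem degFun_of_mem (f : ℕ → ℝ) {p : ℕ} {w : Form n} (hw : w ∈ ⋀[ℝ]^p (Fin n → ℝ)) :
    degFun f w = f p • w := by
  rw [degFun]
  conv_rhs => rw [← sum_degPart w, Finset.smul_sum]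
  refine Finset.sum_congr rfl fun k _ => ?_
  rcases eq_or_ne p k with h | h
  · rw [h]
  · rw [degPart_of_mem_ne hw h, smul_zero, smul_zero]

/-- Functions of the degree operator as linear maps. -/
def degFunL (f : ℕ → ℝ) : Form n →ₗ[ℝ] Form n := ∑ p ∈ Finset.range (n + 1), f p • degPartL p

theorem degFunL_apply (f : ℕ → ℝ) (w : Form n) : degFunL f w = degFun f w := by
  simp [degFunL, degFun, LinearMap.sum_apply, degPartL_apply]

theorem degPart_degFun (f : ℕ → ℝ) (k : ℕ) (w : Form n) :
    degPart k (degFun f w) = f k • degPart k w := by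
  rw [degFun, ← degPartL_apply, map_sum]
  simp only [map_smul, degPartL_apply]
  have : ∀ p, degPart k (degPart p w) = if p = k then degPart p w else 0 := by
    intro p
    split_ifs with h
    · subst h; exact degPart_of_mem (degPart_mem _ _)
    · exact degPart_of_mem_ne (degPart_mem _ _) h
  simp only [this, smul_ite, smul_zero, Finset.sum_ite_eq']
  split_ifs with h
  · rfl
  · rw [eq_zero_of_mem_of_lt (degPart_mem k w) (by simpa using h), smul_zero]

theorem Form.ext_degPart {v w : Form n} (h : ∀ k, degPart k v = degPart k w) : v = w := by
  rw [← sum_degPart v, ← sum_degPart w]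
  exact Finset.sum_congr rfl fun k _ => h k

end FormAlgebra

end

end KillingYano

namespace KillingYano

noncomputable section

/-! ### Clifford product and contracted wedge products -/

section CliffordProduct

variable {n : ℕ} (η : Fin n → ℝ)

/-- The Clifford product as a bilinear map. -/
def cmulL : Form n →ₗ[ℝ] Form n →ₗ[ℝ] Form n :=
  ((LinearMap.mul ℝ (CliffordAlgebra (quadForm η))).compl₁₂
    (toClifford η).toLinearMap (toClifford η).toLinearMap).compr₂ (toClifford η).symm.toLinearMap

theorem cmulL_apply (v w : Form n) : cmulL η v w = cmul η v w := rfl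

theorem toClifford_cmul (v w : Form n) :
    toClifford η (cmul η v w) = toClifford η v * toClifford η w := by
  simp [cmul]

theorem toClifford_one : toClifford η (1 : Form n) = 1 := by
  rw [toClifford, CliffordAlgebra.equivExterior, CliffordAlgebra.changeFormEquiv_symm]
  exact CliffordAlgebra.changeForm_one
    (CliffordAlgebra.changeForm.neg_proof CliffordAlgebra.changeForm.associated_neg_proof)

theorem toClifford_e (a : Fin n) :
    toClifford η (e a) = CliffordAlgebra.ι (quadForm η) (Pi.single a 1) := by
  rw [toClifford, CliffordAlgebra.equivExterior, CliffordAlgebra.changeFormEquiv_symm]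
  exact CliffordAlgebra.changeForm_ι
    (CliffordAlgebra.changeForm.neg_proof CliffordAlgebra.changeForm.associated_neg_proof) _

theorem cmul_assoc (u v w : Form n) : cmul η (cmul η u v) w = cmul η u (cmul η v w) := by
  apply (toClifford η).injective
  simp only [toClifford_cmul, mul_assoc]

@[simp] theorem cmul_one (w : Form n) : cmul η w 1 = w := by
  apply (toClifford η).injective
  rw [toClifford_cmul, toClifford_one, mul_one]

@[simp] theorem one_cmul (w : Form n) : cmul η 1 w = w := by
  apply (toClifford η).injective
  rw [toClifford_cmul, toClifford_one, one_mul]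

theorem cmul_add (u v w : Form n) : cmul η u (v + w) = cmul η u v + cmul η u w :=
  map_add (cmulL η u) v w

theorem cmul_sub (u v w : Form n) : cmul η u (v - w) = cmul η u v - cmul η u w :=
  map_sub (cmulL η u) v w

theorem cmul_neg (u v : Form n) : cmul η u (-v) = -cmul η u v := map_neg (cmulL η u) v

theorem cmul_smul (u : Form n) (r : ℝ) (v : Form n) : cmul η u (r • v) = r • cmul η u v :=
  map_smul (cmulL η u) r v

@[simp] theorem cmul_zero (u : Form n) : cmul η u 0 = 0 := map_zero (cmulL η u)

theorem cmul_sum {ι : Type*} (u : Form n) (s : Finset ι) (f : ι → Form n) :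
    cmul η u (∑ i ∈ s, f i) = ∑ i ∈ s, cmul η u (f i) := map_sum (cmulL η u) f s

theorem add_cmul (u v w : Form n) : cmul η (u + v) w = cmul η u w + cmul η v w :=
  LinearMap.map_add₂ (cmulL η) u v w

theorem sub_cmul (u v w : Form n) : cmul η (u - v) w = cmul η u w - cmul η v w :=
  LinearMap.map_sub₂ (cmulL η) u v w

theorem neg_cmul (u v : Form n) : cmul η (-u) v = -cmul η u v :=
  LinearMap.map_neg₂ (cmulL η) u v

theorem smul_cmul (r : ℝ) (u v : Form n) : cmul η (r • u) v = r • cmul η u v :=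
  LinearMap.map_smul₂ (cmulL η) r u v

@[simp] theorem zero_cmul (u : Form n) : cmul η 0 u = 0 := LinearMap.map_zero₂ (cmulL η) u

theorem sum_cmul {ι : Type*} (s : Finset ι) (f : ι → Form n) (u : Form n) :
    cmul η (∑ i ∈ s, f i) u = ∑ i ∈ s, cmul η (f i) u := by
  simp only [← cmulL_apply, map_sum, LinearMap.sum_apply]

theorem cmul_e (a : Fin n) (w : Form n) : cmul η (e a) w = e a * w + hookUp η a w := by
  -- `equivExterior` is a change of form by the bilinear form associated with `-quadForm η`. On a
  -- coframe covector this is minus the contraction with a raised index; the sign cancels against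
  -- the one in `changeForm_ι_mul`.
  have hB : QuadraticMap.associated (R := ℝ) (-quadForm η) (Pi.single a 1) =
      -(η a • (LinearMap.proj a : Module.Dual ℝ (Fin n → ℝ))) := by
    apply LinearMap.ext
    intro v
    rw [QuadraticMap.associated_apply]
    simp only [quadForm, neg_apply, QuadraticMap.weightedSumSquares_apply,
      LinearMap.neg_apply, LinearMap.smul_apply, LinearMap.proj_apply, smul_eq_mul, Pi.add_apply]
    rw [← Finset.sum_neg_distrib, ← Finset.sum_neg_distrib, ← Finset.sum_neg_distrib,
      ← Finset.sum_sub_distrib, ← Finset.sum_sub_distrib, Finset.sum_eq_single a]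
    · simp; ring
    · intro b _ hb
      simp [Pi.single_eq_of_ne hb]
    · simp
  rw [cmul, toClifford_e]
  simp only [toClifford, LinearEquiv.symm_symm]
  have h := CliffordAlgebra.changeForm_ι_mul
    (CliffordAlgebra.changeForm.associated_neg_proof (Q := quadForm η))
    (Pi.single a 1) ((CliffordAlgebra.equivExterior (quadForm η)).symm w)
  have h2 : CliffordAlgebra.changeForm
      (CliffordAlgebra.changeForm.associated_neg_proof (Q := quadForm η))
      ((CliffordAlgebra.equivExterior (quadForm η)).symm w) = w :=
    (CliffordAlgebra.equivExterior (quadForm η)).apply_symm_apply w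
  rw [h2] at h
  refine h.trans ?_
  rw [hB, map_neg, map_smul, LinearMap.neg_apply, LinearMap.smul_apply, sub_neg_eq_add]
  rfl

/-- Forms are generated from `1` by Clifford products with the coframe. -/
theorem Form.induction_cmul {P : Form n → Prop} (one : P 1)
    (add : ∀ v w, P v → P w → P (v + w)) (smul : ∀ (r : ℝ) w, P w → P (r • w))
    (mul : ∀ a w, P w → P (cmul η (e a) w)) (w : Form n) : P w := by
  suffices h : ∀ x, P ((toClifford η).symm x) by simpa using h (toClifford η w)
  intro x
  induction x using CliffordAlgebra.left_induction with
  | algebraMap r =>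
    rw [Algebra.algebraMap_eq_smul_one, map_smul, ← toClifford_one η, LinearEquiv.symm_apply_apply]
    exact smul r 1 one
  | add v w hv hw => rw [map_add]; exact add _ _ hv hw
  | ι_mul x m hx =>
    have h : (toClifford η).symm (CliffordAlgebra.ι (quadForm η) m * x) =
        ∑ a, m a • cmul η (e a) ((toClifford η).symm x) := by
      apply (toClifford η).injective
      rw [map_sum]
      simp only [map_smul, toClifford_cmul, toClifford_e, LinearEquiv.apply_symm_apply]
      simp only [← smul_mul_assoc, ← map_smul]
      rw [← Finset.sum_mul, ← map_sum]
      congr 2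
      conv_lhs => rw [← Finset.univ_sum_single m]
      refine Finset.sum_congr rfl fun a _ => ?_
      rw [← Pi.single_smul, smul_eq_mul, mul_one]
    rw [h]
    have h0 : P 0 := by simpa using smul 0 1 one
    exact Finset.sum_induction _ P add h0 fun a _ => smul _ _ (mul a _ hx)

theorem inv_cmul (v w : Form n) : inv (cmul η v w) = cmul η (inv v) (inv w) := by
  induction v using Form.induction_cmul η with
  | one => simp
  | add u v hu hv => rw [add_cmul, map_add, hu, hv, map_add, add_cmul]
  | smul r v hv => rw [smul_cmul, map_smul, hv, map_smul, smul_cmul]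
  | mul a v hv =>
    have h : ∀ x : Form n, inv (cmul η (e a) x) = -cmul η (e a) (inv x) := by
      intro x
      rw [cmul_e, cmul_e, map_add, inv_e_mul, hookUp, hookUp, map_smul, inv_hook]
      simp only [smul_neg, neg_add]
    rw [cmul_assoc, h, hv, h, neg_cmul, cmul_assoc]

/-- Right Clifford multiplication by a coframe one-form. -/
theorem cmul_e_right (a : Fin n) (w : Form n) :
    cmul η w (e a) = e a * inv w - hookUp η a (inv w) := by
  induction w using Form.induction_cmul η with
  | one => simp [hookUp]
  | add u v hu hv =>
    rw [add_cmul, hu, hv]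
    simp only [map_add, hookUp, hook_add, mul_add, smul_add]
    abel
  | smul r v hv =>
    rw [smul_cmul, hv]
    simp only [map_smul, hookUp, hook_smul, mul_smul_comm, smul_sub, smul_comm r]
  | mul b v hv =>
    rw [cmul_assoc, hv, inv_cmul, inv_e, neg_cmul, cmul_e, cmul_e]
    simp only [hookUp, mul_sub, hook_sub, hook_e_mul, mul_neg, hook_neg, mul_add, hook_add,
      mul_smul_comm, hook_smul, smul_neg, smul_sub, smul_add]
    rw [e_mul_e_mul b a, hook_comm b a]
    simp only [smul_neg, smul_comm (η b) (η a)]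
    by_cases h : b = a
    · subst h; simp; abel
    · simp [h, Ne.symm h]; abel

theorem e_mul (c : Fin n) (x : Form n) : e c * x = inv x * e c := by
  induction x using Form.induction with
  | one => simp
  | add u v hu hv => rw [mul_add, hu, hv, map_add, add_mul]
  | smul r v hv => rw [mul_smul_comm, hv, map_smul, smul_mul_assoc]
  | mul b v hv => rw [e_mul_e_mul, hv, inv_e_mul, neg_mul, mul_assoc]

/-- Graded commutativity of the exterior product. -/
theorem mul_swap (x y : Form n) :
    y * x = (1 / 2 : ℝ) • (x * y + x * inv y + inv x * y - inv x * inv y) := by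
  -- For homogeneous factors the four terms encode (-1)^{pq} = (1 + (-1)^p + (-1)^q - (-1)^{p+q})/2,
  -- so no homogeneity is needed.
  induction y using Form.induction with
  | one => simp only [map_one, mul_one, one_mul]; module
  | add u v hu hv => rw [add_mul, hu, hv]; simp only [map_add, mul_add]; module
  | smul r v hv => rw [smul_mul_assoc, hv]; simp only [map_smul, mul_smul_comm]; module
  | mul b v hv =>
    have h1 : e b * (inv x) = x * e b := by rw [e_mul, inv_inv]
    rw [mul_assoc, hv, inv_e_mul, mul_smul_comm]
    simp only [mul_sub, mul_add, mul_neg, ← mul_assoc, h1]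
    simp only [e_mul b x]
    congr 1
    abel

/-! ### Contracted wedge products and the Clifford product -/

/-- The iterated contraction `x ∧_k y` of Clifford type: up to signs
`x_{a_1 … a_k} ∧ y^{a_1 … a_k}`. -/
def cw : ℕ → Form n →ₗ[ℝ] Form n →ₗ[ℝ] Form n
  | 0 => LinearMap.mul ℝ (Form n)
  | k + 1 => ∑ a, (cw k).compl₁₂ (inv.toLinearMap ∘ₗ hookL a) (η a • hookL a)

theorem cw_zero (x y : Form n) : cw η 0 x y = x * y := rfl

theorem cw_succ (k : ℕ) (x y : Form n) :
    cw η (k + 1) x y = ∑ a, η a • cw η k (inv (hook a x)) (hook a y) := by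
  simp [cw, LinearMap.sum_apply, hookL_apply]

/-- The grade involution in each step of `cw` absorbs the signs, so contraction is an antiderivation
of every contracted product, exactly as for the wedge product. -/
theorem hook_cw (c : Fin n) (k : ℕ) (x y : Form n) :
    hook c (cw η k x y) = cw η k (hook c x) y + cw η k (inv x) (hook c y) := by
  induction k generalizing x y with
  | zero => exact hook_mul c x y
  | succ k ih =>
    simp only [cw_succ, hook_sum, hook_smul, ih, smul_add, Finset.sum_add_distrib, inv_inv]
    congr 1
    · refine Finset.sum_congr rfl fun a _ => ?_
      rw [hook_comm a c, map_neg, inv_hook c, neg_neg]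
    · refine Finset.sum_congr rfl fun a _ => ?_
      rw [hook_comm c a, inv_hook a, inv_inv]
      simp

/-- Either the new covector stays free or one of the k contractions uses it; the k choices agree,
whence the factor k. At k = 0 that factor makes the truncated index k - 1 harmless. -/
theorem cw_e_mul (c : Fin n) (k : ℕ) (x y : Form n) :
    cw η k (e c * x) y = e c * cw η k x y +
      (k : ℝ) • (η c • cw η (k - 1) (inv x) (hook c y)) := by
  induction k generalizing x y with
  | zero => simp [cw_zero, mul_assoc]
  | succ k ih =>
    have h1 : ∀ a, cw η k (inv (hook a (e c * x))) (hook a y) =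
        (if a = c then cw η k (inv x) (hook a y) else 0) +
          cw η k (e c * inv (hook a x)) (hook a y) := by
      intro a
      rw [hook_e_mul, map_sub, inv_e_mul, sub_neg_eq_add, map_add, LinearMap.add_apply]
      split_ifs <;> simp
    have h2 : (k : ℝ) • cw η k (inv x) (hook c y) =
        (k : ℝ) • ∑ a, η a • cw η (k - 1) (inv (inv (hook a x))) (hook c (hook a y)) := by
      cases k with
      | zero => simp
      | succ k =>
        congr 1
        rw [cw_succ]
        refine Finset.sum_congr rfl fun a _ => ?_
        rw [Nat.add_sub_cancel, hook_comm c a, inv_hook a x, map_neg]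
        simp
    rw [cw_succ]
    simp only [h1, ih, smul_add, Finset.sum_add_distrib, smul_ite, smul_zero,
      Finset.sum_ite_eq', Finset.mem_univ, if_true, cw_succ η k x y, Finset.mul_sum,
      mul_smul_comm]
    rw [add_left_comm, add_right_inj, Nat.add_sub_cancel, Nat.cast_succ, add_smul, one_smul,
      add_comm, add_left_inj, smul_comm, h2, Finset.smul_sum, Finset.smul_sum]
    refine Finset.sum_congr rfl fun a _ => ?_
    simp only [smul_smul]
    congr 1
    ring

/-- The sum counts the indices of x that remain free: of its p indices, k are contracted with y. -/
theorem sum_e_mul_cw_hook_left {p : ℕ} {x : Form n} (hx : x ∈ ⋀[ℝ]^p (Fin n → ℝ)) (k : ℕ)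
    (y : Form n) :
    ∑ c, e c * cw η k (hook c x) y = ((p : ℝ) - k) • cw η k x y := by
  have h : ∑ c, e c * cw η k (hook c x) y =
      cw η k (degOp x) y - (k : ℝ) • cw η k x y := by
    rw [degOp_apply, map_sum, LinearMap.sum_apply]
    simp only [cw_e_mul, Finset.sum_add_distrib, ← Finset.smul_sum]
    cases k with
    | zero => simp
    | succ k => rw [cw_succ η k x y, Nat.add_sub_cancel, add_sub_cancel_right]
  rw [h, degOp_of_mem hx, map_smul, LinearMap.smul_apply, sub_smul]

/-- Again a count of free indices, now those of y; moving the covector past x costs the involution.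
-/
theorem sum_e_mul_cw_hook_right {q : ℕ} {y : Form n} (hy : y ∈ ⋀[ℝ]^q (Fin n → ℝ)) (k : ℕ)
    (x : Form n) :
    ∑ c, e c * cw η k x (hook c y) = ((q : ℝ) - k) • cw η k (inv x) y := by
  induction k generalizing x y q with
  | zero =>
    simp only [cw_zero]
    have : ∀ c, e c * (x * hook c y) = inv x * (e c * hook c y) := fun c => by
      rw [← mul_assoc, e_mul, mul_assoc]
    simp only [this, ← Finset.mul_sum]
    rw [← degOp_apply, degOp_of_mem hy]
    simp
  | succ k ih =>
    simp only [cw_succ, Finset.mul_sum]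
    rw [Finset.sum_comm, Finset.smul_sum]
    refine Finset.sum_congr rfl fun a _ => ?_
    have h1 : ∀ c, e c * η a • cw η k (inv (hook a x)) (hook a (hook c y)) =
        -(η a • (e c * cw η k (inv (hook a x)) (hook c (hook a y)))) := by
      intro c
      rw [hook_comm a c, map_neg, smul_neg, mul_neg, mul_smul_comm]
    simp only [h1, Finset.sum_neg_distrib, ← Finset.smul_sum]
    cases q with
    | zero => simp [hook_of_mem_zero _ hy]
    | succ q =>
      rw [ih (hook_mem a hy), inv_hook a x, inv_hook a (inv x)]
      simp only [map_neg, inv_inv, LinearMap.neg_apply, inv_hook, smul_neg, neg_neg]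
      rw [smul_comm]
      push_cast
      rw [add_sub_add_right_eq_sub]

/-- Each contraction removes one index from either factor. The eigenvalue form avoids truncated
subtraction when 2k > p + q. -/
theorem degOp_cw {p q : ℕ} {x y : Form n} (hx : x ∈ ⋀[ℝ]^p (Fin n → ℝ))
    (hy : y ∈ ⋀[ℝ]^q (Fin n → ℝ)) (k : ℕ) :
    degOp (cw η k x y) = ((p : ℝ) + q - 2 * k) • cw η k x y := by
  rw [degOp_apply]
  simp only [hook_cw, mul_add, Finset.sum_add_distrib]
  rw [sum_e_mul_cw_hook_left η hx, sum_e_mul_cw_hook_right η hy, inv_inv, ← add_smul]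
  congr 1
  ring

theorem cw_eq_zero_of_lt {p k : ℕ} {x : Form n} (hx : x ∈ ⋀[ℝ]^p (Fin n → ℝ)) (h : p < k)
    (y : Form n) : cw η k x y = 0 := by
  induction k generalizing p x y with
  | zero => omega
  | succ k ih =>
    rw [cw_succ]
    refine Finset.sum_eq_zero fun a _ => ?_
    cases p with
    | zero => simp [hook_of_mem_zero a hx]
    | succ p =>
      have h1 := hook_mem a hx
      rw [inv_of_mem h1, map_smul, LinearMap.smul_apply, ih h1 (by omega)]
      simp

theorem cw_eq_zero {k : ℕ} (h : n < k) (x y : Form n) : cw η k x y = 0 := by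
  rw [← sum_degPart x, map_sum, LinearMap.sum_apply]
  exact Finset.sum_eq_zero fun p hp =>
    cw_eq_zero_of_lt η (degPart_mem p x) (by have := Finset.mem_range.1 hp; omega) y

/-- The expansion of the Clifford product into contracted wedge products. -/
theorem cmul_eq_sum (x y : Form n) :
    cmul η x y = ∑ k ∈ Finset.range (n + 1), (k.factorial : ℝ)⁻¹ • cw η k x y := by
  -- A vanishing term is appended because the contraction term of `cw_e_mul` shifts the summation
  -- index by one.
  have hext : ∀ x y : Form n, ∑ k ∈ Finset.range (n + 1), (k.factorial : ℝ)⁻¹ • cw η k x y =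
      ∑ k ∈ Finset.range (n + 2), (k.factorial : ℝ)⁻¹ • cw η k x y := by
    intro x y
    rw [Finset.sum_range_succ _ (n + 1), cw_eq_zero η (by omega), smul_zero, add_zero]
  induction x using Form.induction_cmul η generalizing y with
  | one =>
    rw [one_cmul, Finset.sum_eq_single 0]
    · simp [cw_zero]
    · intro k _ hk
      rw [cw_eq_zero_of_lt η one_mem_zero (by omega), smul_zero]
    · simp
  | add u v hu hv => simp only [add_cmul, hu, hv, map_add, LinearMap.add_apply, smul_add,
      Finset.sum_add_distrib]
  | smul r v hv => simp only [smul_cmul, hv, map_smul, LinearMap.smul_apply, Finset.smul_sum,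
      smul_comm r]
  | mul c x hx =>
    rw [cmul_assoc, hx, cmul_e]
    conv_rhs => rw [cmul_e, hookUp]
    simp only [map_add, LinearMap.add_apply, smul_add, Finset.sum_add_distrib, map_smul,
      LinearMap.smul_apply]
    -- The factor k of `cw_e_mul` turns 1/k! into 1/(k-1)!, so the terms in which e_c meets y form
    -- the same series again.
    have h1 : ∑ k ∈ Finset.range (n + 1), (k.factorial : ℝ)⁻¹ • cw η k (e c * x) y =
        e c * ∑ k ∈ Finset.range (n + 1), (k.factorial : ℝ)⁻¹ • cw η k x y +
          η c • ∑ k ∈ Finset.range (n + 1), (k.factorial : ℝ)⁻¹ • cw η k (inv x) (hook c y) := by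
      rw [hext (e c * x), hext x]
      simp only [cw_e_mul, smul_add, Finset.sum_add_distrib, Finset.mul_sum, mul_smul_comm]
      congr 1
      rw [Finset.sum_range_succ', Finset.smul_sum]
      simp only [Nat.cast_zero, zero_smul, smul_zero, add_zero]
      refine Finset.sum_congr rfl fun k _ => ?_
      rw [Nat.add_sub_cancel, smul_smul, smul_comm _ (η c)]
      congr 2
      rw [Nat.factorial_succ]
      push_cast
      field_simp
    rw [h1, hookUp, hook_sum]
    simp only [hook_smul, hook_cw, smul_add, Finset.sum_add_distrib, Finset.smul_sum,
      smul_comm _ (η c)]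
    abel

/-- Symmetry of the contracted wedge products of forms of definite parity. -/
theorem cw_swap {σ τ : ℝ} {x y : Form n} (hσ : σ ^ 2 = 1) (hτ : τ ^ 2 = 1)
    (hx : inv x = σ • x) (hy : inv y = τ • y) (k : ℕ) :
    cw η k y x = ((-1) ^ k * ((1 + σ + τ - σ * τ) / 2)) • cw η k x y := by
  induction k generalizing x y σ τ with
  | zero =>
    rw [cw_zero, cw_zero, mul_swap, hx, hy]
    simp only [smul_mul_assoc, mul_smul_comm]
    module
  | succ k ih =>
    rw [cw_succ, cw_succ, Finset.smul_sum]
    refine Finset.sum_congr rfl fun a _ => ?_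
    have hx' : inv (hook a x) = (-σ) • hook a x := by rw [inv_hook, hx, hook_smul, neg_smul]
    have hy' : inv (hook a y) = (-τ) • hook a y := by rw [inv_hook, hy, hook_smul, neg_smul]
    rw [hx', hy', map_smul, map_smul, LinearMap.smul_apply, LinearMap.smul_apply,
      ih (by rwa [neg_sq]) (by rwa [neg_sq]) hx' hy']
    simp only [smul_smul]
    congr 1
    have h1 : σ * σ = 1 := by rw [← sq, hσ]
    have h2 : τ * τ = 1 := by rw [← sq, hτ]
    rw [pow_succ]
    linear_combination η a * (-1) ^ k / 2 * (τ * h1 - h1 + σ * h2 + h2)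

end CliffordProduct

end

end KillingYano

namespace KillingYano

noncomputable section

/-! ### The Killing-Yano bracket at a point -/

section PointwiseBracket

open OrthonormalFrame (firstOrderCoeff)

variable {n : ℕ} {η : Fin n → ℝ}

theorem sum_cw_hook_hook (k : ℕ) (x y : Form n) :
    ∑ a, η a • cw η k (hook a x) (hook a y) = -cw η (k + 1) (inv x) y := by
  rw [cw_succ, ← Finset.sum_neg_distrib]
  refine Finset.sum_congr rfl fun a _ => ?_
  rw [inv_hook, inv_inv, map_neg, LinearMap.neg_apply, smul_neg, neg_neg]

/-- The sum over a adds a contraction, so order k - 1 of the Clifford series feeds order k and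
1/(k-1)! = k/k! gives the factor k. The sum over b counts the q + 1 - k indices of y left free. -/
theorem sum_e_mul_cmul_hook_hook {q : ℕ} {y : Form n} (hy : y ∈ ⋀[ℝ]^(q + 1) (Fin n → ℝ))
    (x : Form n) :
    ∑ b, e b * ∑ a, cmul η (hookUp η a x) (hook b (hook a y)) =
      ∑ k ∈ Finset.range (n + 1),
        ((k.factorial : ℝ)⁻¹ * (k * ((q : ℝ) + 1 - k))) • cw η k x y := by
  have h1 : ∀ b, ∑ a, cmul η (hookUp η a x) (hook b (hook a y)) =
      ∑ k ∈ Finset.range (n + 1), (k.factorial : ℝ)⁻¹ • cw η (k + 1) (inv x) (hook b y) := by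
    intro b
    have : ∀ a, cmul η (hookUp η a x) (hook b (hook a y)) =
        -∑ k ∈ Finset.range (n + 1),
          (k.factorial : ℝ)⁻¹ • (η a • cw η k (hook a x) (hook a (hook b y))) := by
      intro a
      rw [hook_comm b a, cmul_neg, cmul_eq_sum, hookUp]
      simp only [map_smul, LinearMap.smul_apply]
    simp only [this, Finset.sum_neg_distrib]
    rw [Finset.sum_comm, ← Finset.sum_neg_distrib]
    refine Finset.sum_congr rfl fun k _ => ?_
    rw [← Finset.smul_sum, sum_cw_hook_hook, smul_neg, neg_neg]
  simp only [h1, Finset.mul_sum, mul_smul_comm]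
  rw [Finset.sum_comm]
  simp only [← Finset.smul_sum, sum_e_mul_cw_hook_right η hy, inv_inv]
  -- The top term would need n + 1 contractions; on the other side the term k = 0 has coefficient
  -- zero. What remains matches after a shift of k.
  rw [Finset.sum_range_succ, cw_eq_zero η (by omega), smul_zero, smul_zero, add_zero,
    Finset.sum_range_succ' _ n]
  simp only [Nat.cast_zero, zero_mul, mul_zero, zero_smul, add_zero, smul_smul]
  refine Finset.sum_congr rfl fun k _ => ?_
  congr 1
  rw [Nat.factorial_succ]
  push_cast
  field_simp

theorem sum_e_mul_cmul_hook_left {p : ℕ} {x : Form n} (hx : x ∈ ⋀[ℝ]^p (Fin n → ℝ))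
    (y : Form n) :
    ∑ b, e b * cmul η (hook b x) y =
      ∑ k ∈ Finset.range (n + 1), ((k.factorial : ℝ)⁻¹ * ((p : ℝ) - k)) • cw η k x y := by
  simp only [cmul_eq_sum, Finset.mul_sum, mul_smul_comm]
  rw [Finset.sum_comm]
  simp only [← Finset.smul_sum, sum_e_mul_cw_hook_left η hx, smul_smul]

theorem sum_e_mul_cmul_hook_right {p : ℕ} {x : Form n} (hx : x ∈ ⋀[ℝ]^p (Fin n → ℝ))
    (y : Form n) :
    ∑ b, e b * cmul η y (hook b x) =
      ∑ k ∈ Finset.range (n + 1), ((k.factorial : ℝ)⁻¹ * ((p : ℝ) - k)) • cw η k (inv y) x := by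
  simp only [cmul_eq_sum, Finset.mul_sum, mul_smul_comm]
  rw [Finset.sum_comm]
  simp only [← Finset.smul_sum, sum_e_mul_cw_hook_right η hx, smul_smul]

theorem neg_one_pow_sq (q : ℕ) : ((-1 : ℝ) ^ q) ^ 2 = 1 := by
  rw [← pow_mul, mul_comm, pow_mul]; simp

variable {p q : ℕ} {x y P L : Form n}

/-- The wedge-trace of the first-order coefficient of the commutator of two operators of
Killing-Yano type, in terms of contracted wedge products. -/
theorem sum_e_mul_firstOrderCoeff (hη : ∀ a, η a * η a = 1) (hp : Odd p)
    (hx : x ∈ ⋀[ℝ]^p (Fin n → ℝ)) (hP : P ∈ ⋀[ℝ]^(p + 1) (Fin n → ℝ))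
    (hy : y ∈ ⋀[ℝ]^q (Fin n → ℝ)) (hL : L ∈ ⋀[ℝ]^(q + 1) (Fin n → ℝ)) (r r' : ℝ) :
    ∑ b, eDown η b * firstOrderCoeff η (fun a => hookUp η a x)
        (fun a b => hookUp η b (r' • hook a P)) ((p / 2 * r') • P)
        (fun a => hookUp η a y) (fun a b => hookUp η b (r • hook a L)) ((q / 2 * r) • L) b =
      ∑ k ∈ Finset.range (n + 1), (k.factorial : ℝ)⁻¹ •
        ((r * (k * (q + 1 - k) + q * (p - k) * ((1 - (-1) ^ k) / 2))) • cw η k x L -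
          (r' * (k * (p + 1 - k) + p * (q - k) * ((1 - (-1) ^ k) / 2))) • cw η k y P) := by
  have hτ := neg_one_pow_sq q
  have hxi : inv x = (-1 : ℝ) • x := by rw [inv_of_mem hx, hp.neg_one_pow]
  have hPi : inv P = (1 : ℝ) • P := by rw [inv_of_mem hP, (hp.add_one).neg_one_pow]
  have hyi : inv y = ((-1 : ℝ) ^ q) • y := inv_of_mem hy
  have hLi : inv L = (-(-1 : ℝ) ^ q) • L := by rw [inv_of_mem hL, pow_succ]; simp
  -- Oddness of p makes the swap sign exactly (-1)^k, whatever the parity of q. Both orderings in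
  -- each commutator are thus expressed by the same contracted product, and only odd k survives
  -- there.
  have hswap1 : ∀ k, cw η k (inv L) x = ((-1 : ℝ) ^ k) • cw η k x L := by
    intro k
    rw [hLi, map_smul, LinearMap.smul_apply,
      cw_swap η (by norm_num) (by rw [neg_sq, hτ]) hxi hLi, smul_smul]
    congr 1
    linear_combination (-1 : ℝ) ^ k * hτ
  have hswap2 : ∀ k, cw η k (inv P) y = ((-1 : ℝ) ^ k) • cw η k y P := by
    intro k
    rw [hPi, one_smul, cw_swap η hτ (by norm_num) hyi hPi]
    congr 1
    ring
  have key : ∀ b, eDown η b * firstOrderCoeff η (fun a => hookUp η a x)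
        (fun a b => hookUp η b (r' • hook a P)) ((p / 2 * r') • P)
        (fun a => hookUp η a y) (fun a b => hookUp η b (r • hook a L)) ((q / 2 * r) • L) b =
      r • (e b * ∑ a, cmul η (hookUp η a x) (hook b (hook a L))) -
      r' • (e b * ∑ a, cmul η (hookUp η a y) (hook b (hook a P))) +
      ((q / 2 * r) • (e b * cmul η (hook b x) L) - (q / 2 * r) • (e b * cmul η L (hook b x))) +
      ((p / 2 * r') • (e b * cmul η P (hook b y)) -
        (p / 2 * r') • (e b * cmul η (hook b y) P)) := by
    intro b
    have h2 : ∀ z : Form n, η b • η b • z = z := fun z => by rw [smul_smul, hη, one_smul]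
    rw [firstOrderCoeff, eDown]
    simp only [ccomm]
    have h3 : ∀ (u v : Form n) (a : Fin n) (t : ℝ), cmul η u (hookUp η b (t • hook a v)) =
        η b • (t • cmul η u (hook b (hook a v))) := by
      intro u v a t
      rw [hookUp, hook_smul, cmul_smul, cmul_smul]
    simp only [h3, Finset.sum_sub_distrib, ← Finset.smul_sum]
    simp only [hookUp, smul_cmul, cmul_smul, mul_add, mul_sub, smul_mul_assoc, mul_smul_comm]
    have h4 : ∀ (t : ℝ) (z : Form n), η b • t • η b • z = t • z := fun t z => by
      rw [smul_comm t, h2]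
    simp only [h2, h4]
  simp only [key, Finset.sum_add_distrib, Finset.sum_sub_distrib, ← Finset.smul_sum]
  rw [sum_e_mul_cmul_hook_hook hL, sum_e_mul_cmul_hook_hook hP, sum_e_mul_cmul_hook_left hx,
    sum_e_mul_cmul_hook_right hx, sum_e_mul_cmul_hook_right hy, sum_e_mul_cmul_hook_left hy]
  simp only [hswap1, hswap2, Finset.smul_sum, ← Finset.sum_sub_distrib,
    ← Finset.sum_add_distrib]
  refine Finset.sum_congr rfl fun k _ => ?_
  module

/-- The derivative of the trace condition relates the contracted wedge products (even case). -/
theorem cw_relation_even (hp : Odd p)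
    (hx : x ∈ ⋀[ℝ]^p (Fin n → ℝ)) (hP : P ∈ ⋀[ℝ]^(p + 1) (Fin n → ℝ))
    (hy : y ∈ ⋀[ℝ]^q (Fin n → ℝ)) (hL : L ∈ ⋀[ℝ]^(q + 1) (Fin n → ℝ)) {r r' : ℝ} {m : ℕ}
    (hm : Even m)
    (H : ∀ c, r' • cw η m (hook c P) y + r • cw η m x (hook c L) = 0) :
    (r * (q + 1 - m)) • cw η m x L = (r' * (p + 1 - m)) • cw η m y P := by
  have hxi : inv x = (-1 : ℝ) • x := by rw [inv_of_mem hx, hp.neg_one_pow]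
  have hPi : inv P = (1 : ℝ) • P := by rw [inv_of_mem hP, (hp.add_one).neg_one_pow]
  -- Wedging with e_c keeps the number of contractions and counts the free indices of the two
  -- derivatives.
  have h : ∑ c, e c * (r' • cw η m (hook c P) y + r • cw η m x (hook c L)) = 0 :=
    Finset.sum_eq_zero fun c _ => by rw [H, mul_zero]
  simp only [mul_add, mul_smul_comm, Finset.sum_add_distrib, ← Finset.smul_sum] at h
  rw [sum_e_mul_cw_hook_left η hP, sum_e_mul_cw_hook_right η hL, hxi,
    cw_swap η (neg_one_pow_sq q) (by norm_num) (inv_of_mem hy) hPi, hm.neg_one_pow, map_smul,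
    LinearMap.smul_apply] at h
  simp only [smul_smul] at h
  push_cast at h
  rw [← sub_eq_zero, ← neg_eq_zero]
  refine Eq.trans ?_ h
  module

/-- The derivative of the trace condition relates the contracted wedge products (odd case). -/
theorem cw_relation_odd (hp : Odd p)
    (hx : x ∈ ⋀[ℝ]^p (Fin n → ℝ)) (hP : P ∈ ⋀[ℝ]^(p + 1) (Fin n → ℝ))
    (hy : y ∈ ⋀[ℝ]^q (Fin n → ℝ)) {r r' : ℝ} {m : ℕ}
    (hm : Even m)
    (H : ∀ c, r' • cw η m (hook c P) y + r • cw η m x (hook c L) = 0) :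
    r • cw η (m + 1) x L = r' • cw η (m + 1) y P := by
  have hxi : inv x = (-1 : ℝ) • x := by rw [inv_of_mem hx, hp.neg_one_pow]
  have hPi : inv P = (1 : ℝ) • P := by rw [inv_of_mem hP, (hp.add_one).neg_one_pow]
  -- Contracting with X^c, instead of wedging, adds one contraction: a double contraction of P or L
  -- vanishes, so the new index must hit the other factor.
  have h : ∑ c, η c • hook c (r' • cw η m (hook c P) y + r • cw η m x (hook c L)) = 0 :=
    Finset.sum_eq_zero fun c _ => by rw [H, hook_zero, smul_zero]
  simp only [hook_add, hook_smul, hook_cw, hook_hook_self, map_zero, LinearMap.zero_apply,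
    zero_add, add_zero, smul_add, Finset.sum_add_distrib, smul_comm (η _) r,
    smul_comm (η _) r', ← Finset.smul_sum] at h
  rw [← cw_succ, sum_cw_hook_hook, hxi, map_smul, LinearMap.smul_apply,
    cw_swap η (neg_one_pow_sq q) (by norm_num) (inv_of_mem hy) hPi,
    hm.add_one.neg_one_pow] at h
  rw [← sub_eq_zero]
  refine Eq.trans ?_ h
  module

theorem cw_one_mem (hx : x ∈ ⋀[ℝ]^p (Fin n → ℝ)) (hL : L ∈ ⋀[ℝ]^(q + 1) (Fin n → ℝ))
    (hpq : 1 ≤ p + q) : cw η 1 x L ∈ ⋀[ℝ]^(p + q - 1) (Fin n → ℝ) := by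
  refine mem_of_degOp ?_
  rw [degOp_cw η hx hL]
  push_cast [Nat.cast_sub hpq]
  congr 1
  ring

/-- The explicit Killing-Yano bracket at a point under the differentiated trace condition. -/
theorem degFun_sum_e_mul_firstOrderCoeff (hη : ∀ a, η a * η a = 1) (hp : Odd p)
    (hx : x ∈ ⋀[ℝ]^p (Fin n → ℝ)) (hP : P ∈ ⋀[ℝ]^(p + 1) (Fin n → ℝ))
    (hy : y ∈ ⋀[ℝ]^q (Fin n → ℝ)) (hL : L ∈ ⋀[ℝ]^(q + 1) (Fin n → ℝ)) {r r' : ℝ}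
    (H : ∀ m, Even m → 2 ≤ m → ∀ c, r' • cw η m (hook c P) y + r • cw η m x (hook c L) = 0) :
    degFun (fun k => 1 / (k : ℝ)) (∑ b, eDown η b * firstOrderCoeff η (fun a => hookUp η a x)
        (fun a b => hookUp η b (r' • hook a P)) ((p / 2 * r') • P)
        (fun a => hookUp η a y) (fun a b => hookUp η b (r • hook a L)) ((q / 2 * r) • L) b) =
      ((p * q : ℝ) / (p + q - 1)) • (∑ a, hookUp η a x * (r • hook a L) +
        (-1 : ℝ) ^ (p * q) • ∑ a, hookUp η a y * (r' • hook a P)) := by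
  have hp1 : 1 ≤ p := hp.pos
  have hxi : inv x = (-1 : ℝ) • x := by rw [inv_of_mem hx, hp.neg_one_pow]
  -- Only k = 1 survives. There q + q(p-1) = pq gives the numerator, and π⁻¹ on degree p + q - 1
  -- gives the denominator.
  rw [sum_e_mul_firstOrderCoeff hη hp hx hP hy hL, Finset.sum_eq_single 1]
  · have h1 : cw η 1 x L = ∑ a, hookUp η a x * hook a L := by
      rw [cw_succ]
      refine Finset.sum_congr rfl fun a _ => ?_
      rw [inv_hook, hxi, hook_smul, cw_zero, hookUp, smul_mul_assoc]
      simp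
    have h2 : cw η 1 y P = (-(-1) ^ q : ℝ) • ∑ a, hookUp η a y * hook a P := by
      rw [cw_succ, Finset.smul_sum]
      refine Finset.sum_congr rfl fun a _ => ?_
      rw [inv_hook, inv_of_mem hy, hook_smul, cw_zero, hookUp, neg_mul, smul_mul_assoc,
        smul_mul_assoc, neg_smul, smul_neg, smul_comm]
    have h3 : (-1 : ℝ) ^ (p * q) = (-1) ^ q := by rw [pow_mul, hp.neg_one_pow]
    have h4 : (1 : ℕ).factorial = 1 := rfl
    have h5 : ∀ z : Form n, z ∈ ⋀[ℝ]^(p + q - 1) (Fin n → ℝ) →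
        degFun (fun k => 1 / (k : ℝ)) z = (1 / ((p : ℝ) + q - 1)) • z := by
      intro z hz
      rw [degFun_of_mem _ hz]
      push_cast [Nat.cast_sub (show 1 ≤ p + q by omega)]
      rfl
    rw [h5 _ (Submodule.smul_mem _ _ (Submodule.sub_mem _
      (Submodule.smul_mem _ _ (cw_one_mem hx hL (by omega)))
      (Submodule.smul_mem _ _ (by
        have := cw_one_mem (η := η) hy hP (by omega); rwa [add_comm q p] at this))))]
    simp only [mul_smul_comm, ← Finset.smul_sum]
    rw [h1, h2, h3, h4]
    simp only [Nat.cast_one, pow_one]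
    match_scalars <;> ring
  · intro k _ hk
    rcases Nat.even_or_odd k with he | ho
    · rcases Nat.eq_zero_or_pos k with h0 | h0
      · subst h0; simp
      · have h2 : 2 ≤ k := by rcases he with ⟨j, rfl⟩; omega
        -- For even k the commutators drop out, and the coefficients left are k times those of the
        -- even relation.
        have := cw_relation_even hp hx hP hy hL he (H k he h2)
        rw [he.neg_one_pow]
        have h3 : ∀ (s u v t : ℝ), s * ((k : ℝ) * t + u * v * ((1 - 1) / 2)) = k * (s * t) :=
          fun s u v t => by ring
        rw [h3, h3, mul_smul, mul_smul (k : ℝ) (r' * _), this, sub_self, smul_zero]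
    · obtain ⟨j, rfl⟩ : ∃ j, k = j + 1 := ⟨k - 1, by have := ho.pos; omega⟩
      have he : Even j := by
        rcases ho with ⟨i, hi⟩; exact ⟨i, by omega⟩
      have := cw_relation_odd (L := L) hp hx hP hy he
        (H j he (by rcases he with ⟨i, rfl⟩; omega))
      rw [ho.neg_one_pow]
      -- For odd k both coefficients reduce to pq + k - k², which is symmetric in p and q; the odd
      -- relation then suffices.
      have e1 : r * (((j + 1 : ℕ) : ℝ) * (q + 1 - (j + 1 : ℕ)) +
          q * (p - (j + 1 : ℕ)) * ((1 - -1) / 2)) =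
          ((p : ℝ) * q + (j + 1 : ℕ) - (j + 1 : ℕ) ^ 2) * r := by ring
      have e2 : r' * (((j + 1 : ℕ) : ℝ) * (p + 1 - (j + 1 : ℕ)) +
          p * (q - (j + 1 : ℕ)) * ((1 - -1) / 2)) =
          ((p : ℝ) * q + (j + 1 : ℕ) - (j + 1 : ℕ) ^ 2) * r' := by ring
      rw [e1, e2, mul_smul, mul_smul, this, sub_self, smul_zero]
  · intro h
    have h1 : n < 1 := by simpa using h
    rw [cw_eq_zero η h1, cw_eq_zero η h1]
    simp

/-- The trace condition is the vanishing of the even contracted wedge products. -/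
theorem cw_eq_zero_of_trace (hp : Odd p)
    (hx : x ∈ ⋀[ℝ]^p (Fin n → ℝ)) (hy : y ∈ ⋀[ℝ]^q (Fin n → ℝ))
    (h : ∑ a, ccomm η (hookUp η a x) (hook a y) = 0) {m : ℕ} (hm : Even m) (hm2 : 2 ≤ m) :
    cw η m x y = 0 := by
  have hxi : inv x = (-1 : ℝ) • x := by rw [inv_of_mem hx, hp.neg_one_pow]
  have hyi : inv y = ((-1 : ℝ) ^ q) • y := inv_of_mem hy
  -- The contraction over a raises the order by one and the commutator keeps odd k only, so exactly
  -- the even orders k + 1 ≥ 2 of x ∧ y remain.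
  have h1 : ∑ a, ccomm η (hookUp η a x) (hook a y) = ∑ k ∈ Finset.range (n + 1),
      ((k.factorial : ℝ)⁻¹ * (1 - (-1) ^ k)) • cw η (k + 1) x y := by
    simp only [ccomm, hookUp, cmul_eq_sum, Finset.sum_sub_distrib, map_smul,
      LinearMap.smul_apply]
    rw [Finset.sum_comm, Finset.sum_comm (s := Finset.univ), ← Finset.sum_sub_distrib]
    refine Finset.sum_congr rfl fun k _ => ?_
    simp only [← Finset.smul_sum, sum_cw_hook_hook]
    rw [hxi, hyi, map_smul, map_smul, LinearMap.smul_apply, LinearMap.smul_apply,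
      cw_swap η (by norm_num) (neg_one_pow_sq q) hxi hyi, pow_succ]
    match_scalars
    linear_combination -(k.factorial : ℝ)⁻¹ * (-1) ^ k * neg_one_pow_sq q
  by_cases hmn : n < m
  · exact cw_eq_zero η hmn x y
  rw [h1] at h
  have hdeg : ∀ k, degOp (cw η k x y) = ((p : ℝ) + q - 2 * k) • cw η k x y :=
    degOp_cw η hx hy
  -- Different numbers of contractions give different degrees p + q - 2k, so each term of the
  -- vanishing sum vanishes by itself.
  refine Form.ext_degPart fun j => ?_
  by_cases hj : (p : ℝ) + q - 2 * m = j
  · have h2 := congrArg (degPartL j) h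
    rw [map_sum, map_zero, Finset.sum_eq_single (m - 1)] at h2
    · rw [Nat.sub_add_cancel (by omega), map_smul, degPartL_apply, smul_eq_zero] at h2
      rw [h2.resolve_left]
      · exact ((degPartL j).map_zero).symm
      · have : Odd (m - 1) := Nat.Even.sub_odd (by omega) hm odd_one
        rw [this.neg_one_pow]
        have := Nat.cast_ne_zero (R := ℝ).2 (m - 1).factorial_ne_zero
        positivity
    · intro k _ hk
      rw [map_smul, degPartL_apply, degPart_eq_zero_of_degOp (hdeg (k + 1)), smul_zero]
      intro h3
      apply hk
      have : ((k + 1 : ℕ) : ℝ) = m := by linarith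
      have : k + 1 = m := by exact_mod_cast this
      omega
    · intro h3
      exact absurd (Finset.mem_range.2 (by omega)) h3
  · rw [degPart_eq_zero_of_degOp (hdeg m) hj]
    exact ((degPartL j).map_zero).symm

end PointwiseBracket

end

end KillingYano

namespace KillingYano

noncomputable section

/-! ### Clifford multiplication by the Levi-Civita form -/

section Hodge

open OrthonormalFrame (firstOrderCoeff)

variable {n : ℕ} {η : Fin n → ℝ}

theorem cmul_e_e_self (a : Fin n) (w : Form n) :
    cmul η (e a) (cmul η (e a) w) = η a • w := by
  rw [cmul_e, cmul_e, hookUp, hookUp]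
  simp [mul_add, hook_add, hook_smul, hook_e_mul, smul_sub]

theorem cmul_e_e_comm {a b : Fin n} (h : a ≠ b) (w : Form n) :
    cmul η (e a) (cmul η (e b) w) = -cmul η (e b) (cmul η (e a) w) := by
  simp only [cmul_e, hookUp, mul_add, hook_add, hook_smul, hook_e_mul, h, h.symm, if_false,
    mul_smul_comm, smul_add, smul_sub, smul_zero]
  rw [e_mul_e_mul a b, hook_comm a b]
  module

/-- Clifford product of the coframe one-forms in a list. -/
def cprod (η : Fin n → ℝ) : List (Fin n) → Form n
  | [] => 1
  | a :: l => cmul η (e a) (cprod η l)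

/-- With distinct labels no contraction term ever arises. The second claim is what the induction
needs in order to discard that term. -/
theorem cprod_spec {l : List (Fin n)} (hl : l.Nodup) :
    cprod η l = (l.map e).prod ∧ ∀ a ∉ l, hook a (cprod η l) = 0 := by
  induction l with
  | nil => exact ⟨rfl, fun a _ => hook_one a⟩
  | cons b l ih =>
    obtain ⟨hb, hl⟩ := List.nodup_cons.1 hl
    obtain ⟨h1, h2⟩ := ih hl
    have h3 : cprod η (b :: l) = e b * cprod η l := by
      rw [cprod, cmul_e, hookUp, h2 b hb, smul_zero, add_zero]
    refine ⟨by rw [h3, h1, List.map_cons, List.prod_cons], fun a ha => ?_⟩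
    rw [h3, hook_e_mul, h2 a (fun h => ha (List.mem_cons_of_mem _ h)),
      if_neg (by rintro rfl; exact ha List.mem_cons_self), mul_zero, sub_zero]

theorem cprod_comm_of_notMem {l : List (Fin n)} {a : Fin n} (ha : a ∉ l) :
    cmul η (cprod η l) (e a) = (-1 : ℝ) ^ l.length • cmul η (e a) (cprod η l) := by
  induction l with
  | nil => simp [cprod]
  | cons b l ih =>
    rw [List.mem_cons, not_or] at ha
    rw [cprod, cmul_assoc, ih ha.2, cmul_smul, cmul_e_e_comm (Ne.symm ha.1), List.length_cons,
      pow_succ]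
    module

/-- The covector anticommutes with every factor except its own copy, which accounts for one sign
fewer. -/
theorem cprod_comm_of_mem {l : List (Fin n)} (hl : l.Nodup) {a : Fin n} (ha : a ∈ l) :
    cmul η (cprod η l) (e a) = -(-1 : ℝ) ^ l.length • cmul η (e a) (cprod η l) := by
  induction l with
  | nil => simp at ha
  | cons b l ih =>
    obtain ⟨hb, hl⟩ := List.nodup_cons.1 hl
    rw [cprod, cmul_assoc, List.length_cons, pow_succ]
    by_cases h : a = b
    · subst h
      rw [cprod_comm_of_notMem hb, cmul_smul]
      module
    · rw [ih hl ((List.mem_cons.1 ha).resolve_left h), cmul_smul, cmul_e_e_comm (Ne.symm h)]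
      module

/-- Bringing the two copies of the head together crosses the whole tail once, and these crossings
add up to a binomial coefficient. -/
theorem cprod_sq {l : List (Fin n)} (hl : l.Nodup) :
    cmul η (cprod η l) (cprod η l) =
      ((-1 : ℝ) ^ (l.length.choose 2) * (l.map η).prod) • (1 : Form n) := by
  induction l with
  | nil => simp [cprod]
  | cons b l ih =>
    obtain ⟨hb, hl⟩ := List.nodup_cons.1 hl
    rw [cprod, cmul_assoc, ← cmul_assoc η (cprod η l), cprod_comm_of_notMem hb, smul_cmul,
      cmul_smul, cmul_assoc, cmul_e_e_self, ih hl, List.length_cons, Nat.choose_succ_succ',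
      Nat.choose_one_right, pow_add, List.map_cons, List.prod_cons]
    module

theorem eps_eq_cprod (η : Fin n → ℝ) : (eps : Form n) = cprod η (List.finRange n) := by
  rw [(cprod_spec (List.nodup_finRange n)).1, eps, ExteriorAlgebra.ιMulti_apply,
    List.ofFn_eq_map]
  rfl

theorem neg_one_pow_choose_two (n : ℕ) : (-1 : ℝ) ^ (n.choose 2) = (-1) ^ (n / 2) := by
  induction n using Nat.twoStepInduction with
  | zero => rfl
  | one => rfl
  | more k ih _ =>
    have h1 : (k + 2).choose 2 = k.choose 2 + (2 * k + 1) := by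
      simp only [Nat.choose_succ_succ' (k + 1) 1, Nat.choose_succ_succ' k 1,
        Nat.choose_one_right, Nat.reduceAdd]
      omega
    have h2 : (k + 2) / 2 = k / 2 + 1 := by omega
    rw [h1, h2, pow_add, ih, pow_succ, pow_succ, pow_mul]
    simp

theorem eps_sq : cmul η eps eps = ((∏ a, η a) * (-1 : ℝ) ^ (n / 2)) • (1 : Form n) := by
  rw [eps_eq_cprod η, cprod_sq (List.nodup_finRange n), List.length_finRange,
    neg_one_pow_choose_two, ← List.ofFn_eq_map, List.prod_ofFn, mul_comm]

theorem eps_eps_cmul (w : Form n) :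
    cmul η eps (cmul η eps w) = ((∏ a, η a) * (-1 : ℝ) ^ (n / 2)) • w := by
  rw [← cmul_assoc, eps_sq, smul_cmul, one_cmul]

theorem eps_sq_sq (hη : ∀ a, η a * η a = 1) :
    ((∏ a, η a) * (-1 : ℝ) ^ (n / 2)) * ((∏ a, η a) * (-1 : ℝ) ^ (n / 2)) = 1 := by
  rw [mul_mul_mul_comm, ← Finset.prod_mul_distrib, ← sq ((-1 : ℝ) ^ _), neg_one_pow_sq]
  simp [hη]

theorem eps_cmul_e (a : Fin n) :
    cmul η eps (e a) = (-(-1 : ℝ) ^ n) • cmul η (e a) eps := by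
  have := cprod_comm_of_mem (η := η) (List.nodup_finRange n) (List.mem_finRange a)
  rwa [← eps_eq_cprod, List.length_finRange] at this

theorem eps_mem : (eps : Form n) ∈ ⋀[ℝ]^n (Fin n → ℝ) :=
  ExteriorAlgebra.ιMulti_range ℝ n ⟨_, rfl⟩

theorem inv_eps_cmul (w : Form n) :
    inv (cmul η eps w) = (-1 : ℝ) ^ n • cmul η eps (inv w) := by
  rw [inv_cmul, inv_of_mem eps_mem, smul_cmul]

/-- The sum is left Clifford multiplication by e_a and the difference is right multiplication after
the involution. Left multiplication passes ε up to a sign; right multiplication passes it by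
associativity. Half-sum and half-difference then give the duality of wedge and contraction. -/
theorem eps_cmul_aux (a : Fin n) (w : Form n) :
    cmul η eps (e a * w + hookUp η a w) =
        (-(-1 : ℝ) ^ n) • (e a * cmul η eps w + hookUp η a (cmul η eps w)) ∧
      cmul η eps (e a * w - hookUp η a w) =
        (-1 : ℝ) ^ n • (e a * cmul η eps w - hookUp η a (cmul η eps w)) := by
  constructor
  · rw [← cmul_e, ← cmul_e, ← cmul_assoc, eps_cmul_e, smul_cmul, cmul_assoc]
  · have h := cmul_e_right η a (inv w)
    rw [inv_inv] at h
    rw [← h, ← cmul_assoc, cmul_e_right, inv_eps_cmul, inv_inv]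
    simp only [hookUp, hook_smul, mul_smul_comm]
    module

/-- Hodge duality exchanges exterior multiplication and contraction. -/
theorem eps_cmul_e_mul (a : Fin n) (w : Form n) :
    cmul η eps (e a * w) = (-(-1 : ℝ) ^ n) • hookUp η a (cmul η eps w) := by
  obtain ⟨h1, h2⟩ := eps_cmul_aux (η := η) a w
  have : e a * w = (1 / 2 : ℝ) • ((e a * w + hookUp η a w) + (e a * w - hookUp η a w)) := by
    module
  rw [this, cmul_smul, cmul_add, h1, h2]
  module

theorem eps_cmul_hookUp (a : Fin n) (w : Form n) :
    cmul η eps (hookUp η a w) = (-(-1 : ℝ) ^ n) • (e a * cmul η eps w) := by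
  obtain ⟨h1, h2⟩ := eps_cmul_aux (η := η) a w
  have : hookUp η a w = (1 / 2 : ℝ) • ((e a * w + hookUp η a w) - (e a * w - hookUp η a w)) := by
    module
  rw [this, cmul_smul, cmul_sub, h1, h2]
  module

/-- Even forms commute with ε and odd forms do so up to -(-1)^n; w ± inv w are twice the parity
components. -/
theorem eps_cmul_comm (w : Form n) :
    cmul η eps w = (1 / 2 : ℝ) • (cmul η (w + inv w) eps - (-1 : ℝ) ^ n • cmul η (w - inv w) eps) := by
  induction w using Form.induction_cmul η with
  | one => rw [cmul_one, map_one, sub_self, zero_cmul, add_cmul, one_cmul]; module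
  | add u v hu hv =>
    rw [cmul_add, hu, hv]
    simp only [map_add, add_cmul, sub_cmul]
    module
  | smul r v hv =>
    rw [cmul_smul, hv]
    simp only [map_smul, add_cmul, sub_cmul, smul_cmul]
    module
  | mul a v hv =>
    rw [← cmul_assoc, eps_cmul_e, smul_cmul, cmul_assoc, hv, inv_cmul, inv_e]
    simp only [add_cmul, sub_cmul, neg_cmul, cmul_assoc, cmul_smul, cmul_add, cmul_sub]
    rcases neg_one_pow_eq_or ℝ n with h | h <;> rw [h] <;> module

theorem eps_cmul_comm_of_even {w : Form n} (hw : inv w = w) : cmul η eps w = cmul η w eps := by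
  rw [eps_cmul_comm, hw, sub_self, zero_cmul, add_cmul]
  module

theorem eps_cmul_comm_of_odd (hn : Odd n) (w : Form n) : cmul η eps w = cmul η w eps := by
  rw [eps_cmul_comm, hn.neg_one_pow, add_cmul, sub_cmul]
  module

theorem eps_cmul_cmul_of_even {v : Form n} (hv : inv v = v) (w : Form n) :
    cmul η eps (cmul η v w) = cmul η v (cmul η eps w) := by
  rw [← cmul_assoc, eps_cmul_comm_of_even hv, cmul_assoc]

/-- For each a, duality turns e_a ∧ X_a ⌟ into the identity minus itself; summing over a, it turns π
into n - π. -/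
theorem eps_cmul_mem (hη : ∀ a, η a * η a = 1) {p : ℕ} {w : Form n}
    (hw : w ∈ ⋀[ℝ]^p (Fin n → ℝ)) (hp : p ≤ n) :
    cmul η eps w ∈ ⋀[ℝ]^(n - p) (Fin n → ℝ) := by
  refine mem_of_degOp ?_
  have h1 : cmul η eps (degOp w) = (n : ℝ) • cmul η eps w - degOp (cmul η eps w) := by
    have h2 : ∀ a, cmul η eps (e a * hook a w) =
        cmul η eps w - e a * hook a (cmul η eps w) := by
      intro a
      have h3 : ∀ z : Form n, hook a z = η a • hookUp η a z := fun z => by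
        rw [hookUp, smul_smul, hη, one_smul]
      rw [eps_cmul_e_mul, h3 w, cmul_smul, eps_cmul_hookUp, hookUp]
      simp only [hook_smul, hook_e_mul, if_true, smul_smul]
      have : -(-1 : ℝ) ^ n * (η a * (η a * -(-1) ^ n)) = 1 := by
        linear_combination (η a * η a) * neg_one_pow_sq n + hη a
      rw [this, one_smul]
    simp only [degOp_apply, cmul_sum, h2, Finset.sum_sub_distrib, Finset.sum_const,
      Finset.card_univ, Fintype.card_fin]
    rw [Nat.cast_smul_eq_nsmul]
  rw [degOp_of_mem hw, cmul_smul] at h1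
  rw [Nat.cast_sub hp, sub_smul, h1]
  abel

theorem eps_cmul_degFun (hη : ∀ a, η a * η a = 1) {f g : ℕ → ℝ}
    (h : ∀ k ≤ n, f k = g (n - k)) (w : Form n) :
    cmul η eps (degFun f w) = degFun g (cmul η eps w) := by
  conv_rhs => rw [← sum_degPart w, cmul_sum, ← degFunL_apply, map_sum]
  rw [degFun, cmul_sum]
  refine Finset.sum_congr rfl fun k hk => ?_
  have hk : k ≤ n := by have := Finset.mem_range.1 hk; omega
  rw [degFunL_apply, degFun_of_mem _ (eps_cmul_mem hη (degPart_mem k w) hk), cmul_smul, h k hk]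

/-- It suffices that ε passes the forms s^a and s0 to reach the t side. The derivatives of s only
occur to the right of t, so their parity plays no role. -/
theorem eps_cmul_firstOrderCoeff_of_even {s : Fin n → Form n} {ds : Fin n → Fin n → Form n}
    {s0 : Form n} (hs : ∀ a, inv (s a) = s a) (hs0 : inv s0 = s0)
    (t : Fin n → Form n) (dt : Fin n → Fin n → Form n) (t0 : Form n) (b : Fin n) :
    cmul η eps (firstOrderCoeff η s ds s0 t dt t0 b) =
      firstOrderCoeff η s ds s0 (fun a => cmul η eps (t a)) (fun a b => cmul η eps (dt a b))
        (cmul η eps t0) b := by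
  simp only [firstOrderCoeff, ccomm, cmul_add, cmul_sub, cmul_sum, eps_cmul_cmul_of_even (hs _),
    eps_cmul_cmul_of_even hs0, cmul_assoc]

theorem eps_eps_cmul_firstOrderCoeff (hn : Odd n) (s : Fin n → Form n)
    (ds : Fin n → Fin n → Form n) (s0 : Form n)
    (t : Fin n → Form n) (dt : Fin n → Fin n → Form n) (t0 : Form n) (b : Fin n) :
    cmul η eps (cmul η eps (firstOrderCoeff η s ds s0 t dt t0 b)) =
      firstOrderCoeff η (fun a => cmul η eps (s a)) (fun a b => cmul η eps (ds a b))
        (cmul η eps s0) (fun a => cmul η eps (t a)) (fun a b => cmul η eps (dt a b))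
        (cmul η eps t0) b := by
  have h : ∀ v w : Form n, cmul η eps (cmul η eps (cmul η v w)) =
      cmul η (cmul η eps v) (cmul η eps w) := by
    intro v w
    rw [cmul_assoc, ← cmul_assoc η v, ← eps_cmul_comm_of_odd hn v, cmul_assoc]
  simp only [firstOrderCoeff, ccomm, cmul_add, cmul_sub, cmul_sum, h]

theorem firstOrderCoeff_smul_right (r : ℝ) (s : Fin n → Form n)
    (ds : Fin n → Fin n → Form n) (s0 : Form n)
    (t : Fin n → Form n) (dt : Fin n → Fin n → Form n) (t0 : Form n) (b : Fin n) :
    firstOrderCoeff η s ds s0 (fun a => r • t a) (fun a b => r • dt a b) (r • t0) b =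
      r • firstOrderCoeff η s ds s0 t dt t0 b := by
  simp only [firstOrderCoeff, ccomm, cmul_smul, smul_cmul, smul_add, smul_sub, Finset.smul_sum]

theorem firstOrderCoeff_smul_left (r : ℝ) (s : Fin n → Form n)
    (ds : Fin n → Fin n → Form n) (s0 : Form n)
    (t : Fin n → Form n) (dt : Fin n → Fin n → Form n) (t0 : Form n) (b : Fin n) :
    firstOrderCoeff η (fun a => r • s a) (fun a b => r • ds a b) (r • s0) t dt t0 b =
      r • firstOrderCoeff η s ds s0 t dt t0 b := by
  simp only [firstOrderCoeff, ccomm, cmul_smul, smul_cmul, smul_add, smul_sub, Finset.smul_sum]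

end Hodge

end

end KillingYano

namespace KillingYano

noncomputable section

/-! ### Calculus of maps into finite-dimensional spaces -/

section VectorCalculus

variable {n : ℕ} {M : Type*} [TopologicalSpace M] [ChartedSpace (EuclideanSpace ℝ (Fin n)) M]
  {V W Z : Type*} [AddCommGroup V] [Module ℝ V] [Module.Finite ℝ V]
  [AddCommGroup W] [Module ℝ W] [Module.Finite ℝ W]
  [AddCommGroup Z] [Module ℝ Z] [Module.Finite ℝ Z] {U : Set M} {x : M}

theorem SmoothOn.mdifferentiableAt {f : M → V} (hU : IsOpen U) (hf : SmoothOn n U f)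
    (hx : x ∈ U) :
    MDifferentiableAt (𝓡 n) 𝓘(ℝ, Fin (Module.finrank ℝ V) → ℝ) (fun y => coords V (f y)) x :=
  (ContMDiffOn.contMDiffAt hf (hU.mem_nhds hx)).mdifferentiableAt (by simp)

/-- A function in the preferred chart at a point. -/
def inChart {E' : Type*} (F : M → E') (x : M) (z : EuclideanSpace ℝ (Fin n)) : E' :=
  F ((extChartAt (𝓡 n) x).symm z)

theorem inChart_apply_self {E' : Type*} (F : M → E') (x : M) :
    inChart F x (extChartAt (𝓡 n) x x) = F x :=
  congrArg F (extChartAt_to_inv x)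

theorem differentiableAt_inChart {E' : Type*} [NormedAddCommGroup E'] [NormedSpace ℝ E']
    {F : M → E'} (hF : MDifferentiableAt (𝓡 n) 𝓘(ℝ, E') F x) :
    DifferentiableAt ℝ (inChart F x) (extChartAt (𝓡 n) x x) := by
  have h := hF.differentiableWithinAt_writtenInExtChartAt
  rw [(𝓡 n).range_eq_univ, differentiableWithinAt_univ] at h
  exact h

theorem mfderiv_eq_fderiv {E' : Type*} [NormedAddCommGroup E'] [NormedSpace ℝ E']
    {F : M → E'} (hF : MDifferentiableAt (𝓡 n) 𝓘(ℝ, E') F x) :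
    mfderiv (𝓡 n) 𝓘(ℝ, E') F x = fderiv ℝ (inChart F x) (extChartAt (𝓡 n) x x) := by
  rw [hF.mfderiv, (𝓡 n).range_eq_univ, fderivWithin_univ]
  rfl

theorem SmoothOn.differentiableAt {f : M → V} (hU : IsOpen U) (hf : SmoothOn n U f)
    (hx : x ∈ U) :
    DifferentiableAt ℝ (inChart (fun y => coords V (f y)) x) (extChartAt (𝓡 n) x x) :=
  differentiableAt_inChart (hf.mdifferentiableAt hU hx)

theorem coords_dirDeriv {f : M → V} (hU : IsOpen U) (hf : SmoothOn n U f)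
    (hx : x ∈ U) (v : EuclideanSpace ℝ (Fin n)) :
    coords V (dirDeriv f x v) =
      fderiv ℝ (inChart (fun y => coords V (f y)) x) (extChartAt (𝓡 n) x x) v := by
  rw [← mfderiv_eq_fderiv (hf.mdifferentiableAt hU hx)]
  exact (coords V).apply_symm_apply _

theorem dirDeriv_congr {f g : M → V} (hU : IsOpen U) (hx : x ∈ U) (h : ∀ y ∈ U, f y = g y)
    (v : TangentSpace (𝓡 n) x) : dirDeriv f x v = dirDeriv g x v := by
  have : (fun y => coords V (f y)) =ᶠ[nhds x] fun y => coords V (g y) := by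
    filter_upwards [hU.mem_nhds hx] with y hy
    rw [h y hy]
  rw [dirDeriv, dirDeriv, this.mfderiv_eq]
  rfl

theorem SmoothOn.congr {f g : M → V} (hf : SmoothOn n U f) (h : ∀ y ∈ U, g y = f y) :
    SmoothOn n U g := by
  refine ContMDiffOn.congr hf fun y hy => ?_
  rw [h y hy]

theorem smoothOn_const (c : V) : SmoothOn n U fun _ : M => c := contMDiffOn_const

theorem dirDeriv_const (c : V) (v : TangentSpace (𝓡 n) x) :
    dirDeriv (fun _ : M => c) x v = 0 := by
  rw [dirDeriv, mfderiv_const]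
  exact map_zero _

/-- A linear map in coordinates. -/
def coordMap (L : V →ₗ[ℝ] W) :
    (Fin (Module.finrank ℝ V) → ℝ) →L[ℝ] (Fin (Module.finrank ℝ W) → ℝ) :=
  LinearMap.toContinuousLinearMap
    ((coords W).toLinearMap ∘ₗ L ∘ₗ (coords V).symm.toLinearMap)

theorem coordMap_apply (L : V →ₗ[ℝ] W) (v : V) : coordMap L (coords V v) = coords W (L v) := by
  simp [coordMap]

theorem SmoothOn.map {f : M → V} (hf : SmoothOn n U f) (L : V →ₗ[ℝ] W) :
    SmoothOn n U fun y => L (f y) := by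
  have h := (coordMap L).contMDiff.comp_contMDiffOn (n := ∞) hf
  exact h.congr fun y _ => (coordMap_apply L (f y)).symm

theorem dirDeriv_map {f : M → V} (hU : IsOpen U) (hf : SmoothOn n U f) (hx : x ∈ U)
    (L : V →ₗ[ℝ] W) (v : TangentSpace (𝓡 n) x) :
    dirDeriv (fun y => L (f y)) x v = L (dirDeriv f x v) := by
  change EuclideanSpace ℝ (Fin n) at v
  apply (coords W).injective
  have h2 : inChart (n := n) (fun y => coords W (L (f y))) x =
      coordMap L ∘ inChart (fun y => coords V (f y)) x := by
    funext z
    exact (coordMap_apply L _).symm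
  refine (coords_dirDeriv hU (hf.map L) hx v).trans ?_
  rw [h2, ((coordMap L).hasFDerivAt.comp _ (hf.differentiableAt hU hx).hasFDerivAt).fderiv,
    ContinuousLinearMap.comp_apply, ← coords_dirDeriv hU hf hx, coordMap_apply]

/-- A bilinear map in coordinates. -/
def coordBilin (B : V →ₗ[ℝ] W →ₗ[ℝ] Z) :
    (Fin (Module.finrank ℝ V) → ℝ) →L[ℝ] (Fin (Module.finrank ℝ W) → ℝ) →L[ℝ]
      (Fin (Module.finrank ℝ Z) → ℝ) :=
  LinearMap.toContinuousLinearMap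
    ({ toFun := fun u => coordMap (B ((coords V).symm u))
       map_add' := fun u w => by ext; simp [coordMap]
       map_smul' := fun r u => by ext; simp [coordMap] } :
      (Fin (Module.finrank ℝ V) → ℝ) →ₗ[ℝ] (Fin (Module.finrank ℝ W) → ℝ) →L[ℝ]
        (Fin (Module.finrank ℝ Z) → ℝ))

theorem coordBilin_apply (B : V →ₗ[ℝ] W →ₗ[ℝ] Z) (v : V) (w : W) :
    coordBilin B (coords V v) (coords W w) = coords Z (B v w) := by
  simp [coordBilin, coordMap_apply]

theorem SmoothOn.map₂ {f : M → V} {g : M → W} (hf : SmoothOn n U f) (hg : SmoothOn n U g)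
    (B : V →ₗ[ℝ] W →ₗ[ℝ] Z) : SmoothOn n U fun y => B (f y) (g y) := by
  have h := ContMDiffOn.clm_apply ((coordBilin B).contMDiff.comp_contMDiffOn (n := ∞) hf) hg
  exact h.congr fun y _ => (coordBilin_apply B (f y) (g y)).symm

theorem dirDeriv_map₂ {f : M → V} {g : M → W} (hU : IsOpen U) (hf : SmoothOn n U f)
    (hg : SmoothOn n U g) (hx : x ∈ U) (B : V →ₗ[ℝ] W →ₗ[ℝ] Z) (v : TangentSpace (𝓡 n) x) :
    dirDeriv (fun y => B (f y) (g y)) x v =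
      B (dirDeriv f x v) (g x) + B (f x) (dirDeriv g x v) := by
  change EuclideanSpace ℝ (Fin n) at v
  apply (coords Z).injective
  have h2 : inChart (n := n) (fun y => coords Z (B (f y) (g y))) x =
      fun z => coordBilin B (inChart (fun y => coords V (f y)) x z)
        (inChart (fun y => coords W (g y)) x z) := by
    funext z
    exact (coordBilin_apply B _ _).symm
  refine (coords_dirDeriv hU (hf.map₂ hg B) hx v).trans ?_
  rw [h2, ((coordBilin B).hasFDerivAt_of_bilinear (hf.differentiableAt hU hx).hasFDerivAt
    (hg.differentiableAt hU hx).hasFDerivAt).fderiv, map_add, add_apply,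
    ContinuousLinearMap.precompR_apply, ContinuousLinearMap.precompL_apply,
    ContinuousLinearMap.compL_apply, ContinuousLinearMap.comp_apply,
    ← coords_dirDeriv hU hf hx, ← coords_dirDeriv hU hg hx, inChart_apply_self,
    inChart_apply_self, coordBilin_apply, coordBilin_apply, add_comm]

theorem SmoothOn.add {f g : M → V} (hf : SmoothOn n U f) (hg : SmoothOn n U g) :
    SmoothOn n U fun y => f y + g y := by
  have h := ContMDiffOn.add hf hg
  exact h.congr fun y _ => map_add _ _ _

theorem dirDeriv_add {f g : M → V} (hU : IsOpen U) (hf : SmoothOn n U f)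
    (hg : SmoothOn n U g) (hx : x ∈ U) (v : TangentSpace (𝓡 n) x) :
    dirDeriv (fun y => f y + g y) x v = dirDeriv f x v + dirDeriv g x v := by
  change EuclideanSpace ℝ (Fin n) at v
  apply (coords V).injective
  have h2 : inChart (n := n) (fun y => coords V (f y + g y)) x =
      inChart (fun y => coords V (f y)) x + inChart (fun y => coords V (g y)) x := by
    funext z
    exact map_add _ _ _
  refine (coords_dirDeriv hU (hf.add hg) hx v).trans ?_
  rw [h2, ((hf.differentiableAt hU hx).hasFDerivAt.add
    (hg.differentiableAt hU hx).hasFDerivAt).fderiv, map_add, add_apply,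
    ← coords_dirDeriv hU hf hx, ← coords_dirDeriv hU hg hx]

theorem SmoothOn.sum {ι : Type*} {s : Finset ι} {f : ι → M → V}
    (hf : ∀ i ∈ s, SmoothOn n U (f i)) : SmoothOn n U fun y => ∑ i ∈ s, f i y := by
  classical
  induction s using Finset.induction_on with
  | empty => simpa using smoothOn_const (0 : V)
  | insert i s hi ih =>
    simp only [Finset.sum_insert hi]
    exact (hf i (Finset.mem_insert_self _ _)).add
      (ih fun j hj => hf j (Finset.mem_insert_of_mem hj))

theorem dirDeriv_sum {ι : Type*} {s : Finset ι} {f : ι → M → V} (hU : IsOpen U)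
    (hf : ∀ i ∈ s, SmoothOn n U (f i)) (hx : x ∈ U) (v : TangentSpace (𝓡 n) x) :
    dirDeriv (fun y => ∑ i ∈ s, f i y) x v = ∑ i ∈ s, dirDeriv (f i) x v := by
  classical
  induction s using Finset.induction_on with
  | empty => simpa using dirDeriv_const (0 : V) v
  | insert i s hi ih =>
    simp only [Finset.sum_insert hi]
    have h := fun j hj => hf j (Finset.mem_insert_of_mem hj)
    rw [dirDeriv_add hU (hf i (Finset.mem_insert_self _ _)) (SmoothOn.sum h) hx, ih h]

theorem SmoothOn.smul {f : M → ℝ} {g : M → V} (hf : SmoothOn n U f) (hg : SmoothOn n U g) :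
    SmoothOn n U fun y => f y • g y := hf.map₂ hg (LinearMap.lsmul ℝ V)

theorem dirDeriv_smul {f : M → ℝ} {g : M → V} (hU : IsOpen U) (hf : SmoothOn n U f)
    (hg : SmoothOn n U g) (hx : x ∈ U) (v : TangentSpace (𝓡 n) x) :
    dirDeriv (fun y => f y • g y) x v = dirDeriv f x v • g x + f x • dirDeriv g x v :=
  dirDeriv_map₂ hU hf hg hx (LinearMap.lsmul ℝ V) v

theorem SmoothOn.mul {f g : M → ℝ} (hf : SmoothOn n U f) (hg : SmoothOn n U g) :
    SmoothOn n U fun y => f y * g y := hf.smul hg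

theorem dirDeriv_mul {f g : M → ℝ} (hU : IsOpen U) (hf : SmoothOn n U f)
    (hg : SmoothOn n U g) (hx : x ∈ U) (v : TangentSpace (𝓡 n) x) :
    dirDeriv (fun y => f y * g y) x v = dirDeriv f x v * g x + f x * dirDeriv g x v :=
  dirDeriv_smul hU hf hg hx v

theorem smoothOn_real_iff {f : M → ℝ} :
    SmoothOn n U f ↔ ContMDiffOn (𝓡 n) 𝓘(ℝ, ℝ) ∞ f U := by
  let L := (coords ℝ).toContinuousLinearEquiv
  constructor
  · intro hf
    have h := L.symm.toContinuousLinearMap.contMDiff.comp_contMDiffOn (n := ∞) hf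
    exact h.congr fun y _ => (L.symm_apply_apply (f y)).symm
  · intro hf
    have h := L.toContinuousLinearMap.contMDiff.comp_contMDiffOn (n := ∞) hf
    exact h

theorem dirDeriv_real {f : M → ℝ} (hf : MDifferentiableAt (𝓡 n) 𝓘(ℝ, ℝ) f x)
    (v : TangentSpace (𝓡 n) x) :
    dirDeriv f x v = mfderiv (𝓡 n) 𝓘(ℝ, ℝ) f x v := by
  let L := (coords ℝ).toContinuousLinearEquiv
  have h := (L.toContinuousLinearMap.hasMFDerivAt (x := f x)).comp x hf.hasMFDerivAt
  have h2 : (fun y => coords ℝ (f y)) = L.toContinuousLinearMap ∘ f := rfl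
  rw [dirDeriv, h2, h.mfderiv]
  exact L.symm_apply_apply _

/-- The derivative along X is the fibre component of the tangent map of f composed with the section
X. -/
theorem SmoothOn.dirDeriv [IsManifold (𝓡 n) ∞ M] {f : M → V} (hU : IsOpen U)
    (hf : SmoothOn n U f) {X : ∀ x : M, TangentSpace (𝓡 n) x}
    (hX : ContMDiffOn (𝓡 n) (𝓡 n).tangent ∞
      (fun x => (⟨x, X x⟩ : TangentBundle (𝓡 n) M)) U) :
    SmoothOn n U fun y => dirDeriv f y (X y) := by
  have h1 := ContMDiffOn.contMDiffOn_tangentMapWithin (m := ∞) hf (by simp)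
    (hU.uniqueMDiffOn)
  have h2 := h1.comp hX fun y hy => hy
  have h3 := (contMDiff_snd_tangentBundle_modelSpace (n := ∞) (Fin (Module.finrank ℝ V) → ℝ)
    𝓘(ℝ, Fin (Module.finrank ℝ V) → ℝ)).comp_contMDiffOn h2
  refine ContMDiffOn.congr h3 fun y hy => ?_
  refine ((coords V).apply_symm_apply _).trans ?_
  rw [← mfderivWithin_of_isOpen hU hy]
  rfl

end VectorCalculus

end

end KillingYano

namespace KillingYano

noncomputable section

/-! ### Lie brackets and test functions -/

section LieBracket

variable {n : ℕ} {M : Type*} [TopologicalSpace M] [ChartedSpace (EuclideanSpace ℝ (Fin n)) M]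
  [IsManifold (𝓡 n) ∞ M]
  {V : Type*} [AddCommGroup V] [Module ℝ V] [Module.Finite ℝ V] {U : Set M} {x : M}

/-- The chain rule at an arbitrary point of the chart, not only its centre; this is needed because
first derivatives are differentiated again. -/
theorem fderiv_inChart {E' : Type*} [NormedAddCommGroup E'] [NormedSpace ℝ E']
    {F : M → E'} {z : EuclideanSpace ℝ (Fin n)} (hz : z ∈ (extChartAt (𝓡 n) x).target)
    (hF : MDifferentiableAt (𝓡 n) 𝓘(ℝ, E') F ((extChartAt (𝓡 n) x).symm z))
    (X : ∀ x : M, TangentSpace (𝓡 n) x) :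
    fderiv ℝ (inChart F x) z (VectorField.mpullbackWithin 𝓘(ℝ, EuclideanSpace ℝ (Fin n)) (𝓡 n)
      (extChartAt (𝓡 n) x).symm X (Set.range (𝓡 n)) z) =
      mfderiv (𝓡 n) 𝓘(ℝ, E') F ((extChartAt (𝓡 n) x).symm z)
        (X ((extChartAt (𝓡 n) x).symm z)) := by
  have : IsManifold (𝓡 n) 1 M := IsManifold.of_le (n := ∞) (by simp)
  have h1 := mfderiv_comp_mfderivWithin (I := 𝓘(ℝ, EuclideanSpace ℝ (Fin n))) z hF
    (mdifferentiableWithinAt_extChartAt_symm hz)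
    ((𝓡 n).uniqueMDiffOn z (extChartAt_target_subset_range x hz))
  have h2 := isInvertible_mfderivWithin_extChartAt_symm hz
  rw [VectorField.mpullbackWithin_apply]
  have h3 : mfderivWithin 𝓘(ℝ, EuclideanSpace ℝ (Fin n)) 𝓘(ℝ, E')
      (F ∘ (extChartAt (𝓡 n) x).symm) (Set.range (𝓡 n)) z = fderiv ℝ (inChart F x) z := by
    rw [mfderivWithin_eq_fderivWithin, (𝓡 n).range_eq_univ, fderivWithin_univ]
    rfl
  rw [← h3, h1]
  exact congrArg (mfderiv (𝓡 n) 𝓘(ℝ, E') F ((extChartAt (𝓡 n) x).symm z))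
    (h2.self_apply_inverse _)

theorem mfderiv_eq_fderiv_inChart {E' : Type*} [NormedAddCommGroup E'] [NormedSpace ℝ E']
    {F : M → E'} (hF : MDifferentiableAt (𝓡 n) 𝓘(ℝ, E') F x) (v : TangentSpace (𝓡 n) x) :
    mfderiv (𝓡 n) 𝓘(ℝ, E') F x v = fderiv ℝ (inChart F x) (extChartAt (𝓡 n) x x)
      (mfderiv (𝓡 n) 𝓘(ℝ, EuclideanSpace ℝ (Fin n)) (extChartAt (𝓡 n) x) x v) := by
  have : IsManifold (𝓡 n) 1 M := IsManifold.of_le (n := ∞) (by simp)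
  have h1 : F =ᶠ[nhds x] inChart F x ∘ extChartAt (𝓡 n) x := by
    filter_upwards [extChartAt_source_mem_nhds (I := 𝓡 n) x] with y hy
    exact congrArg F ((extChartAt (𝓡 n) x).left_inv hy).symm
  have h2 := (differentiableAt_inChart hF).hasFDerivAt.hasMFDerivAt.comp x
    (mdifferentiableAt_extChartAt (I := 𝓡 n) (mem_chart_source _ x)).hasMFDerivAt
  rw [h1.mfderiv_eq, h2.mfderiv]
  rfl

/-- In the chart this is the symmetry of the second derivative: it cancels in the commutator and
leaves the derivatives of the two fields. -/
theorem dirDeriv_mlieBracket {f : M → V} (hU : IsOpen U) (hf : SmoothOn n U f) (hx : x ∈ U)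
    {X Y : ∀ x : M, TangentSpace (𝓡 n) x}
    (hX : ContMDiffOn (𝓡 n) (𝓡 n).tangent ∞
      (fun x => (⟨x, X x⟩ : TangentBundle (𝓡 n) M)) U)
    (hY : ContMDiffOn (𝓡 n) (𝓡 n).tangent ∞
      (fun x => (⟨x, Y x⟩ : TangentBundle (𝓡 n) M)) U) :
    dirDeriv f x (VectorField.mlieBracket (𝓡 n) X Y x) =
      dirDeriv (fun y => dirDeriv f y (Y y)) x (X x) -
        dirDeriv (fun y => dirDeriv f y (X y)) x (Y x) := by
  have : IsManifold (𝓡 n) 1 M := IsManifold.of_le (n := ∞) (by simp)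
  have : IsManifold (𝓡 n) 2 M := IsManifold.of_le (n := ∞) (by norm_cast)
  have hF : ContDiffAt ℝ ∞ (inChart (fun y => coords V (f y)) x) (extChartAt (𝓡 n) x x) := by
    have h := (contMDiffAt_iff.1 (ContMDiffOn.contMDiffAt hf (hU.mem_nhds hx))).2
    rw [(𝓡 n).range_eq_univ, contDiffWithinAt_univ] at h
    exact h
  -- The chart formula for a first derivative must hold near the centre, since it is differentiated
  -- once more.
  have hmem : ∀ᶠ z in nhds (extChartAt (𝓡 n) x x),
      z ∈ (extChartAt (𝓡 n) x).target ∧ (extChartAt (𝓡 n) x).symm z ∈ U :=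
    ((isOpen_extChartAt_target x).eventually_mem (mem_extChartAt_target x)).and
      ((continuousAt_extChartAt_symm x).eventually_mem
        (by rw [extChartAt_to_inv]; exact hU.mem_nhds hx))
  have key : ∀ {Z W : ∀ x : M, TangentSpace (𝓡 n) x}, ContMDiffOn (𝓡 n) (𝓡 n).tangent ∞
      (fun x => (⟨x, Z x⟩ : TangentBundle (𝓡 n) M)) U →
      coords V (dirDeriv (fun y => dirDeriv f y (Z y)) x (W x)) =
      fderiv ℝ (fun z => fderiv ℝ (inChart (fun y => coords V (f y)) x) z
        (VectorField.mpullbackWithin 𝓘(ℝ, EuclideanSpace ℝ (Fin n)) (𝓡 n)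
          (extChartAt (𝓡 n) x).symm Z (Set.range (𝓡 n)) z)) (extChartAt (𝓡 n) x x)
        (VectorField.mpullbackWithin 𝓘(ℝ, EuclideanSpace ℝ (Fin n)) (𝓡 n)
          (extChartAt (𝓡 n) x).symm W (Set.range (𝓡 n)) (extChartAt (𝓡 n) x x)) := by
    intro Z W hZ
    have h1 : (fun z => fderiv ℝ (inChart (fun y => coords V (f y)) x) z
        (VectorField.mpullbackWithin 𝓘(ℝ, EuclideanSpace ℝ (Fin n)) (𝓡 n)
          (extChartAt (𝓡 n) x).symm Z (Set.range (𝓡 n)) z)) =ᶠ[nhds (extChartAt (𝓡 n) x x)]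
        inChart (fun y => coords V (dirDeriv f y (Z y))) x := by
      filter_upwards [hmem] with z hz
      rw [fderiv_inChart hz.1 (hf.mdifferentiableAt hU hz.2)]
      exact ((coords V).apply_symm_apply _).symm
    have h2 := (hf.dirDeriv hU hZ).mdifferentiableAt hU hx
    rw [h1.fderiv_eq, fderiv_inChart (mem_extChartAt_target x)
      (by rw [extChartAt_to_inv]; exact h2)]
    rw [extChartAt_to_inv]
    exact (coords V).apply_symm_apply _
  apply (coords V).injective
  rw [map_sub, key hY, key hX]
  refine ((coords V).apply_symm_apply _).trans ?_
  rw [mfderiv_eq_fderiv_inChart (hf.mdifferentiableAt hU hx)]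
  have hdiff : ∀ {Z : ∀ x : M, TangentSpace (𝓡 n) x}, ContMDiffOn (𝓡 n) (𝓡 n).tangent ∞
      (fun x => (⟨x, Z x⟩ : TangentBundle (𝓡 n) M)) U →
      DifferentiableAt ℝ (VectorField.mpullbackWithin 𝓘(ℝ, EuclideanSpace ℝ (Fin n)) (𝓡 n)
          (extChartAt (𝓡 n) x).symm Z (Set.range (𝓡 n))) (extChartAt (𝓡 n) x x) := by
    intro Z hZ
    have h := MDifferentiableWithinAt.differentiableWithinAt_mpullbackWithin_vectorField
      (I := 𝓡 n) (s := Set.univ) (x := x) (V := Z)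
      (((hZ.contMDiffAt (hU.mem_nhds hx)).mdifferentiableAt (by simp)).mdifferentiableWithinAt)
    rw [Set.preimage_univ, (𝓡 n).range_eq_univ, Set.univ_inter] at h
    rw [(𝓡 n).range_eq_univ]
    exact differentiableWithinAt_univ.1 h
  rw [← VectorField.fderiv_apply_lieBracket hF (by simp; norm_cast)
    (hdiff hY) (hdiff hX)]
  congr 1
  rw [← VectorField.mlieBracketWithin_univ, VectorField.mlieBracketWithin_apply]
  refine ((isInvertible_mfderiv_extChartAt (mem_extChartAt_source x)).self_apply_inverse
    _).trans ?_
  rw [Set.preimage_univ, Set.univ_inter, (𝓡 n).range_eq_univ]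
  exact congrFun (VectorField.lieBracketWithin_univ (𝕜 := ℝ) (E := EuclideanSpace ℝ (Fin n))) _

/-- Smooth functions with prescribed differential at a point. -/
theorem exists_smooth_dirDeriv [T2Space M] (x : M) (ℓ : TangentSpace (𝓡 n) x →L[ℝ] ℝ) :
    ∃ f : M → ℝ, SmoothOn n Set.univ f ∧ f x = 0 ∧ ∀ v, dirDeriv f x v = ℓ v := by
  have : IsManifold (𝓡 n) 1 M := IsManifold.of_le (n := ∞) (by simp)
  obtain ⟨b⟩ : Nonempty (SmoothBumpFunction (𝓡 n) x) := inferInstance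
  let D : TangentSpace (𝓡 n) x →L[ℝ] EuclideanSpace ℝ (Fin n) :=
    mfderiv (𝓡 n) 𝓘(ℝ, EuclideanSpace ℝ (Fin n)) (extChartAt (𝓡 n) x) x
  have hD : ContinuousLinearMap.IsInvertible D :=
    isInvertible_mfderiv_extChartAt (mem_extChartAt_source x)
  -- The functional in chart coordinates; multiplied by a bump function it becomes globally smooth,
  -- which is where the Hausdorff hypothesis enters.
  let ℓ' : EuclideanSpace ℝ (Fin n) →L[ℝ] ℝ := ℓ.comp D.inverse
  let g : M → ℝ := fun y => ℓ' (extChartAt (𝓡 n) x y - extChartAt (𝓡 n) x x)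
  have hg : ContMDiffOn (𝓡 n) 𝓘(ℝ, ℝ) ∞ g (chartAt (EuclideanSpace ℝ (Fin n)) x).source :=
    ℓ'.contMDiff.comp_contMDiffOn ((contMDiffOn_extChartAt (x := x)).sub contMDiffOn_const)
  have hf : ContMDiff (𝓡 n) 𝓘(ℝ, ℝ) ∞ fun y => b y • g y := b.contMDiff_smul hg
  refine ⟨fun y => b y • g y, smoothOn_real_iff.2 hf.contMDiffOn, by simp [g], fun v => ?_⟩
  rw [dirDeriv_real (hf.mdifferentiableAt (by simp))]
  have h1 : (fun y => b y • g y) =ᶠ[nhds x]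
      (fun z => ℓ' (z - extChartAt (𝓡 n) x x)) ∘ extChartAt (𝓡 n) x := by
    filter_upwards [b.eventuallyEq_one] with y hy
    simp [hy, g]
  have h2 : HasFDerivAt (fun z => ℓ' (z - extChartAt (𝓡 n) x x)) ℓ' (extChartAt (𝓡 n) x x) :=
    ℓ'.hasFDerivAt.comp _ ((hasFDerivAt_id _).sub_const _)
  have h3 := h2.hasMFDerivAt.comp x
    (mdifferentiableAt_extChartAt (I := 𝓡 n) (mem_chart_source _ x)).hasMFDerivAt
  rw [h1.mfderiv_eq, h3.mfderiv]
  exact congrArg ℓ (hD.inverse_apply_self v)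

end LieBracket

end

end KillingYano

namespace KillingYano

noncomputable section

/-! ### Orthonormal frames and Ricci coefficients -/

section LinearDirDeriv

variable {n : ℕ} {M : Type*} [TopologicalSpace M] [ChartedSpace (EuclideanSpace ℝ (Fin n)) M]
  {V : Type*} [AddCommGroup V] [Module ℝ V] [Module.Finite ℝ V] {x : M}

/-- The derivative along a tangent vector is linear in the vector. -/
def dirDerivL (f : M → V) (x : M) : TangentSpace (𝓡 n) x →ₗ[ℝ] V :=
  (coords V).symm.toLinearMap ∘ₗ
    (mfderiv (𝓡 n) 𝓘(ℝ, Fin (Module.finrank ℝ V) → ℝ) (fun y => coords V (f y)) x).toLinearMap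

theorem dirDerivL_apply (f : M → V) (v : TangentSpace (𝓡 n) x) :
    dirDerivL f x v = dirDeriv f x v := rfl

end LinearDirDeriv

namespace OrthonormalFrame

variable {n : ℕ} {M : Type*} [TopologicalSpace M] [ChartedSpace (EuclideanSpace ℝ (Fin n)) M]
  [IsManifold (𝓡 n) ∞ M] {g : PseudoRiemannianMetric n M} {U : Set M}
  (F : OrthonormalFrame g U) {x : M}

theorem sign_mul_self (a : Fin n) : F.η a * F.η a = 1 := by
  rcases F.sign a with h | h <;> simp [h]

/-- Metric compatibility in an orthonormal frame. -/
theorem conn_antisymm (a b c : Fin n) (x : M) : F.conn a b c x = -F.conn a c b x := by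
  have h1 := VectorField.mlieBracket_swap_apply (I := 𝓡 n) (V := F.X a) (W := F.X c) (x := x)
  have h2 := VectorField.mlieBracket_swap_apply (I := 𝓡 n) (V := F.X c) (W := F.X b) (x := x)
  have h3 := VectorField.mlieBracket_swap_apply (I := 𝓡 n) (V := F.X b) (W := F.X a) (x := x)
  simp only [conn]
  rw [h1, h2, h3]
  simp only [map_neg, neg_apply]
  ring

/-- Vanishing torsion: ∇_a X_c - ∇_c X_a = [X_a, X_c], paired with X_b. -/
theorem conn_sub_conn (a b c : Fin n) (x : M) :
    F.conn a b c x - F.conn c b a x =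
      g.val x (VectorField.mlieBracket (𝓡 n) (F.X a) (F.X c) x) (F.X b x) := by
  have h1 := VectorField.mlieBracket_swap_apply (I := 𝓡 n) (V := F.X c) (W := F.X a) (x := x)
  have h2 := VectorField.mlieBracket_swap_apply (I := 𝓡 n) (V := F.X c) (W := F.X b) (x := x)
  have h3 := VectorField.mlieBracket_swap_apply (I := 𝓡 n) (V := F.X b) (W := F.X a) (x := x)
  simp only [conn]
  rw [h1, h2, h3]
  simp only [map_neg, neg_apply]
  ring

theorem linearIndependent_frame (hx : x ∈ U) : LinearIndependent ℝ fun a => F.X a x := by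
  rw [Fintype.linearIndependent_iff]
  intro c hc b
  have h := congrArg (fun v => g.val x v (F.X b x)) hc
  simp only [map_sum, map_smul, sum_apply, smul_apply,
    F.orthonormal x hx, map_zero, zero_apply, smul_eq_mul, mul_ite, mul_zero,
    Finset.sum_ite_eq', Finset.mem_univ, if_true] at h
  rcases mul_eq_zero.1 h with h | h
  · exact h
  · have := F.sign_mul_self b
    rw [h] at this
    simp at this

/-- The frame vectors as a basis of the tangent space. -/
def basis (hx : x ∈ U) : Module.Basis (Fin n) ℝ (TangentSpace (𝓡 n) x) :=
  haveI : Module.Finite ℝ (TangentSpace (𝓡 n) x) :=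
    inferInstanceAs (Module.Finite ℝ (EuclideanSpace ℝ (Fin n)))
  basisOfLinearIndependentOfCardEqFinrank' (fun a => F.X a x) (F.linearIndependent_frame hx)
    ((Fintype.card_fin n).trans (finrank_euclideanSpace_fin (𝕜 := ℝ) (n := n)).symm)

theorem basis_apply (hx : x ∈ U) (a : Fin n) : F.basis hx a = F.X a x := by
  simp [basis]

theorem frame_expansion (hx : x ∈ U) (v : TangentSpace (𝓡 n) x) :
    v = ∑ b, (F.η b * g.val x v (F.X b x)) • F.X b x := by
  have hv := (F.basis hx).sum_repr v
  simp only [F.basis_apply] at hv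
  have h : ∀ b, g.val x v (F.X b x) = (F.basis hx).repr v b * F.η b := by
    intro b
    conv_lhs => rw [← hv]
    simp only [map_sum, map_smul, sum_apply, smul_apply,
      F.orthonormal x hx, smul_eq_mul, mul_ite, mul_zero,
      Finset.sum_ite_eq', Finset.mem_univ, if_true]
  conv_lhs => rw [← hv]
  refine Finset.sum_congr rfl fun b _ => ?_
  rw [h, mul_left_comm, F.sign_mul_self, mul_one]

variable {V : Type*} [AddCommGroup V] [Module ℝ V] [Module.Finite ℝ V]

theorem dirDeriv_frame_comm (hU : IsOpen U) {f : M → V} (hf : SmoothOn n U f) (hx : x ∈ U)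
    (a c : Fin n) :
    dirDeriv (fun y => dirDeriv f y (F.X c y)) x (F.X a x) -
        dirDeriv (fun y => dirDeriv f y (F.X a y)) x (F.X c x) =
      ∑ b, (F.η b * (F.conn a b c x - F.conn c b a x)) • dirDeriv f x (F.X b x) := by
  rw [← dirDeriv_mlieBracket hU hf hx (F.smooth a) (F.smooth c)]
  simp only [← dirDerivL_apply, conn_sub_conn]
  conv_lhs => rw [F.frame_expansion hx (VectorField.mlieBracket (𝓡 n) (F.X a) (F.X c) x)]
  simp only [map_sum, map_smul]

theorem smoothOn_metric {X Y : ∀ x : M, TangentSpace (𝓡 n) x}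
    (hX : ∀ x ∈ U, ContMDiffAt (𝓡 n) (𝓡 n).tangent ∞
      (fun x => (⟨x, X x⟩ : TangentBundle (𝓡 n) M)) x)
    (hY : ∀ x ∈ U, ContMDiffAt (𝓡 n) (𝓡 n).tangent ∞
      (fun x => (⟨x, Y x⟩ : TangentBundle (𝓡 n) M)) x) :
    SmoothOn n U fun x => g.val x (X x) (Y x) := by
  rw [smoothOn_real_iff]
  intro x hx
  have : IsManifold (𝓡 n) 1 M := IsManifold.of_le (n := ∞) (by simp)
  have h := ContMDiffAt.clm_bundle_apply₂ (E₃ := Bundle.Trivial M ℝ) (F₃ := ℝ)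
    (g.smooth x) (hX x hx) (hY x hx)
  rw [Bundle.contMDiffAt_totalSpace] at h
  exact h.2.contMDiffWithinAt

theorem contMDiffAt_X (hU : IsOpen U) (hx : x ∈ U) (a : Fin n) :
    ContMDiffAt (𝓡 n) (𝓡 n).tangent ∞
      (fun x => (⟨x, F.X a x⟩ : TangentBundle (𝓡 n) M)) x :=
  (F.smooth a).contMDiffAt (hU.mem_nhds hx)

theorem contMDiffAt_mlieBracket (hU : IsOpen U) (hx : x ∈ U) (a b : Fin n) :
    ContMDiffAt (𝓡 n) (𝓡 n).tangent ∞
      (fun x => (⟨x, VectorField.mlieBracket (𝓡 n) (F.X a) (F.X b) x⟩ :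
        TangentBundle (𝓡 n) M)) x := by
  have : IsManifold (𝓡 n) (minSmoothness ℝ 2) M :=
    IsManifold.of_le (n := ∞) (by simp; norm_cast)
  have : IsManifold (𝓡 n) ((⊤ : ℕ∞) + 1) M := IsManifold.of_le (n := ∞) (by simp)
  exact ContMDiffAt.mlieBracket_vectorField (m := ⊤) (n := ⊤) (F.contMDiffAt_X hU hx a)
    (F.contMDiffAt_X hU hx b) (by simp)

theorem smoothOn_conn (hU : IsOpen U) (a b c : Fin n) : SmoothOn n U (F.conn a b c) := by
  have h : ∀ i j k : Fin n, SmoothOn n U fun x =>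
      g.val x (VectorField.mlieBracket (𝓡 n) (F.X i) (F.X j) x) (F.X k x) := fun i j k =>
    smoothOn_metric (fun x hx => F.contMDiffAt_mlieBracket hU hx i j)
      (fun x hx => F.contMDiffAt_X hU hx k)
  have h2 := (((h a c b).add ((h c b a).map (-LinearMap.id))).add (h b a c)).map
    ((1 / 2 : ℝ) • (LinearMap.id : ℝ →ₗ[ℝ] ℝ))
  refine h2.congr fun y _ => ?_
  simp only [conn, LinearMap.smul_apply, LinearMap.id_apply, LinearMap.neg_apply, smul_eq_mul,
    sub_eq_add_neg]

end OrthonormalFrame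

end

end KillingYano

namespace KillingYano

noncomputable section

/-! ### Infinitesimal rotations of forms -/

section Rotation

variable {n : ℕ} {η : Fin n → ℝ} {A : Fin n → Fin n → ℝ}

/-- The infinitesimal rotation `A^b{}_c e^c ∧ X_b ⌟`. -/
def rot (η : Fin n → ℝ) (A : Fin n → Fin n → ℝ) : Form n →ₗ[ℝ] Form n :=
  ∑ b, ∑ c, (η b * A b c) • (LinearMap.mulLeft ℝ (e c) ∘ₗ hookL b)

theorem rot_apply (w : Form n) :
    rot η A w = ∑ b, ∑ c, (η b * A b c) • (e c * hook b w) := by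
  simp [rot, LinearMap.sum_apply, hookL_apply]

theorem rot_one : rot η A 1 = 0 := by
  simp [rot_apply, hook_of_mem_zero _ one_mem_zero]

theorem hook_rot (d : Fin n) (w : Form n) :
    hook d (rot η A w) = rot η A (hook d w) + ∑ b, (η b * A b d) • hook b w := by
  simp only [rot_apply, hook_sum, hook_smul, hook_e_mul, smul_sub, Finset.sum_sub_distrib,
    smul_ite, smul_zero, Finset.sum_ite_eq, Finset.mem_univ, if_true]
  rw [add_comm, sub_eq_add_neg, ← Finset.sum_neg_distrib]
  congr 1
  simp only [← Finset.sum_neg_distrib]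
  refine Finset.sum_congr rfl fun b _ => Finset.sum_congr rfl fun c _ => ?_
  rw [hook_comm d b]
  simp

theorem rot_e_mul (d : Fin n) (w : Form n) :
    rot η A (e d * w) = e d * rot η A w + ∑ c, (η d * A d c) • (e c * w) := by
  simp only [rot_apply, hook_e_mul, mul_sub, smul_sub, Finset.sum_sub_distrib, mul_ite, mul_zero,
    smul_ite, smul_zero, Finset.mul_sum, mul_smul_comm]
  rw [Finset.sum_comm (f := fun b c => if b = d then _ else _)]
  simp only [Finset.sum_ite_eq', Finset.mem_univ, if_true]
  rw [add_comm, sub_eq_add_neg, ← Finset.sum_neg_distrib]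
  congr 1
  simp only [← Finset.sum_neg_distrib]
  refine Finset.sum_congr rfl fun b _ => Finset.sum_congr rfl fun c _ => ?_
  rw [e_mul_e_mul c d]
  simp

theorem inv_rot (w : Form n) : inv (rot η A w) = rot η A (inv w) := by
  simp only [rot_apply, map_sum, map_smul, inv_e_mul, inv_hook, mul_neg, neg_neg]

theorem rot_mem {p : ℕ} {w : Form n} (hw : w ∈ ⋀[ℝ]^p (Fin n → ℝ)) :
    rot η A w ∈ ⋀[ℝ]^p (Fin n → ℝ) := by
  rw [rot_apply]
  refine Submodule.sum_mem _ fun b _ => Submodule.sum_mem _ fun c _ => Submodule.smul_mem _ _ ?_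
  cases p with
  | zero => simp [hook_of_mem_zero _ hw]
  | succ p => exact mem_one_mul _ (hook_mem _ hw)

theorem rot_mul (x y : Form n) : rot η A (x * y) = rot η A x * y + x * rot η A y := by
  induction x using Form.induction with
  | one => simp [rot_one]
  | add v w hv hw => simp only [add_mul, map_add, hv, hw]; abel
  | smul r w hw => simp only [smul_mul_assoc, map_smul, hw, smul_add]
  | mul a w hw =>
    rw [mul_assoc, rot_e_mul, hw, rot_e_mul, add_mul, mul_add, Finset.sum_mul]
    simp only [mul_assoc, smul_mul_assoc]
    abel

/-- Rotating a contracted pair of indices contributes two terms, which cancel because A is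
antisymmetric: the metric is invariant. -/
theorem rot_cw (hA : ∀ b c, A b c = -A c b) (k : ℕ) (x y : Form n) :
    rot η A (cw η k x y) = cw η k (rot η A x) y + cw η k x (rot η A y) := by
  induction k generalizing x y with
  | zero => simp only [cw_zero, rot_mul]
  | succ k ih =>
    simp only [cw_succ, map_sum, map_smul, ih, hook_rot, map_add, inv_rot, smul_add,
      Finset.sum_add_distrib, LinearMap.add_apply, LinearMap.sum_apply, LinearMap.smul_apply,
      Finset.smul_sum, smul_smul]
    have h : ∑ a, ∑ b, (η a * (η b * A b a)) • cw η k (inv (hook b x)) (hook a y) +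
        ∑ a, ∑ b, (η a * (η b * A b a)) • cw η k (inv (hook a x)) (hook b y) = 0 := by
      rw [Finset.sum_comm, ← Finset.sum_add_distrib]
      refine Finset.sum_eq_zero fun a _ => ?_
      rw [← Finset.sum_add_distrib]
      refine Finset.sum_eq_zero fun b _ => ?_
      rw [hA a b, ← add_smul]
      convert zero_smul ℝ _ using 2
      ring
    rw [add_add_add_comm, h, add_zero]

/-- Duality swaps the wedge and the contraction; restoring their order gives a sign, and
antisymmetry of A gives another. The diagonal correction vanishes with A_cc. -/
theorem rot_eps_cmul (hA : ∀ b c, A b c = -A c b) (w : Form n) :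
    cmul η eps (rot η A w) = rot η A (cmul η eps w) := by
  have h1 : ∀ b c, cmul η eps ((η b * A b c) • (e c * hook b w)) =
      A b c • hookUp η c (e b * cmul η eps w) := by
    intro b c
    rw [mul_comm, mul_smul, ← mul_smul_comm]
    change cmul η eps (A b c • (e c * hookUp η b w)) = _
    rw [cmul_smul, eps_cmul_e_mul, eps_cmul_hookUp]
    congr 1
    simp only [hookUp, hook_smul]
    rw [smul_comm (η c), smul_smul]
    convert one_smul ℝ _
    rw [neg_mul_neg, ← sq, neg_one_pow_sq]
  simp only [rot_apply, cmul_sum, h1, hookUp, hook_e_mul]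
  rw [Finset.sum_comm]
  refine Finset.sum_congr rfl fun c _ => Finset.sum_congr rfl fun b _ => ?_
  split_ifs with h
  · subst h
    have : A c c = 0 := by linarith [hA c c]
    simp [this]
  · rw [zero_sub, smul_neg, smul_neg, smul_smul, hA b c, neg_mul, neg_smul, neg_neg, mul_comm]

theorem cmul_e_cmul_e_sub (b c : Fin n) (h : b ≠ c) (w : Form n) :
    ccomm η (cmul η (e b) (e c)) w =
      (2 : ℝ) • (e b * hookUp η c w) - (2 : ℝ) • (e c * hookUp η b w) := by
  have hc : hook b (e c * w) = -(e c * hook b w) := by rw [hook_e_mul, if_neg h, zero_sub]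
  have hb : hook c (e b * w) = -(e b * hook c w) := by
    rw [hook_e_mul, if_neg (Ne.symm h), zero_sub]
  rw [ccomm, cmul_assoc, ← cmul_assoc η w]
  simp only [cmul_e, cmul_e_right, map_sub, inv_e_mul, hookUp, map_smul, inv_hook, inv_inv,
    hook_add, hook_smul, hook_sub, hook_neg, mul_add, mul_sub, hc, hb, hook_comm c b,
    e_mul_e_mul c b, mul_smul_comm, mul_neg, smul_add, smul_sub, smul_neg, smul_smul]
  module

/-- The Clifford generator of an infinitesimal rotation. -/
def rotGen (η : Fin n → ℝ) (A : Fin n → Fin n → ℝ) : Form n :=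
  (1 / 4 : ℝ) • ∑ b, ∑ c, A b c • cmul η (e b) (e c)

/-- This makes the spin connection compatible with the Levi-Civita connection on forms. -/
theorem ccomm_rotGen (hA : ∀ b c, A b c = -A c b) (w : Form n) :
    ccomm η (rotGen η A) w = -rot η A w := by
  have h1 : ∀ b c, A b c • ccomm η (cmul η (e b) (e c)) w =
      (2 * A b c) • (e b * hookUp η c w) - (2 * A b c) • (e c * hookUp η b w) := by
    intro b c
    by_cases h : b = c
    · subst h
      have : A b b = 0 := by linarith [hA b b]
      simp [this]
    · rw [cmul_e_cmul_e_sub b c h, smul_sub, smul_smul, smul_smul, mul_comm]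
  have h2 : ccomm η (rotGen η A) w =
      (1 / 4 : ℝ) • ∑ b, ∑ c, A b c • ccomm η (cmul η (e b) (e c)) w := by
    simp only [ccomm, rotGen, smul_cmul, cmul_smul, sum_cmul, cmul_sum, smul_sub,
      Finset.sum_sub_distrib]
  rw [h2]
  simp only [h1, Finset.sum_sub_distrib]
  rw [Finset.sum_comm, ← Finset.sum_sub_distrib, Finset.smul_sum, rot_apply,
    ← Finset.sum_neg_distrib]
  refine Finset.sum_congr rfl fun b _ => ?_
  rw [← Finset.sum_sub_distrib, Finset.smul_sum, ← Finset.sum_neg_distrib]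
  refine Finset.sum_congr rfl fun c _ => ?_
  rw [hA c b, hookUp, mul_smul_comm]
  module

end Rotation

end

end KillingYano

namespace KillingYano

noncomputable section

/-! ### The Levi-Civita derivative of forms -/

namespace OrthonormalFrame

variable {n : ℕ} {M : Type*} [TopologicalSpace M] [ChartedSpace (EuclideanSpace ℝ (Fin n)) M]
  [IsManifold (𝓡 n) ∞ M] {g : PseudoRiemannianMetric n M} {U : Set M}
  (F : OrthonormalFrame g U) {x : M}

theorem nabla_eq (a : Fin n) (α : M → Form n) (x : M) :
    F.nabla a α x =
      dirDeriv α x (F.X a x) - rot F.η (fun b c => F.conn a b c x) (α x) := by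
  rw [nabla, rot_apply]

theorem smoothOn_nabla (hU : IsOpen U) {α : M → Form n} (hα : SmoothOn n U α) (a : Fin n) :
    SmoothOn n U (F.nabla a α) := by
  have h1 : SmoothOn n U fun x =>
      ∑ b, ∑ c, (-(F.η b * F.conn a b c x)) • (e c * hook b (α x)) := by
    refine SmoothOn.sum fun b _ => SmoothOn.sum fun c _ => ?_
    exact ((F.smoothOn_conn hU a b c).map (LinearMap.mulLeft ℝ (-F.η b))).smul
      (hα.map (LinearMap.mulLeft ℝ (e c) ∘ₗ hookL b)) |>.congr fun y _ => by
        simp [hookL_apply]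
  refine ((hα.dirDeriv hU (F.smooth a)).add h1).congr fun y _ => ?_
  simp only [nabla, sub_eq_add_neg, neg_smul, Finset.sum_neg_distrib]

theorem nabla_map (hU : IsOpen U) {α : M → Form n} (hα : SmoothOn n U α) (hx : x ∈ U)
    (a : Fin n) (L : Form n →ₗ[ℝ] Form n)
    (hL : ∀ w, L (rot F.η (fun b c => F.conn a b c x) w) =
      rot F.η (fun b c => F.conn a b c x) (L w)) :
    F.nabla a (fun y => L (α y)) x = L (F.nabla a α x) := by
  rw [nabla_eq, nabla_eq, dirDeriv_map hU hα hx, map_sub, hL]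

theorem nabla_dual (hU : IsOpen U) {α : M → Form n} (hα : SmoothOn n U α) (hx : x ∈ U)
    (a : Fin n) : F.nabla a (F.dual α) x = cmul F.η eps (F.nabla a α x) :=
  F.nabla_map hU hα hx a (cmulL F.η eps) fun w =>
    rot_eps_cmul (fun b c => F.conn_antisymm a b c x) w

theorem nabla_mem (hU : IsOpen U) {α : M → Form n} (hα : SmoothOn n U α) {p : ℕ}
    (hp : HasDegree U p α) (hx : x ∈ U) (a : Fin n) :
    F.nabla a α x ∈ ⋀[ℝ]^p (Fin n → ℝ) := by
  rw [nabla_eq]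
  refine Submodule.sub_mem _ ?_ (rot_mem (hp x hx))
  rw [dirDeriv_congr hU hx (fun y hy => (degPart_of_mem (hp y hy)).symm)]
  have h := dirDeriv_map hU hα hx (degPartL p) (F.X a x)
  simp only [degPartL_apply] at h
  rw [h]
  exact degPart_mem _ _

/-- Contracted products are rotation invariant, so ∇ obeys the Leibniz rule on them; it is applied
to a product that vanishes on all of U. -/
theorem cw_nabla (hU : IsOpen U) {α β : M → Form n} (hα : SmoothOn n U α)
    (hβ : SmoothOn n U β) (k : ℕ) (h : ∀ y ∈ U, cw F.η k (α y) (β y) = 0) (hx : x ∈ U)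
    (a : Fin n) :
    cw F.η k (F.nabla a α x) (β x) + cw F.η k (α x) (F.nabla a β x) = 0 := by
  have h1 := dirDeriv_map₂ hU hα hβ hx (cw F.η k) (F.X a x)
  rw [dirDeriv_congr hU hx h, dirDeriv_const] at h1
  have h2 := rot_cw (η := F.η) (fun b c => F.conn_antisymm a b c x) k (α x) (β x)
  rw [h x hx, map_zero] at h2
  simp only [nabla_eq, map_sub, LinearMap.sub_apply]
  rw [sub_add_sub_comm, ← h1, ← h2, sub_zero]

theorem extD_mem (hU : IsOpen U) {α : M → Form n} (hα : SmoothOn n U α) {p : ℕ}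
    (hp : HasDegree U p α) (hx : x ∈ U) : F.extD α x ∈ ⋀[ℝ]^(p + 1) (Fin n → ℝ) :=
  Submodule.sum_mem _ fun a _ => mem_one_mul a (F.nabla_mem hU hα hp hx a)

/-! ### Killing-Yano forms and Hodge duality -/

variable {F}

theorem IsKY.smoothOn {w : M → Form n} (h : F.IsKY w) : SmoothOn n U w := h.1.1

theorem IsCCKY.smoothOn {w : M → Form n} (h : F.IsCCKY w) : SmoothOn n U w := h.1.1

theorem degFun_zero (f : ℕ → ℝ) : degFun f (0 : Form n) = 0 := by
  rw [← degFunL_apply, map_zero]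

theorem IsKY.nabla_eq (hU : IsOpen U) {p : ℕ} {w : M → Form n} (h : F.IsKY w)
    (hp : HasDegree U p w) (hx : x ∈ U) (a : Fin n) :
    F.nabla a w x = (1 / ((p : ℝ) + 1)) • hook a (F.extD w x) := by
  have h1 := h.1.2 x hx a
  rw [h.2 x hx, mul_zero, degFun_zero, add_zero, sub_eq_zero] at h1
  rw [h1, degFun_of_mem _ (hook_mem a (F.extD_mem hU h.smoothOn hp hx))]

/-- The factor 1/(p+1) is kept apart because it also occurs in the KY equation, so one scalar
governs both coefficients in the pointwise computation. -/
theorem zeroK_eq (hU : IsOpen U) {p : ℕ} {w : M → Form n} (hw : SmoothOn n U w)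
    (hp : HasDegree U p w) (hx : x ∈ U) :
    F.zeroK w x = ((p : ℝ) / 2 * (1 / ((p : ℝ) + 1))) • F.extD w x := by
  rw [zeroK, degFun_of_mem _ (F.extD_mem hU hw hp hx)]
  congr 1
  push_cast
  have : (p : ℝ) + 1 ≠ 0 := by positivity
  field_simp
  ring

variable (F)

theorem smoothOn_dual {w : M → Form n} (hw : SmoothOn n U w) : SmoothOn n U (F.dual w) :=
  hw.map (cmulL F.η eps)

theorem extD_dual (hU : IsOpen U) {w : M → Form n} (hw : SmoothOn n U w) (hx : x ∈ U) :
    F.extD (F.dual w) x = (-1 : ℝ) ^ n • cmul F.η eps (F.coD w x) := by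
  simp only [extD, coD, cmul_neg, cmul_sum, F.nabla_dual hU hw hx, eps_cmul_hookUp]
  rw [← Finset.smul_sum, neg_smul, neg_neg, smul_smul, ← sq, neg_one_pow_sq, one_smul]

theorem coD_dual (hU : IsOpen U) {w : M → Form n} (hw : SmoothOn n U w) (hx : x ∈ U) :
    F.coD (F.dual w) x = (-1 : ℝ) ^ n • cmul F.η eps (F.extD w x) := by
  simp only [extD, coD, cmul_sum, F.nabla_dual hU hw hx, eps_cmul_e_mul]
  rw [← Finset.smul_sum, neg_smul, smul_neg, smul_smul, ← sq, neg_one_pow_sq, one_smul]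

variable {F}

/-- Duality is parallel and exchanges d with δ, wedge with contraction and π with n - π, hence the
two correction terms of the conformal equation. -/
theorem IsCCKY.isKY_dual (hU : IsOpen U) {w : M → Form n} (h : F.IsCCKY w) :
    F.IsKY (F.dual w) := by
  have hco : ∀ x ∈ U, F.coD (F.dual w) x = 0 := fun x hx => by
    rw [F.coD_dual hU h.smoothOn hx, h.2 x hx, cmul_zero, smul_zero]
  refine ⟨⟨F.smoothOn_dual h.smoothOn, fun x hx a => ?_⟩, hco⟩
  have h1 := congrArg (cmul F.η eps) (h.1.2 x hx a)
  rw [h.2 x hx, hook_zero, degFun_zero, sub_zero, cmul_add, cmul_zero,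
    eps_cmul_degFun F.sign_mul_self (g := fun p => 1 / ((p : ℝ) + 1)) (fun k hk => by
      rw [Nat.cast_sub hk])] at h1
  rw [hco x hx, mul_zero, degFun_zero, add_zero, F.nabla_dual hU h.smoothOn hx, ← h1,
    F.extD_dual hU h.smoothOn hx, sub_eq_add_neg]
  congr 1
  rw [eDown, smul_mul_assoc, cmul_smul, eps_cmul_e_mul, hookUp, smul_comm _ (F.η a), smul_smul,
    F.sign_mul_self, one_smul, hook_smul, neg_smul, ← degFunL_apply, ← degFunL_apply, map_neg]

theorem zeroK_dual (hU : IsOpen U) {w : M → Form n} (hw : SmoothOn n U w) (hx : x ∈ U) :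
    F.zeroK (F.dual w) x = (-(-1 : ℝ) ^ n) • cmul F.η eps (F.zeroM w x) := by
  rw [zeroK, zeroM, F.extD_dual hU hw hx, cmul_neg,
    eps_cmul_degFun F.sign_mul_self (g := fun p => ((p : ℝ) - 1) / (2 * p)) (fun k hk => by
      rw [Nat.cast_sub hk]), ← degFunL_apply, ← degFunL_apply, map_smul, smul_neg, neg_smul,
    neg_neg]

variable (F)

theorem hasDegree_dual {p : ℕ} {w : M → Form n} (hw : HasDegree U p w) (hp : p ≤ n) :
    HasDegree U (n - p) (F.dual w) := fun x hx =>
  eps_cmul_mem F.sign_mul_self (hw x hx) hp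

variable {F}

/-! ### The explicit brackets -/

theorem factorial_ratio {p q : ℕ} (hp : 1 ≤ p) (hq : 1 ≤ q) :
    (((p + q - 2).factorial : ℝ) / ((p - 1).factorial * (q - 1).factorial)) *
      ((p.factorial * q.factorial : ℝ) / (p + q - 1).factorial) = (p * q : ℝ) / (p + q - 1) := by
  obtain ⟨p, rfl⟩ := Nat.exists_eq_add_of_le' hp
  obtain ⟨q, rfl⟩ := Nat.exists_eq_add_of_le' hq
  have h1 : p + 1 + (q + 1) - 2 = p + q := by omega
  have h2 : p + 1 + (q + 1) - 1 = p + q + 1 := by omega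
  rw [h1, h2, Nat.add_sub_cancel, Nat.add_sub_cancel, Nat.factorial_succ, Nat.factorial_succ,
    Nat.factorial_succ]
  push_cast
  have h3 : ((p : ℝ) + 1 + (q + 1) - 1) = p + q + 1 := by ring
  rw [h3]
  have := Nat.factorial_ne_zero p
  have := Nat.factorial_ne_zero q
  have := Nat.factorial_ne_zero (p + q)
  have : (p : ℝ) + q + 1 ≠ 0 := by positivity
  field_simp

/-- Only the first degree has to be odd. This generality is used for the mixed bracket, where the
second form is a dual of degree n - c and arbitrary parity. -/
theorem bracketKK_eq (hU : IsOpen U) {p q : ℕ} {κ lam : M → Form n} (hp : Odd p) (hq : 1 ≤ q)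
    (hκ : F.IsKY κ) (hκp : HasDegree U p κ) (hlam : F.IsKY lam) (hlamq : HasDegree U q lam)
    (h : F.TraceKK κ lam) (hx : x ∈ U) :
    F.bracketKK κ lam x =
      (((p + q - 2).factorial : ℝ) / ((p - 1).factorial * (q - 1).factorial)) •
        F.snBracket p q κ lam x := by
  have h1 := degFun_sum_e_mul_firstOrderCoeff (η := F.η) F.sign_mul_self hp (hκp x hx)
    (F.extD_mem hU hκ.smoothOn hκp hx) (hlamq x hx) (F.extD_mem hU hlam.smoothOn hlamq hx)
    (r := 1 / ((q : ℝ) + 1)) (r' := 1 / ((p : ℝ) + 1)) (by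
      intro m hm hm2 c
      have h2 := F.cw_nabla hU hκ.smoothOn hlam.smoothOn m
        (fun y hy => cw_eq_zero_of_trace hp (hκp y hy) (hlamq y hy) (h y hy) hm hm2) hx c
      rw [hκ.nabla_eq hU hκp hx, hlam.nabla_eq hU hlamq hx] at h2
      simpa only [map_smul, LinearMap.smul_apply] using h2)
  rw [snBracket, smul_smul, factorial_ratio hp.pos hq]
  simp only [← hκ.nabla_eq hU hκp hx, ← hlam.nabla_eq hU hlamq hx,
    ← zeroK_eq hU hκ.smoothOn hκp hx, ← zeroK_eq hU hlam.smoothOn hlamq hx] at h1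
  exact h1

theorem neg_neg_one_pow_mul_self (n : ℕ) : -(-1 : ℝ) ^ n * -(-1 : ℝ) ^ n = 1 := by
  rw [neg_mul_neg, ← sq, neg_one_pow_sq]

theorem eps_cmul_symbM (w : M → Form n) (a : Fin n) (x : M) :
    cmul F.η eps (F.symbM w a x) = (-(-1 : ℝ) ^ n) • F.symbK (F.dual w) a x :=
  eps_cmul_e_mul a (w x)

theorem eps_cmul_dsymbM (hU : IsOpen U) {w : M → Form n} (hw : SmoothOn n U w) (hx : x ∈ U)
    (a b : Fin n) :
    cmul F.η eps (F.dsymbM w x a b) = (-(-1 : ℝ) ^ n) • F.dsymbK (F.dual w) x a b := by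
  rw [dsymbM, eps_cmul_e_mul, dsymbK, F.nabla_dual hU hw hx]

theorem eps_cmul_zeroM (hU : IsOpen U) {w : M → Form n} (hw : SmoothOn n U w) (hx : x ∈ U) :
    cmul F.η eps (F.zeroM w x) = (-(-1 : ℝ) ^ n) • F.zeroK (F.dual w) x := by
  rw [zeroK_dual hU hw hx, smul_smul, neg_neg_one_pow_mul_self, one_smul]

theorem inv_of_even_mem {p : ℕ} {w : Form n} (hw : w ∈ ⋀[ℝ]^p (Fin n → ℝ)) (hp : Even p) :
    inv w = w := by
  rw [inv_of_mem hw, hp.neg_one_pow, one_smul]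

theorem inv_symbK {p : ℕ} {μ : M → Form n} (hp : Odd p) (hμ : HasDegree U p μ) (hx : x ∈ U)
    (a : Fin n) : inv (F.symbK μ a x) = F.symbK μ a x := by
  rw [symbK, hookUp, map_smul, inv_hook, inv_of_mem (hμ x hx), hp.neg_one_pow, neg_one_smul,
    hook_neg, neg_neg]

/-- One sign -(-1)^n comes from dualizing the M-type coefficients, an equal one from turning X_b ⌟
into e_b ∧; they cancel. -/
theorem eps_cmul_bracketKM (hU : IsOpen U) {p : ℕ} {μ w : M → Form n} (hp : Odd p)
    (hμ : SmoothOn n U μ) (hμp : HasDegree U p μ) (hw : SmoothOn n U w) (hx : x ∈ U) :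
    cmul F.η eps (F.bracketKM μ w x) = F.bracketKK μ (F.dual w) x := by
  have hz : inv (F.zeroK μ x) = F.zeroK μ x := by
    rw [zeroK_eq hU hμ hμp hx, map_smul,
      inv_of_even_mem (F.extD_mem hU hμ hμp hx) hp.add_one]
  rw [bracketKM, eps_cmul_degFun F.sign_mul_self (g := fun p => 1 / (p : ℝ)) (fun k hk => by
      rw [Nat.cast_sub hk]), bracketKK, cmul_sum]
  congr 1
  refine Finset.sum_congr rfl fun b _ => ?_
  have h1 : ∀ v : Form n, hook b v = F.η b • hookUp F.η b v := fun v => by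
    rw [hookUp, smul_smul, F.sign_mul_self, one_smul]
  rw [h1, cmul_smul, eps_cmul_hookUp,
    eps_cmul_firstOrderCoeff_of_even (inv_symbK hp hμp hx) hz]
  simp only [eps_cmul_symbM, eps_cmul_dsymbM hU hw hx, eps_cmul_zeroM hU hw hx]
  rw [firstOrderCoeff_smul_right, mul_smul_comm, smul_smul (-(-1 : ℝ) ^ n),
    neg_neg_one_pow_mul_self, one_smul, eDown, smul_mul_assoc]

/-- As ε is central for odd n, its two copies can be shared between the two factors. Their product
is a scalar, hence commutes with the trace and with π⁻¹. -/
theorem eps_eps_cmul_bracketMM (hU : IsOpen U) (hn : Odd n) {α β : M → Form n}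
    (hα : SmoothOn n U α) (hβ : SmoothOn n U β) (hx : x ∈ U) :
    cmul F.η eps (cmul F.η eps (F.bracketMM α β x)) =
      F.bracketKK (F.dual α) (F.dual β) x := by
  have h1 : ∀ v : Form n, cmul F.η eps (cmul F.η eps v) =
      (cmulL F.η eps ∘ₗ cmulL F.η eps) v := fun _ => rfl
  have h2 : ∀ v : Form n, cmul F.η eps (cmul F.η eps (degFun (fun p => 1 / (p : ℝ)) v)) =
      degFun (fun p => 1 / (p : ℝ)) (cmul F.η eps (cmul F.η eps v)) := by
    intro v
    rw [eps_eps_cmul, eps_eps_cmul, ← degFunL_apply, ← degFunL_apply, map_smul]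
  rw [bracketMM, h2, bracketKK, cmul_sum, cmul_sum]
  congr 1
  refine Finset.sum_congr rfl fun b _ => ?_
  rw [eps_eps_cmul, ← mul_smul_comm, ← eps_eps_cmul, eps_eps_cmul_firstOrderCoeff hn]
  simp only [eps_cmul_symbM, eps_cmul_dsymbM hU hα hx, eps_cmul_zeroM hU hα hx,
    eps_cmul_dsymbM hU hβ hx, eps_cmul_zeroM hU hβ hx]
  rw [firstOrderCoeff_smul_right, firstOrderCoeff_smul_left, smul_smul, neg_neg_one_pow_mul_self,
    one_smul]

theorem TraceKM.traceKK {p : ℕ} {μ w : M → Form n} (hp : Odd p)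
    (hμp : HasDegree U p μ) (h : F.TraceKM μ w) : F.TraceKK μ (F.dual w) := by
  intro x hx
  have h1 := congrArg (cmul F.η eps) (h x hx)
  rw [cmul_sum, cmul_zero] at h1
  have h2 : ∀ a, cmul F.η eps (ccomm F.η (hookUp F.η a (μ x)) (eDown F.η a * w x)) =
      (-(-1 : ℝ) ^ n) • ccomm F.η (hookUp F.η a (μ x)) (hook a (F.dual w x)) := by
    intro a
    have h3 : inv (hookUp F.η a (μ x)) = hookUp F.η a (μ x) := inv_symbK hp hμp hx a
    have h4 : cmul F.η eps (eDown F.η a * w x) = (-(-1 : ℝ) ^ n) • hook a (F.dual w x) := by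
      rw [eDown, smul_mul_assoc, cmul_smul, eps_cmul_e_mul, hookUp, smul_comm (F.η a), smul_smul (F.η a),
        F.sign_mul_self, one_smul]
      rfl
    rw [ccomm, cmul_sub, eps_cmul_cmul_of_even h3, ← cmul_assoc F.η eps (eDown F.η a * w x), h4,
      cmul_smul, smul_cmul, ccomm, smul_sub]
  simp only [h2, ← Finset.smul_sum] at h1
  rcases smul_eq_zero.1 h1 with h0 | h0
  · exact absurd h0 (by simp)
  · exact h0

theorem TraceMM.traceKK (hn : Odd n) {α β : M → Form n}
    (h : F.TraceMM α β) : F.TraceKK (F.dual α) (F.dual β) := by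
  intro x hx
  refine Eq.trans ?_ ((congrArg (fun v => ((∏ a, F.η a) * (-1 : ℝ) ^ (n / 2)) • v)
    (h x hx)).trans (smul_zero _))
  rw [Finset.smul_sum]
  refine Finset.sum_congr rfl fun a _ => ?_
  have h1 : hookUp F.η a (F.dual α x) = (-(-1 : ℝ) ^ n) • cmul F.η eps (e a * α x) := by
    rw [eps_cmul_e_mul, smul_smul, neg_neg_one_pow_mul_self, one_smul]
    rfl
  have h2 : hook a (F.dual β x) = (-(-1 : ℝ) ^ n) • cmul F.η eps (eDown F.η a * β x) := by
    rw [eDown, smul_mul_assoc, cmul_smul, eps_cmul_e_mul, hookUp, smul_comm (F.η a), smul_smul,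
      neg_neg_one_pow_mul_self, one_smul, smul_smul, F.sign_mul_self, one_smul]
    rfl
  have h3 : ∀ v w : Form n, cmul F.η (cmul F.η eps v) (cmul F.η eps w) =
      ((∏ a, F.η a) * (-1 : ℝ) ^ (n / 2)) • cmul F.η v w := by
    intro v w
    rw [cmul_assoc, ← cmul_assoc F.η v, ← eps_cmul_comm_of_odd hn v, cmul_assoc, eps_eps_cmul]
  rw [h1, h2]
  have h4 : ∀ v : Form n, (-(-1 : ℝ) ^ n) • (-(-1 : ℝ) ^ n) • v = v := fun v => by
    rw [smul_smul, neg_neg_one_pow_mul_self, one_smul]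
  simp only [ccomm, smul_cmul, cmul_smul, h3, smul_sub, h4]

theorem signature_sq :
    F.signature * (-1 : ℝ) ^ (n / 2) * (F.signature * (-1 : ℝ) ^ (n / 2)) = 1 :=
  eps_sq_sq F.sign_mul_self

/-- The KY case is applied to the dual form, whose degree n - c is positive because c < n; a second
multiplication by ε undoes the duality up to the sign ε². -/
theorem bracketKM_eq (hU : IsOpen U) {r c : ℕ} {μ w : M → Form n} (hr : Odd r)
    (hc : c < n) (hμ : F.IsKY μ) (hμr : HasDegree U r μ) (hw : F.IsCCKY w)
    (hwc : HasDegree U c w) (h : F.TraceKM μ w) (hx : x ∈ U) :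
    F.bracketKM μ w x =
      (F.signature * (-1 : ℝ) ^ (n / 2) *
        (((r + n - c - 2).factorial : ℝ) / ((r - 1).factorial * (n - c - 1).factorial))) •
          F.dual (F.snBracket r (n - c) μ (F.dual w)) x := by
  have h1 := bracketKK_eq hU hr (q := n - c) (by omega) hμ hμr (hw.isKY_dual hU)
    (F.hasDegree_dual hwc hc.le) (h.traceKK hr hμr) hx
  rw [← eps_cmul_bracketKM hU hr hμ.smoothOn hμr hw.smoothOn hx] at h1
  have h2 := congrArg (cmul F.η eps) h1
  rw [eps_eps_cmul, cmul_smul] at h2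
  have h3 := congrArg (fun v => (F.signature * (-1 : ℝ) ^ (n / 2)) • v) h2
  simp only [smul_smul] at h3
  rw [← signature, signature_sq, one_smul] at h3
  rw [h3, show r + n - c - 2 = r + (n - c) - 2 by omega]
  rfl

theorem bracketMM_eq (hU : IsOpen U) (hn : Odd n) {a b : ℕ} {α β : M → Form n} (ha : Even a)
    (hb : Even b) (han : a ≤ n) (hbn : b ≤ n) (hα : F.IsCCKY α) (hαa : HasDegree U a α)
    (hβ : F.IsCCKY β) (hβb : HasDegree U b β) (h : F.TraceMM α β) (hx : x ∈ U) :
    F.bracketMM α β x =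
      (F.signature * (-1 : ℝ) ^ ((n - 1) / 2) *
        (((2 * n - a - b - 2).factorial : ℝ) /
          ((n - a - 1).factorial * (n - b - 1).factorial))) •
        F.snBracket (n - a) (n - b) (F.dual α) (F.dual β) x := by
  have h1 := bracketKK_eq hU (Nat.Odd.sub_even han hn ha) (Nat.Odd.sub_even hbn hn hb).pos
    (hα.isKY_dual hU) (F.hasDegree_dual hαa han) (hβ.isKY_dual hU) (F.hasDegree_dual hβb hbn)
    (h.traceKK hn) hx
  rw [← eps_eps_cmul_bracketMM hU hn hα.smoothOn hβ.smoothOn hx, eps_eps_cmul] at h1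
  have h3 := congrArg (fun v => (F.signature * (-1 : ℝ) ^ (n / 2)) • v) h1
  simp only [smul_smul] at h3
  rw [← signature, signature_sq, one_smul] at h3
  -- The floor in ε² is that of n/2, equal to (n-1)/2 for odd n.
  have h4 : (n - 1) / 2 = n / 2 := by obtain ⟨k, rfl⟩ := hn; omega
  rw [h3, h4, show 2 * n - a - b - 2 = n - a + (n - b) - 2 by omega]

end OrthonormalFrame

end

end KillingYano

namespace KillingYano

noncomputable section

/-! ### Faithfulness of spinor representations on forms of definite parity -/

section Spinor

variable {n : ℕ} {η : Fin n → ℝ} {S : Type*} [AddCommGroup S] [Module ℝ S]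

/-- The action of forms on spinors. -/
def spinAct (ρ : CliffordAlgebra (quadForm η) →ₐ[ℝ] Module.End ℝ S) :
    Form n →ₗ[ℝ] Module.End ℝ S :=
  ρ.toLinearMap ∘ₗ (toClifford η).toLinearMap

variable (ρ : CliffordAlgebra (quadForm η) →ₐ[ℝ] Module.End ℝ S)

theorem spinAct_apply (w : Form n) : spinAct ρ w = ρ (toClifford η w) := rfl

theorem spinAct_cmul (v w : Form n) : spinAct ρ (cmul η v w) = spinAct ρ v * spinAct ρ w := by
  rw [spinAct_apply, toClifford_cmul, map_mul]
  rfl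

theorem spinAct_one : spinAct ρ (1 : Form n) = 1 := by
  rw [spinAct_apply, toClifford_one, map_one]

theorem eq_smul_one_of_mem_zero {w : Form n} (hw : w ∈ ⋀[ℝ]^0 (Fin n → ℝ)) :
    ∃ r : ℝ, w = r • (1 : Form n) := by
  change w ∈ (LinearMap.range (ExteriorAlgebra.ι ℝ : (Fin n → ℝ) →ₗ[ℝ] _)) ^ 0 at hw
  rw [pow_zero, Submodule.mem_one] at hw
  obtain ⟨r, rfl⟩ := hw
  exact ⟨r, Algebra.algebraMap_eq_smul_one r⟩

/-- If w acts by zero, so does its graded commutator with e_a, which is twice X^a ⌟ w. Contraction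
keeps definite parity and lowers the degree, so induction kills all contractions and leaves a
scalar; a scalar acting by zero on S ≠ 0 is zero. -/
theorem eq_zero_of_spinAct_eq_zero [Nontrivial S] (hη : ∀ a, η a * η a = 1) {σ : ℝ}
    (hσ : σ * σ = 1) {w : Form n} (hw : inv w = σ • w) (h : spinAct ρ w = 0) : w = 0 := by
  suffices H : ∀ (k : ℕ) (σ : ℝ) (w : Form n), σ * σ = 1 → inv w = σ • w → spinAct ρ w = 0 →
      (∀ j, k ≤ j → degPart j w = 0) → w = 0 from
    H (n + 1) σ w hσ hw h fun j hj => eq_zero_of_mem_of_lt (degPart_mem j w) hj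
  clear hσ hw h σ w
  intro k
  induction k with
  | zero =>
    intro σ w _ _ _ hk
    exact Form.ext_degPart fun j => by
      rw [hk j (Nat.zero_le _), ← degPartL_apply, map_zero]
  | succ k ih =>
    intro σ w hσ hw h hk
    have hhook : ∀ a, hook a w = 0 := by
      intro a
      refine ih (-σ) (hook a w) (by linarith) ?_ ?_ ?_
      · rw [inv_hook, hw, hook_smul, neg_smul]
      · have h1 : spinAct ρ (cmul η (e a) w) = 0 := by rw [spinAct_cmul, h, mul_zero]
        have h2 : spinAct ρ (cmul η w (e a)) = 0 := by rw [spinAct_cmul, h, zero_mul]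
        have h3 : hook a w = (1 / 2 * η a) • (cmul η (e a) w - σ • cmul η w (e a)) := by
          rw [cmul_e, cmul_e_right, hw, mul_smul_comm, hookUp, hookUp, hook_smul, smul_comm (η a) σ,
            ← smul_sub, smul_smul, hσ, one_smul, add_sub_sub_cancel]
          rw [← two_smul ℝ, smul_smul, smul_smul]
          rw [show 1 / 2 * η a * 2 * η a = η a * η a by ring, hη, one_smul]
        rw [h3, map_smul, map_sub, map_smul, h1, h2, smul_zero, sub_zero, smul_zero]
      · intro j hj
        rw [degPart_hook, hk (j + 1) (by omega), hook_zero]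
    have h0 : w ∈ ⋀[ℝ]^0 (Fin n → ℝ) := mem_of_degOp (by
      rw [degOp_apply]
      simp [hhook])
    obtain ⟨r, rfl⟩ := eq_smul_one_of_mem_zero h0
    rw [map_smul, spinAct_one] at h
    rcases smul_eq_zero.1 h with hr | hr
    · rw [hr, zero_smul]
    · exact absurd hr one_ne_zero

end Spinor

/-! ### Forms of definite parity -/

section Parity

variable {n : ℕ}

theorem inv_eq_degFun (w : Form n) : inv w = degFun (fun k => (-1 : ℝ) ^ k) w := by
  conv_lhs => rw [← sum_degPart w]
  rw [map_sum]
  exact Finset.sum_congr rfl fun k _ => inv_of_mem (degPart_mem k w)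

theorem inv_degFun (f : ℕ → ℝ) (w : Form n) : inv (degFun f w) = degFun f (inv w) := by
  refine Form.ext_degPart fun k => ?_
  rw [inv_eq_degFun, inv_eq_degFun, degPart_degFun, degPart_degFun, degPart_degFun,
    degPart_degFun, smul_comm]

theorem inv_of_odd {w : Form n} (h : ∀ k, Even k → degPart k w = 0) : inv w = (-1 : ℝ) • w := by
  refine Form.ext_degPart fun k => ?_
  rw [inv_eq_degFun, degPart_degFun, degPart_smul]
  rcases Nat.even_or_odd k with hk | hk
  · rw [h k hk, smul_zero, smul_zero]
  · rw [hk.neg_one_pow]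

theorem inv_of_even {w : Form n} (h : ∀ k, Odd k → degPart k w = 0) : inv w = (1 : ℝ) • w := by
  refine Form.ext_degPart fun k => ?_
  rw [inv_eq_degFun, degPart_degFun, degPart_smul]
  rcases Nat.even_or_odd k with hk | hk
  · rw [hk.neg_one_pow]
  · rw [h k hk, smul_zero, smul_zero]

variable {η : Fin n → ℝ} (A : Fin n → Fin n → ℝ)

theorem inv_rotGen : inv (rotGen η A) = rotGen η A := by
  simp only [rotGen, map_smul, map_sum, inv_cmul, inv_e, neg_cmul, cmul_neg, neg_neg]

end Parity

/-! ### Commutators of first-order operators on spinors -/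

namespace OrthonormalFrame

variable {n : ℕ} {M : Type*} [TopologicalSpace M] [ChartedSpace (EuclideanSpace ℝ (Fin n)) M]
  [IsManifold (𝓡 n) ∞ M] {g : PseudoRiemannianMetric n M} {U : Set M}
  (F : OrthonormalFrame g U) {x : M}

/-- The spin connection form `¼ ω_{abc} e^b e^c`. -/
def spinConn (a : Fin n) (x : M) : Form n := rotGen F.η fun b c => F.conn a b c x

/-- A first-order operator acting on Clifford-algebra valued functions from the left. -/
def formOp (s : Fin n → M → Form n) (t : M → Form n) (W : M → Form n) (x : M) : Form n :=
  ∑ a, cmul F.η (s a x) (dirDeriv W x (F.X a x) + cmul F.η (F.spinConn a x) (W x)) +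
    cmul F.η (t x) (W x)

theorem smoothOn_spinConn (hU : IsOpen U) (a : Fin n) : SmoothOn n U (F.spinConn a) := by
  have h : SmoothOn n U fun x => ∑ b, ∑ c, F.conn a b c x • cmul F.η (e b) (e c) :=
    SmoothOn.sum fun b _ => SmoothOn.sum fun c _ =>
      (F.smoothOn_conn hU a b c).smul (smoothOn_const _)
  exact h.map ((1 / 4 : ℝ) • LinearMap.id)

theorem inv_spinConn (a : Fin n) (x : M) : inv (F.spinConn a x) = F.spinConn a x := inv_rotGen _

/-- Left multiplication by the spin connection is its commutator plus right multiplication. The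
commutator completes the covariant derivative; the right multiplications cancel later, in
`symbol_of_commutator`. -/
theorem dirDeriv_add_spinConn (a : Fin n) (W : M → Form n) (x : M) :
    dirDeriv W x (F.X a x) + cmul F.η (F.spinConn a x) (W x) =
      F.nabla a W x + cmul F.η (W x) (F.spinConn a x) := by
  have h := ccomm_rotGen (η := F.η) (fun b c => F.conn_antisymm a b c x) (W x)
  rw [F.nabla_eq, sub_eq_add_neg, ← h, ccomm, add_assoc]
  congr 1
  exact (sub_add_cancel _ _).symm

variable {S : Type*} [AddCommGroup S] [Module ℝ S] [Module.Finite ℝ S]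

theorem firstOrderOp_spinAct (hU : IsOpen U)
    (ρ : CliffordAlgebra (quadForm F.η) →ₐ[ℝ] Module.End ℝ S)
    (s : Fin n → M → Form n) (t : M → Form n) {W : M → Form n} (hW : SmoothOn n U W) (v : S)
    {ψ : M → S} (hψ : ∀ y ∈ U, ψ y = spinAct ρ (W y) v) (hx : x ∈ U) :
    F.firstOrderOp ρ s t ψ x = spinAct ρ (F.formOp s t W x) v := by
  have h1 : ∀ a, F.spinNabla ρ a ψ x =
      spinAct ρ (dirDeriv W x (F.X a x) + cmul F.η (F.spinConn a x) (W x)) v := by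
    intro a
    have h2 := dirDeriv_map hU hW hx ((LinearMap.applyₗ v) ∘ₗ spinAct ρ) (F.X a x)
    rw [spinNabla, dirDeriv_congr hU hx hψ, map_add, LinearMap.add_apply, hψ x hx]
    refine congrArg₂ (· + ·) h2 ?_
    rw [spinAct_cmul, spinConn, rotGen, map_smul, map_sum]
    simp only [map_sum, map_smul, Module.End.mul_apply, toClifford_cmul, LinearMap.smul_apply,
      LinearMap.sum_apply, map_mul, spinAct_apply]
  rw [firstOrderOp, formOp, hψ x hx, map_add, map_sum, LinearMap.add_apply, LinearMap.sum_apply]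
  simp only [h1, spinAct_cmul, Module.End.mul_apply]
  rfl

theorem smoothOn_cmul {v w : M → Form n} (hv : SmoothOn n U v) (hw : SmoothOn n U w) :
    SmoothOn n U fun y => cmul F.η (v y) (w y) := hv.map₂ hw (cmulL F.η)

theorem smoothOn_formOp (hU : IsOpen U) {s : Fin n → M → Form n} {t W : M → Form n}
    (hs : ∀ a, SmoothOn n U (s a)) (ht : SmoothOn n U t) (hW : SmoothOn n U W) :
    SmoothOn n U (F.formOp s t W) :=
  (SmoothOn.sum fun a _ => F.smoothOn_cmul (hs a)
    ((hW.dirDeriv hU (F.smooth a)).add (F.smoothOn_cmul (F.smoothOn_spinConn hU a) hW))).add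
    (F.smoothOn_cmul ht hW)

theorem inv_formOp (hU : IsOpen U) {s : Fin n → M → Form n} {t W : M → Form n} {σ τ : ℝ}
    (hs : ∀ a, ∀ y ∈ U, inv (s a y) = σ • s a y) (ht : ∀ y ∈ U, inv (t y) = σ • t y)
    (hW : SmoothOn n U W) (hWτ : ∀ y ∈ U, inv (W y) = τ • W y) (hx : x ∈ U) :
    inv (F.formOp s t W x) = (σ * τ) • F.formOp s t W x := by
  have h1 : ∀ a, inv (dirDeriv W x (F.X a x)) = τ • dirDeriv W x (F.X a x) := by
    intro a
    have h2 := dirDeriv_map hU hW hx inv.toLinearMap (F.X a x)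
    have h3 := dirDeriv_map hU hW hx (τ • LinearMap.id) (F.X a x)
    exact h2.symm.trans ((dirDeriv_congr hU hx hWτ _).trans h3)
  simp only [mul_comm σ τ, formOp, map_add, map_sum, inv_cmul, hs _ x hx, ht x hx, h1, hWτ x hx, inv_spinConn,
    smul_cmul, cmul_smul, ← smul_add, ← Finset.smul_sum, smul_smul]

/-- On fields f v with v constant, the operators act through form-valued functions applied to v. The
difference of the two sides has parity στ and kills every v, so it vanishes. -/
theorem formOp_commutator (hU : IsOpen U) [Nontrivial S]
    (ρ : CliffordAlgebra (quadForm F.η) →ₐ[ℝ] Module.End ℝ S)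
    {s t u : Fin n → M → Form n} {s0 t0 u0 : M → Form n} {σ τ : ℝ}
    (hσ : σ * σ = 1) (hτ : τ * τ = 1)
    (hs : ∀ a, SmoothOn n U (s a)) (hs0 : SmoothOn n U s0)
    (ht : ∀ a, SmoothOn n U (t a)) (ht0 : SmoothOn n U t0)
    (hsσ : ∀ a, ∀ y ∈ U, inv (s a y) = σ • s a y) (hs0σ : ∀ y ∈ U, inv (s0 y) = σ • s0 y)
    (htτ : ∀ a, ∀ y ∈ U, inv (t a y) = τ • t a y) (ht0τ : ∀ y ∈ U, inv (t0 y) = τ • t0 y)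
    (hu : ∀ a, ∀ y ∈ U, inv (u a y) = (σ * τ) • u a y)
    (hu0 : ∀ y ∈ U, inv (u0 y) = (σ * τ) • u0 y)
    (h : F.CommutatorEq (F.firstOrderOp ρ s s0) (F.firstOrderOp ρ t t0) (F.firstOrderOp ρ u u0))
    {f : M → ℝ} (hf : SmoothOn n U f) (hx : x ∈ U) :
    F.formOp s s0 (F.formOp t t0 fun y => f y • 1) x -
        F.formOp t t0 (F.formOp s s0 fun y => f y • 1) x =
      F.formOp u u0 (fun y => f y • 1) x := by
  have hW : SmoothOn n U fun y => f y • (1 : Form n) := hf.smul (smoothOn_const _)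
  have hW1 : ∀ y ∈ U, inv (f y • (1 : Form n)) = (1 : ℝ) • f y • (1 : Form n) := by simp
  have hsW := F.smoothOn_formOp hU hs hs0 hW
  have htW := F.smoothOn_formOp hU ht ht0 hW
  have psW : ∀ y ∈ U, _ := fun y hy => F.inv_formOp hU hsσ hs0σ hW hW1 hy
  have ptW : ∀ y ∈ U, _ := fun y hy => F.inv_formOp hU htτ ht0τ hW hW1 hy
  rw [← sub_eq_zero]
  refine eq_zero_of_spinAct_eq_zero ρ F.sign_mul_self (σ := σ * τ) ?_ ?_ ?_
  · rw [mul_mul_mul_comm, hσ, hτ, one_mul]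
  · rw [map_sub, map_sub, F.inv_formOp hU hsσ hs0σ htW ptW hx,
      F.inv_formOp hU htτ ht0τ hsW psW hx, F.inv_formOp hU hu hu0 hW hW1 hx, smul_sub, smul_sub,
      mul_one, mul_one, mul_one, mul_comm τ σ]
  · ext v
    have hψ : SmoothOn n U fun y => f y • v := hf.smul (smoothOn_const _)
    have hψW : ∀ y ∈ U, f y • v = spinAct ρ (f y • (1 : Form n)) v := fun y _ => by
      rw [map_smul, spinAct_one]
      rfl
    have h1 := h (fun y => f y • v) hψ x hx
    rw [F.firstOrderOp_spinAct hU ρ s s0 htW v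
        (fun y hy => F.firstOrderOp_spinAct hU ρ t t0 hW v hψW hy) hx,
      F.firstOrderOp_spinAct hU ρ t t0 hsW v
        (fun y hy => F.firstOrderOp_spinAct hU ρ s s0 hW v hψW hy) hx,
      F.firstOrderOp_spinAct hU ρ u u0 hW v hψW hx] at h1
    rw [map_sub, map_sub, LinearMap.sub_apply, LinearMap.sub_apply, h1, sub_self]
    rfl

end OrthonormalFrame

end

end KillingYano

namespace KillingYano

noncomputable section

/-! ### First-order symbols of commutators -/

namespace OrthonormalFrame

variable {n : ℕ} {M : Type*} [TopologicalSpace M] [ChartedSpace (EuclideanSpace ℝ (Fin n)) M]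
  [IsManifold (𝓡 n) ∞ M] {g : PseudoRiemannianMetric n M} {U : Set M}
  (F : OrthonormalFrame g U) {x : M}

theorem dirDeriv_smul_one (hU : IsOpen U) {f : M → ℝ} (hf : SmoothOn n U f) (hx : x ∈ U)
    (a : Fin n) :
    dirDeriv (fun y => f y • (1 : Form n)) x (F.X a x) = dirDeriv f x (F.X a x) • 1 := by
  rw [dirDeriv_smul hU hf (smoothOn_const _) hx, dirDeriv_const, smul_zero, add_zero]

theorem formOp_smul_one (hU : IsOpen U) (t : Fin n → M → Form n) (t0 : M → Form n)
    {f : M → ℝ} (hf : SmoothOn n U f) (hx : x ∈ U) :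
    F.formOp t t0 (fun y => f y • 1) x = ∑ b, dirDeriv f x (F.X b x) • t b x +
      f x • (∑ b, cmul F.η (t b x) (F.spinConn b x) + t0 x) := by
  simp only [formOp, F.dirDeriv_smul_one hU hf hx, cmul_add, cmul_smul, cmul_one,
    Finset.sum_add_distrib, Finset.smul_sum, smul_add, add_assoc]

/-- The condition f x = 0 removes every term without a derivative of f. -/
theorem formOp_formOp_smul_one (hU : IsOpen U) {s t : Fin n → M → Form n} {s0 t0 : M → Form n}
    (ht : ∀ a, SmoothOn n U (t a)) (ht0 : SmoothOn n U t0)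
    {f : M → ℝ} (hf : SmoothOn n U f) (hx : x ∈ U) (hfx : f x = 0) :
    F.formOp s s0 (F.formOp t t0 fun y => f y • 1) x =
      ∑ a, ∑ b, dirDeriv (fun y => dirDeriv f y (F.X b y)) x (F.X a x) •
          cmul F.η (s a x) (t b x) +
        ∑ b, dirDeriv f x (F.X b x) • (∑ a, cmul F.η (s a x) (F.nabla a (t b) x) +
          (∑ a, cmul F.η (cmul F.η (s a x) (t b x)) (F.spinConn a x) +
            ∑ a, cmul F.η (cmul F.η (s b x) (t a x)) (F.spinConn a x)) +
          (cmul F.η (s b x) (t0 x) + cmul F.η (s0 x) (t b x))) := by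
  have hT : SmoothOn n U fun y => ∑ b, cmul F.η (t b y) (F.spinConn b y) + t0 y :=
    (SmoothOn.sum fun b _ => F.smoothOn_cmul (ht b) (F.smoothOn_spinConn hU b)).add ht0
  have hD : ∀ b, SmoothOn n U fun y => dirDeriv f y (F.X b y) := fun b =>
    hf.dirDeriv hU (F.smooth b)
  have h1 : ∀ a, dirDeriv (F.formOp t t0 fun y => f y • 1) x (F.X a x) =
      ∑ b, (dirDeriv (fun y => dirDeriv f y (F.X b y)) x (F.X a x) • t b x +
        dirDeriv f x (F.X b x) • dirDeriv (t b) x (F.X a x)) +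
      dirDeriv f x (F.X a x) • (∑ b, cmul F.η (t b x) (F.spinConn b x) + t0 x) := by
    intro a
    rw [dirDeriv_congr hU hx fun y hy => F.formOp_smul_one hU t t0 hf hy,
      dirDeriv_add hU (SmoothOn.sum fun b _ => (hD b).smul (ht b)) (hf.smul hT) hx,
      dirDeriv_sum hU (fun b _ => (hD b).smul (ht b)) hx, dirDeriv_smul hU hf hT hx, hfx,
      zero_smul, add_zero]
    congr 1
    exact Finset.sum_congr rfl fun b _ => dirDeriv_smul hU (hD b) (ht b) hx _
  have h2 : F.formOp t t0 (fun y => f y • 1) x = ∑ b, dirDeriv f x (F.X b x) • t b x := by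
    rw [F.formOp_smul_one hU t t0 hf hx, hfx, zero_smul, add_zero]
  have h3 : ∀ a, cmul F.η (s a x) (dirDeriv (F.formOp t t0 fun y => f y • 1) x (F.X a x) +
        cmul F.η (F.spinConn a x) (F.formOp t t0 (fun y => f y • 1) x)) =
      ∑ b, dirDeriv (fun y => dirDeriv f y (F.X b y)) x (F.X a x) • cmul F.η (s a x) (t b x) +
      ∑ b, dirDeriv f x (F.X b x) • (cmul F.η (s a x) (F.nabla a (t b) x) +
        cmul F.η (cmul F.η (s a x) (t b x)) (F.spinConn a x)) +
      dirDeriv f x (F.X a x) • (∑ b, cmul F.η (cmul F.η (s a x) (t b x)) (F.spinConn b x) +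
        cmul F.η (s a x) (t0 x)) := by
    intro a
    have h4 : ∀ b, cmul F.η (s a x) (F.nabla a (t b) x) +
        cmul F.η (cmul F.η (s a x) (t b x)) (F.spinConn a x) =
        cmul F.η (s a x) (dirDeriv (t b) x (F.X a x)) +
          cmul F.η (s a x) (cmul F.η (F.spinConn a x) (t b x)) := by
      intro b
      rw [cmul_assoc, ← cmul_add, ← cmul_add, F.dirDeriv_add_spinConn]
    simp only [h4]
    simp only [h1, h2, cmul_add, cmul_sum, cmul_smul, Finset.sum_add_distrib, smul_add,
      cmul_assoc]
    abel
  rw [formOp, Finset.sum_congr rfl fun a _ => h3 a, h2]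
  simp only [Finset.sum_add_distrib, smul_add, cmul_sum, cmul_smul, Finset.smul_sum]
  rw [Finset.sum_comm (f := fun a b => dirDeriv f x (F.X b x) •
      cmul F.η (s a x) (F.nabla a (t b) x)),
    Finset.sum_comm (f := fun a b => dirDeriv f x (F.X b x) •
      cmul F.η (cmul F.η (s a x) (t b x)) (F.spinConn a x))]
  abel

theorem exists_testFunction [T2Space M] (hx : x ∈ U) (c : Fin n) :
    ∃ f : M → ℝ, SmoothOn n U f ∧ f x = 0 ∧
      ∀ a, dirDeriv f x (F.X a x) = if a = c then 1 else 0 := by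
  let ℓ : TangentSpace (𝓡 n) x →L[ℝ] ℝ := F.η c • g.val x (F.X c x)
  obtain ⟨f, hf, hfx, h⟩ := exists_smooth_dirDeriv x ℓ
  refine ⟨f, ContMDiffOn.mono hf (Set.subset_univ U), hfx, fun a => ?_⟩
  rw [h]
  change F.η c * g.val x (F.X c x) (F.X a x) = _
  rw [F.orthonormal x hx, mul_ite, F.sign_mul_self, mul_zero]
  simp only [eq_comm]

/-- The first-order coefficient of a commutator of first-order operators. -/
theorem symbol_of_commutator [T2Space M] (hU : IsOpen U)
    {s t u : Fin n → M → Form n} {s0 t0 u0 : M → Form n}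
    (hs : ∀ a, SmoothOn n U (s a)) (hs0 : SmoothOn n U s0)
    (ht : ∀ a, SmoothOn n U (t a)) (ht0 : SmoothOn n U t0) (hx : x ∈ U)
    (h : ∀ f : M → ℝ, SmoothOn n U f →
      F.formOp s s0 (F.formOp t t0 fun y => f y • 1) x -
        F.formOp t t0 (F.formOp s s0 fun y => f y • 1) x =
      F.formOp u u0 (fun y => f y • 1) x)
    {ds dt : Fin n → Fin n → Form n}
    (hds : ∀ a b, ds a b = F.nabla a (s b) x + ∑ c, (F.η b * F.conn a b c x) • s c x)
    (hdt : ∀ a b, dt a b = F.nabla a (t b) x + ∑ c, (F.η b * F.conn a b c x) • t c x)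
    (d : Fin n) :
    u d x = firstOrderCoeff F.η (fun a => s a x) ds (s0 x) (fun a => t a x) dt (t0 x) d := by
  set Q : Fin n → Fin n → Form n := fun a b =>
    cmul F.η (s a x) (t b x) - cmul F.η (t a x) (s b x) with hQ
  have key : ∀ f : M → ℝ, SmoothOn n U f → f x = 0 →
      ∑ a, ∑ b, dirDeriv (fun y => dirDeriv f y (F.X b y)) x (F.X a x) • Q a b +
        ∑ b, dirDeriv f x (F.X b x) • (
          ∑ a, (cmul F.η (s a x) (F.nabla a (t b) x) - cmul F.η (t a x) (F.nabla a (s b) x)) +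
          ∑ a, cmul F.η (Q a b + Q b a) (F.spinConn a x) +
          (ccomm F.η (s b x) (t0 x) + ccomm F.η (s0 x) (t b x))) =
      ∑ b, dirDeriv f x (F.X b x) • u b x := by
    intro f hf hfx
    have h1 := h f hf
    rw [F.formOp_formOp_smul_one hU ht ht0 hf hx hfx, F.formOp_formOp_smul_one hU hs hs0 hf hx hfx,
      F.formOp_smul_one hU u u0 hf hx, hfx, zero_smul, add_zero] at h1
    rw [← h1]
    simp only [hQ, ccomm, add_cmul, sub_cmul, smul_add, smul_sub, Finset.sum_add_distrib,
      Finset.sum_sub_distrib]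
    abel
  -- The product of two test functions has zero value and zero first derivatives at x, so it
  -- isolates the symmetric second-order part.
  have hQsymm : ∀ c d, Q c d + Q d c = 0 := by
    intro c d
    obtain ⟨f, hf, hfx, hfc⟩ := F.exists_testFunction hx c
    obtain ⟨f', hf', hfx', hfd⟩ := F.exists_testFunction hx d
    have hD : ∀ b, ∀ y ∈ U, dirDeriv (fun y => f y * f' y) y (F.X b y) =
        dirDeriv f y (F.X b y) * f' y + f y * dirDeriv f' y (F.X b y) := fun b y hy =>
      dirDeriv_mul hU hf hf' hy _
    have hD1 : ∀ b, dirDeriv (fun y => f y * f' y) x (F.X b x) = 0 := fun b => by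
      rw [hD b x hx, hfx, hfx', mul_zero, zero_mul, add_zero]
    have hD2 : ∀ a b, dirDeriv (fun y => dirDeriv (fun y => f y * f' y) y (F.X b y)) x (F.X a x) =
        (if b = c then 1 else 0) * (if a = d then 1 else 0) +
          (if a = c then 1 else 0) * (if b = d then 1 else 0) := fun a b => by
      rw [dirDeriv_congr hU hx (hD b),
        dirDeriv_add hU ((hf.dirDeriv hU (F.smooth b)).mul hf')
          (hf.mul (hf'.dirDeriv hU (F.smooth b))) hx,
        dirDeriv_mul hU (hf.dirDeriv hU (F.smooth b)) hf' hx,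
        dirDeriv_mul hU hf (hf'.dirDeriv hU (F.smooth b)) hx, hfx, hfx', hfc, hfc, hfd, hfd,
        mul_zero, zero_mul, zero_add, add_zero]
    have h1 := key (fun y => f y * f' y) (hf.mul hf') (by simp [hfx])
    simp only [hD1, hD2, zero_smul, Finset.sum_const_zero, add_zero, add_smul, mul_smul, ite_smul,
      one_smul, Finset.sum_add_distrib, Finset.sum_ite_eq', Finset.mem_univ, if_true] at h1
    simpa [add_comm, Finset.sum_add_distrib] using h1
  obtain ⟨f, hf, hfx, hfd⟩ := F.exists_testFunction hx d
  have h1 := key f hf hfx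
  simp only [hfd, hQsymm, ite_smul, one_smul, zero_smul, Finset.sum_ite_eq', Finset.mem_univ,
    if_true, zero_cmul, Finset.sum_const_zero, add_zero] at h1
  have h2 : ∀ a b, dirDeriv (fun y => dirDeriv f y (F.X b y)) x (F.X a x) -
      dirDeriv (fun y => dirDeriv f y (F.X a y)) x (F.X b x) =
        F.η d * (F.conn a d b x - F.conn b d a x) := by
    intro a b
    rw [F.dirDeriv_frame_comm hU hf hx]
    simp [hfd]
  -- Q is antisymmetric, so only the commutator of frame derivatives contributes. Vanishing torsion
  -- turns it into exactly the connection terms that act on the upper index of s^b and t^b.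
  have h3 : ∑ a, ∑ b, dirDeriv (fun y => dirDeriv f y (F.X b y)) x (F.X a x) • Q a b =
      ∑ a, ∑ b, (F.η d * F.conn a d b x) • Q a b := by
    have h4 : ∀ H : Fin n → Fin n → ℝ, (2 : ℝ) • ∑ a, ∑ b, H a b • Q a b =
        ∑ a, ∑ b, (H a b - H b a) • Q a b := by
      intro H
      simp only [sub_smul, Finset.sum_sub_distrib]
      rw [Finset.sum_comm (f := fun a b => H b a • Q a b), two_smul, sub_eq_add_neg,
        ← Finset.sum_neg_distrib]
      congr 1
      refine Finset.sum_congr rfl fun a _ => ?_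
      rw [← Finset.sum_neg_distrib]
      refine Finset.sum_congr rfl fun b _ => ?_
      rw [← smul_neg, eq_neg_of_add_eq_zero_left (hQsymm a b)]
    have h5 : (2 : ℝ) ≠ 0 := two_ne_zero
    apply smul_right_injective _ h5
    simp only [h4, h2, mul_sub]
  rw [← h1, h3, firstOrderCoeff]
  simp only [hds, hdt, hQ, cmul_add, cmul_sum, cmul_smul, smul_sub, Finset.sum_add_distrib,
    Finset.sum_sub_distrib]
  abel

end OrthonormalFrame

end

end KillingYano

namespace KillingYano

noncomputable section

/-! ### Killing-Yano brackets characterized by operator identities -/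

theorem HasDegree.inv_of_odd {n : ℕ} {M : Type*} {U : Set M} {p : ℕ} {w : M → Form n} (h : HasDegree U p w)
    (hp : Odd p) : ∀ y ∈ U, inv (w y) = (-1 : ℝ) • w y := fun y hy => by
  rw [inv_of_mem (h y hy), hp.neg_one_pow]

theorem HasDegree.inv_of_even {n : ℕ} {M : Type*} {U : Set M} {p : ℕ} {w : M → Form n} (h : HasDegree U p w)
    (hp : Even p) : ∀ y ∈ U, inv (w y) = (1 : ℝ) • w y := fun y hy => by
  rw [inv_of_mem (h y hy), hp.neg_one_pow]

namespace OrthonormalFrame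

variable {n : ℕ} {M : Type*} [TopologicalSpace M] [ChartedSpace (EuclideanSpace ℝ (Fin n)) M]
  [IsManifold (𝓡 n) ∞ M] {g : PseudoRiemannianMetric n M} {U : Set M}
  (F : OrthonormalFrame g U) {x : M}

theorem smoothOn_symbK {w : M → Form n} (hw : SmoothOn n U w) (a : Fin n) :
    SmoothOn n U (F.symbK w a) := hw.map (F.η a • hookL a)

theorem smoothOn_symbM {w : M → Form n} (hw : SmoothOn n U w) (a : Fin n) :
    SmoothOn n U (F.symbM w a) := hw.map (LinearMap.mulLeft ℝ (e a))

theorem smoothOn_extD (hU : IsOpen U) {w : M → Form n} (hw : SmoothOn n U w) :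
    SmoothOn n U (F.extD w) :=
  SmoothOn.sum fun a _ => (F.smoothOn_nabla hU hw a).map (LinearMap.mulLeft ℝ (e a))

theorem smoothOn_coD (hU : IsOpen U) {w : M → Form n} (hw : SmoothOn n U w) :
    SmoothOn n U (F.coD w) :=
  ((SmoothOn.sum (s := Finset.univ) fun a _ =>
    (F.smoothOn_nabla hU hw a).map (F.η a • hookL a)).map (-LinearMap.id)).congr fun _ _ => rfl

theorem smoothOn_zeroK (hU : IsOpen U) {w : M → Form n} (hw : SmoothOn n U w) :
    SmoothOn n U (F.zeroK w) :=
  ((F.smoothOn_extD hU hw).map (degFunL fun p => ((p : ℝ) - 1) / (2 * p))).congr fun _ _ =>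
    (degFunL_apply _ _).symm

theorem smoothOn_zeroM (hU : IsOpen U) {w : M → Form n} (hw : SmoothOn n U w) :
    SmoothOn n U (F.zeroM w) :=
  ((F.smoothOn_coD hU hw).map
    (-degFunL fun p => ((n : ℝ) - p - 1) / (2 * ((n : ℝ) - p)))).congr fun y _ => by
      rw [LinearMap.neg_apply, degFunL_apply, zeroM]

theorem inv_nabla (hU : IsOpen U) {w : M → Form n} (hw : SmoothOn n U w) {σ : ℝ}
    (hσ : ∀ y ∈ U, inv (w y) = σ • w y) (hx : x ∈ U) (a : Fin n) :
    inv (F.nabla a w x) = σ • F.nabla a w x := by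
  have h2 := dirDeriv_map hU hw hx inv.toLinearMap (F.X a x)
  have h3 := dirDeriv_map hU hw hx (σ • LinearMap.id) (F.X a x)
  have h4 : inv (dirDeriv w x (F.X a x)) = σ • dirDeriv w x (F.X a x) :=
    h2.symm.trans ((dirDeriv_congr hU hx hσ _).trans h3)
  rw [F.nabla_eq, map_sub, inv_rot, h4, hσ x hx, map_smul, smul_sub]

theorem inv_hookUp {w : Form n} {η : Fin n → ℝ} {σ : ℝ} (h : inv w = σ • w) (a : Fin n) :
    inv (hookUp η a w) = (-σ) • hookUp η a w := by
  rw [hookUp, map_smul, inv_hook, h, hook_smul, neg_smul, smul_neg, smul_comm]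

theorem inv_e_mul_of {w : Form n} {σ : ℝ} (h : inv w = σ • w) (a : Fin n) :
    inv (e a * w) = (-σ) • (e a * w) := by
  rw [inv_e_mul, h, mul_smul_comm, neg_smul]

theorem inv_zeroK (hU : IsOpen U) {w : M → Form n} (hw : SmoothOn n U w) {σ : ℝ}
    (hσ : ∀ y ∈ U, inv (w y) = σ • w y) (hx : x ∈ U) :
    inv (F.zeroK w x) = (-σ) • F.zeroK w x := by
  rw [zeroK, inv_degFun, extD, map_sum]
  simp only [inv_e_mul_of (F.inv_nabla hU hw hσ hx _), ← Finset.smul_sum]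
  rw [← degFunL_apply, ← degFunL_apply, map_smul]

theorem inv_zeroM (hU : IsOpen U) {w : M → Form n} (hw : SmoothOn n U w) {σ : ℝ}
    (hσ : ∀ y ∈ U, inv (w y) = σ • w y) (hx : x ∈ U) :
    inv (F.zeroM w x) = (-σ) • F.zeroM w x := by
  rw [zeroM, map_neg, inv_degFun, coD, map_neg, map_sum]
  simp only [inv_hookUp (F.inv_nabla hU hw hσ hx _), ← Finset.smul_sum]
  rw [← degFunL_apply, ← degFunL_apply, ← smul_neg, map_smul, smul_neg]

/-- For b as a tensor index the connection acts on it too; this is the statement ∇X^b = 0. -/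
theorem dsymbK_eq (hU : IsOpen U) {w : M → Form n} (hw : SmoothOn n U w) (hx : x ∈ U)
    (a b : Fin n) :
    F.dsymbK w x a b =
      F.nabla a (F.symbK w b) x + ∑ c, (F.η b * F.conn a b c x) • F.symbK w c x := by
  have h1 : dirDeriv (F.symbK w b) x (F.X a x) = hookUp F.η b (dirDeriv w x (F.X a x)) :=
    dirDeriv_map hU hw hx (F.η b • hookL b) (F.X a x)
  rw [dsymbK, F.nabla_eq, F.nabla_eq, h1]
  simp only [symbK, hookUp, hook_sub, hook_rot, map_smul, smul_sub, smul_add, Finset.smul_sum,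
    smul_smul]
  rw [sub_add_eq_sub_sub, sub_eq_add_neg (_ - _), ← Finset.sum_neg_distrib]
  congr 1
  refine Finset.sum_congr rfl fun c _ => ?_
  rw [F.conn_antisymm a b c x, ← neg_smul]
  congr 1
  ring

theorem dsymbM_eq (hU : IsOpen U) {w : M → Form n} (hw : SmoothOn n U w) (hx : x ∈ U)
    (a b : Fin n) :
    F.dsymbM w x a b =
      F.nabla a (F.symbM w b) x + ∑ c, (F.η b * F.conn a b c x) • F.symbM w c x := by
  have h1 : dirDeriv (F.symbM w b) x (F.X a x) = e b * dirDeriv w x (F.X a x) :=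
    dirDeriv_map hU hw hx (LinearMap.mulLeft ℝ (e b)) (F.X a x)
  rw [dsymbM, F.nabla_eq, F.nabla_eq, h1]
  simp only [symbM, rot_e_mul, mul_sub]
  abel

/-- The sum is π w, and π⁻¹ inverts it away from degree zero, where 1/0 = 0 is used. -/
theorem degFun_sum_eDown_mul_hookUp {w : Form n} (h : degPart 0 w = 0) :
    degFun (fun p => 1 / (p : ℝ)) (∑ b, eDown F.η b * hookUp F.η b w) = w := by
  have h1 : ∑ b, eDown F.η b * hookUp F.η b w = degOp w := by
    rw [degOp_apply]
    refine Finset.sum_congr rfl fun b _ => ?_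
    rw [eDown, hookUp, smul_mul_smul_comm, F.sign_mul_self, one_smul]
  refine Form.ext_degPart fun k => ?_
  rw [h1, degPart_degFun, degPart_degOp, smul_smul]
  rcases Nat.eq_zero_or_pos k with rfl | hk
  · rw [h, smul_zero]
  · have : (k : ℝ) ≠ 0 := by positivity
    rw [one_div_mul_cancel this, one_smul]

/-- The sum is (n - π) w, invertible away from degree n; hence the normalization of the mixed
bracket. -/
theorem degFun_sum_hook_e_mul {w : Form n} (h : degPart n w = 0) :
    degFun (fun p => 1 / ((n : ℝ) - p)) (∑ b, hook b (e b * w)) = w := by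
  have h1 : ∑ b, hook b (e b * w) = (n : ℝ) • w - degOp w := by
    simp [hook_e_mul, degOp_apply, Finset.sum_sub_distrib, Nat.cast_smul_eq_nsmul]
  refine Form.ext_degPart fun k => ?_
  rw [h1, degPart_degFun, ← degPartL_apply k (_ - _), map_sub, map_smul, degPartL_apply,
    degPartL_apply, degPart_degOp, ← sub_smul, smul_smul]
  by_cases hk : (n : ℝ) - k = 0
  · have : n = k := by exact_mod_cast sub_eq_zero.1 hk
    rw [← this, h, smul_zero]
  · rw [one_div_mul_cancel hk, one_smul]

variable {F} {S : Type*} [AddCommGroup S] [Module ℝ S] [Module.Finite ℝ S] [Nontrivial S]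
  {ρ : CliffordAlgebra (quadForm F.η) →ₐ[ℝ] Module.End ℝ S}

/-- The symbol X^b ⌟ φ of K_φ must equal the first-order coefficient of the commutator, and its
wedge trace determines φ because an odd form has no part of degree zero. -/
theorem IsBracketKK.eq_bracketKK [T2Space M] (hU : IsOpen U) {p q : ℕ} {κ lam φ : M → Form n}
    (hp : Odd p) (hq : Odd q) (hκ : SmoothOn n U κ) (hκp : HasDegree U p κ)
    (hlam : SmoothOn n U lam) (hlamq : HasDegree U q lam) (h : F.IsBracketKK ρ κ lam φ)
    (hx : x ∈ U) : φ x = F.bracketKK κ lam x := by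
  obtain ⟨hφ, hodd, hcomm⟩ := h
  have iκ := hκp.inv_of_odd hp
  have il := hlamq.inv_of_odd hq
  have iφ : ∀ y ∈ U, inv (φ y) = (-1 : ℝ) • φ y := fun y hy => KillingYano.inv_of_odd (hodd y hy)
  have h1 := F.symbol_of_commutator hU (fun a => F.smoothOn_symbK hκ a)
    (F.smoothOn_zeroK hU hκ) (fun a => F.smoothOn_symbK hlam a) (F.smoothOn_zeroK hU hlam) hx
    (fun f hf => F.formOp_commutator hU ρ (u := F.symbK φ) (u0 := F.zeroK φ) (by norm_num)
      (by norm_num) (fun a => F.smoothOn_symbK hκ a) (F.smoothOn_zeroK hU hκ)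
      (fun a => F.smoothOn_symbK hlam a) (F.smoothOn_zeroK hU hlam)
      (fun a y hy => inv_hookUp (iκ y hy) a) (fun y hy => F.inv_zeroK hU hκ iκ hy)
      (fun a y hy => inv_hookUp (il y hy) a) (fun y hy => F.inv_zeroK hU hlam il hy)
      (fun a y hy => (inv_hookUp (iφ y hy) a).trans (by norm_num [symbK]))
      (fun y hy => (F.inv_zeroK hU hφ.smoothOn iφ hy).trans (by norm_num)) hcomm hf hx)
    (F.dsymbK_eq hU hκ hx) (F.dsymbK_eq hU hlam hx)
  rw [bracketKK]
  simp only [← h1]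
  exact (F.degFun_sum_eDown_mul_hookUp (hodd x hx 0 Even.zero)).symm

theorem IsBracketMM.eq_bracketMM [T2Space M] (hU : IsOpen U) {p q : ℕ} {α β φ : M → Form n}
    (hp : Even p) (hq : Even q) (hα : SmoothOn n U α) (hαp : HasDegree U p α)
    (hβ : SmoothOn n U β) (hβq : HasDegree U q β) (h : F.IsBracketMM ρ α β φ)
    (hx : x ∈ U) : φ x = F.bracketMM α β x := by
  obtain ⟨hφ, hodd, hcomm⟩ := h
  have iα := hαp.inv_of_even hp
  have iβ := hβq.inv_of_even hq
  have iφ : ∀ y ∈ U, inv (φ y) = (-1 : ℝ) • φ y := fun y hy => KillingYano.inv_of_odd (hodd y hy)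
  have h1 := F.symbol_of_commutator hU (fun a => F.smoothOn_symbM hα a)
    (F.smoothOn_zeroM hU hα) (fun a => F.smoothOn_symbM hβ a) (F.smoothOn_zeroM hU hβ) hx
    (fun f hf => F.formOp_commutator hU ρ (u := F.symbK φ) (u0 := F.zeroK φ) (by norm_num)
      (by norm_num) (fun a => F.smoothOn_symbM hα a) (F.smoothOn_zeroM hU hα)
      (fun a => F.smoothOn_symbM hβ a) (F.smoothOn_zeroM hU hβ)
      (fun a y hy => inv_e_mul_of (iα y hy) a) (fun y hy => F.inv_zeroM hU hα iα hy)
      (fun a y hy => inv_e_mul_of (iβ y hy) a) (fun y hy => F.inv_zeroM hU hβ iβ hy)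
      (fun a y hy => (inv_hookUp (iφ y hy) a).trans (by norm_num [symbK]))
      (fun y hy => (F.inv_zeroK hU hφ.smoothOn iφ hy).trans (by norm_num)) hcomm hf hx)
    (F.dsymbM_eq hU hα hx) (F.dsymbM_eq hU hβ hx)
  rw [bracketMM]
  simp only [← h1]
  exact (F.degFun_sum_eDown_mul_hookUp (hodd x hx 0 Even.zero)).symm

theorem IsBracketKM.eq_bracketKM [T2Space M] (hU : IsOpen U) {p q : ℕ} {μ w φ : M → Form n}
    (hp : Odd p) (hq : Even q) (hμ : SmoothOn n U μ) (hμp : HasDegree U p μ)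
    (hw : SmoothOn n U w) (hwq : HasDegree U q w) (h : F.IsBracketKM ρ μ w φ)
    (hx : x ∈ U) : φ x = F.bracketKM μ w x := by
  obtain ⟨hφ, heven, htop, hcomm⟩ := h
  have iμ := hμp.inv_of_odd hp
  have iw := hwq.inv_of_even hq
  have iφ : ∀ y ∈ U, inv (φ y) = (1 : ℝ) • φ y := fun y hy => KillingYano.inv_of_even (heven y hy)
  have h1 := F.symbol_of_commutator hU (fun a => F.smoothOn_symbK hμ a)
    (F.smoothOn_zeroK hU hμ) (fun a => F.smoothOn_symbM hw a) (F.smoothOn_zeroM hU hw) hx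
    (fun f hf => F.formOp_commutator hU ρ (u := F.symbM φ) (u0 := F.zeroM φ) (by norm_num)
      (by norm_num) (fun a => F.smoothOn_symbK hμ a) (F.smoothOn_zeroK hU hμ)
      (fun a => F.smoothOn_symbM hw a) (F.smoothOn_zeroM hU hw)
      (fun a y hy => inv_hookUp (iμ y hy) a) (fun y hy => F.inv_zeroK hU hμ iμ hy)
      (fun a y hy => inv_e_mul_of (iw y hy) a) (fun y hy => F.inv_zeroM hU hw iw hy)
      (fun a y hy => (inv_e_mul_of (iφ y hy) a).trans (by norm_num [symbM]))
      (fun y hy => (F.inv_zeroM hU hφ.smoothOn iφ hy).trans (by norm_num)) hcomm hf hx)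
    (F.dsymbK_eq hU hμ hx) (F.dsymbM_eq hU hw hx)
  rw [bracketKM]
  simp only [← h1]
  exact (degFun_sum_hook_e_mul (htop x hx)).symm

end OrthonormalFrame

end

end KillingYano

/-! ### The three brackets, explicit and characterized by operator identities -/

theorem mainTheorem10 {n : ℕ} {M : Type*} [TopologicalSpace M] [T2Space M]
    [ChartedSpace (EuclideanSpace ℝ (Fin n)) M] [IsManifold (𝓡 n) ∞ M]
    (g : KillingYano.PseudoRiemannianMetric n M) {U : Set M} (hU : IsOpen U)
    (F : KillingYano.OrthonormalFrame g U)
    {S : Type*} [AddCommGroup S] [Module ℝ S] [Module.Finite ℝ S] [Nontrivial S]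
    (ρ : CliffordAlgebra (KillingYano.quadForm F.η) →ₐ[ℝ] Module.End ℝ S) :
    (∀ (p q : ℕ) (κ lam : M → KillingYano.Form n), Odd p → Odd q →
      F.IsKY κ → KillingYano.HasDegree U p κ → F.IsKY lam → KillingYano.HasDegree U q lam →
      F.TraceKK κ lam →
        (∀ x ∈ U, F.bracketKK κ lam x =
          (((p + q - 2).factorial : ℝ) / ((p - 1).factorial * (q - 1).factorial)) •
            F.snBracket p q κ lam x) ∧
        (∀ φ : M → KillingYano.Form n, F.IsBracketKK ρ κ lam φ → ∀ x ∈ U, φ x =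
          (((p + q - 2).factorial : ℝ) / ((p - 1).factorial * (q - 1).factorial)) •
            F.snBracket p q κ lam x)) ∧
    (∀ (r c : ℕ) (μ w : M → KillingYano.Form n), Odd r → Even c → c < n →
      F.IsKY μ → KillingYano.HasDegree U r μ → F.IsCCKY w → KillingYano.HasDegree U c w →
      F.TraceKM μ w →
        (∀ x ∈ U, F.bracketKM μ w x =
          (F.signature * (-1 : ℝ) ^ (n / 2) *
            (((r + n - c - 2).factorial : ℝ) / ((r - 1).factorial * (n - c - 1).factorial))) •
            F.dual (F.snBracket r (n - c) μ (F.dual w)) x) ∧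
        (∀ φ : M → KillingYano.Form n, F.IsBracketKM ρ μ w φ → ∀ x ∈ U, φ x =
          (F.signature * (-1 : ℝ) ^ (n / 2) *
            (((r + n - c - 2).factorial : ℝ) / ((r - 1).factorial * (n - c - 1).factorial))) •
            F.dual (F.snBracket r (n - c) μ (F.dual w)) x)) ∧
    (Odd n → ∀ (a b : ℕ) (α β : M → KillingYano.Form n), Even a → Even b → a ≤ n → b ≤ n →
      F.IsCCKY α → KillingYano.HasDegree U a α → F.IsCCKY β → KillingYano.HasDegree U b β →
      F.TraceMM α β →
        (∀ x ∈ U, F.bracketMM α β x =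
          (F.signature * (-1 : ℝ) ^ ((n - 1) / 2) *
            (((2 * n - a - b - 2).factorial : ℝ) /
              ((n - a - 1).factorial * (n - b - 1).factorial))) •
            F.snBracket (n - a) (n - b) (F.dual α) (F.dual β) x) ∧
        (∀ φ : M → KillingYano.Form n, F.IsBracketMM ρ α β φ → ∀ x ∈ U, φ x =
          (F.signature * (-1 : ℝ) ^ ((n - 1) / 2) *
            (((2 * n - a - b - 2).factorial : ℝ) /
              ((n - a - 1).factorial * (n - b - 1).factorial))) •
            F.snBracket (n - a) (n - b) (F.dual α) (F.dual β) x)) := by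
  refine ⟨fun p q κ lam hp hq hκ hκp hlam hlamq h => ?_,
    fun r c μ w hr hc hcn hμ hμr hw hwc h => ?_,
    fun hn a b α β ha hb han hbn hα hαa hβ hβb h => ?_⟩
  · have h1 : ∀ x ∈ U, _ := fun x hx =>
      KillingYano.OrthonormalFrame.bracketKK_eq hU hp hq.pos hκ hκp hlam hlamq h hx
    exact ⟨h1, fun φ hφ x hx => (hφ.eq_bracketKK hU hp hq hκ.smoothOn hκp hlam.smoothOn hlamq
      hx).trans (h1 x hx)⟩
  · have h1 : ∀ x ∈ U, _ := fun x hx =>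
      KillingYano.OrthonormalFrame.bracketKM_eq hU hr hcn hμ hμr hw hwc h hx
    exact ⟨h1, fun φ hφ x hx => (hφ.eq_bracketKM hU hr hc hμ.smoothOn hμr hw.smoothOn hwc
      hx).trans (h1 x hx)⟩
  · have h1 : ∀ x ∈ U, _ := fun x hx =>
      KillingYano.OrthonormalFrame.bracketMM_eq hU hn ha hb han hbn hα hαa hβ hβb h hx
    exact ⟨h1, fun φ hφ x hx => (hφ.eq_bracketMM hU ha hb hα.smoothOn hαa hβ.smoothOn hβb
      hx).trans (h1 x hx)⟩
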